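/- Let $M$ be a smooth Riemannian manifold (not necessarily complete) with $\dim M>3$ and Levi-Civita connection $\nabla^0$, and let $\mathcal V$ be a smooth unit vector field on $M$ that is anti-torqued with conformal scalar the smooth function $f$, that is, $\nabla^0_X\mathcal V=f\,(X-\langle X,\mathcal V\rangle\mathcal V)$ for all $X$. Let $\phi:N\to M$ be a smooth immersed hypersurface with a smooth unit normal field $U$ such that $\langle U,\mathcal V\rangle=\cos\theta$ on $N$ for a constant $\theta\in[0,\pi]$ and the tangential part $\mathcal V^{\top}=\mathcal V-\langle \mathcal V,U\rangle U$ vanishes nowhere on $N$. Put $T=\mathcal V^\top/|\mathcal V^\top|$, let $\mathcal D=T^\perp\subset TN$, let $A(X)=-\nabla^0_XU$ be the shape operator, and suppose that $A|_{\mathcal D}=\delta\,\mathrm{Id}$ for some function $\delta$ on $N$. (1) Either $\cos\theta=0$ and $N$ is locally ruled, i.e. every point of $N$ has a neighbourhood in $N$ that is smoothly foliated by geodesics of $M$; or $\cos\theta\neq0$ and $N$ is locally a twisted product: every point of $N$ has a neighbourhood which, with the induced metric, is isometric to $I\times_\lambda F$, where $I$ is an open interval with coordinate $s$, $F$ is a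 Riemannian manifold, and $\lambda>0$ is a smooth function on $I\times F$, with metric $ds^2+\lambda^2\langle\,,\rangle_F$, such that $\partial_s=T$ and $$\partial_s(\log\lambda)=\cot\theta\,\delta+\frac{f}{\sin\theta}.$$ (2) If in addition $M$ is the Euclidean space $\mathbb R^m$ or the hyperbolic space $\mathbb H^m$, or an open subset of one of them, then (whatever $\theta$ is) $N$ is locally a warped product: every point of $N$ has a neighbourhood isometric as above to $I\times_\lambda F$ with $\partial_s=T$, with the same formula for $(\log\lambda)'$, and with $\lambda$ depending on $s$ only. -/

import Mathlib

open Bundle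
open scoped Manifold ContDiff

noncomputable section

namespace ConstantAngle

section Connection

variable {E : Type*} [NormedAddCommGroup E] [NormedSpace ℝ E] [FiniteDimensional ℝ E]
  {H : Type*} [TopologicalSpace H] (I : ModelWithCorners ℝ E H)
  {M : Type*} [TopologicalSpace M] [ChartedSpace H M] [IsManifold I ∞ M]
  [RiemannianBundle (fun x : M ↦ TangentSpace I x)]
  {E' : Type*} [NormedAddCommGroup E'] [NormedSpace ℝ E']
  {H' : Type*} [TopologicalSpace H'] (I' : ModelWithCorners ℝ E' H')
  {S : Type*} [TopologicalSpace S] [ChartedSpace H' S]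

instance (p : M) : FiniteDimensional ℝ (TangentSpace I p) :=
  inferInstanceAs (FiniteDimensional ℝ E)

/-- The Christoffel symbols of the first kind at `p`, in the chart at `p`:
`Γ(a, b; c) = (a⟨b, c⟩ + b⟨a, c⟩ - c⟨a, b⟩) / 2`, where the three tangent vectors at `p` are
extended to the vector fields whose components in the chart at `p` are constant. -/
def christoffelFirst (p : M) (a b c : TangentSpace I p) : ℝ :=
  (mvfderiv I (fun q : M ↦ inner ℝ (FiberBundle.extend E b q) (FiberBundle.extend E c q)) p a
    + mvfderiv I (fun q : M ↦ inner ℝ (FiberBundle.extend E a q) (FiberBundle.extend E c q)) p b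
    - mvfderiv I (fun q : M ↦ inner ℝ (FiberBundle.extend E a q) (FiberBundle.extend E b q)) p c)
    / 2

/-- The Christoffel symbols of the second kind at `p`, in the chart at `p`: the tangent vector
`Γ(a, b)` with `⟨Γ(a, b), c⟩ = Γ(a, b; c)` for all `c`. -/
def christoffel (p : M) (a b : TangentSpace I p) : TangentSpace I p :=
  ∑ i, christoffelFirst I p a b (stdOrthonormalBasis ℝ (TangentSpace I p) i) •
    stdOrthonormalBasis ℝ (TangentSpace I p) i

/-- The Levi-Civita covariant derivative `∇⁰_v Y` of a vector field `Y` along a map `φ : S → M`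
in the direction `v ∈ T_x S`: in the chart at `φ x`, it is
`dYᵏ(v) + Γᵏᵢⱼ dφⁱ(v) Yʲ`. -/
def covDerivAlong (φ : S → M) (Y : ∀ x, TangentSpace I (φ x)) (x : S) (v : TangentSpace I' x) :
    TangentSpace I (φ x) :=
  (trivializationAt E (TangentSpace I : M → Type _) (φ x)).symm (φ x)
      (mvfderiv I' (fun y : S ↦
        (trivializationAt E (TangentSpace I : M → Type _) (φ x) ⟨φ y, Y y⟩).2) x v)
    + christoffel I (φ x) (mfderiv I' I φ x v) (Y x)

/-- `γ` is a (smooth, affinely parametrized) geodesic of `M` on the set `J` of parameters: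
`∇⁰_{γ'} γ' = 0`. -/
def IsGeodesicOn (γ : ℝ → M) (J : Set ℝ) : Prop :=
  ContMDiffOn 𝓘(ℝ, ℝ) I ∞ γ J ∧
    ∀ s ∈ J, covDerivAlong I 𝓘(ℝ, ℝ) γ (fun t ↦ mfderiv 𝓘(ℝ, ℝ) I γ t (1 : ℝ)) s (1 : ℝ) = 0

/-- `V` is a unit anti-torqued vector field on `M` with conformal scalar `f`:
`∇⁰_X V = f (X - ⟨X, V⟩ V)`. -/
structure IsUnitAntiTorqued (V : ∀ p : M, TangentSpace I p) (f : M → ℝ) : Prop where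
  smooth : ContMDiff I I.tangent ∞ (fun p ↦ (⟨p, V p⟩ : TangentBundle I M))
  smooth_scalar : ContMDiff I 𝓘(ℝ, ℝ) ∞ f
  unit : ∀ p, ‖V p‖ = 1
  cov : ∀ (p : M) (X : TangentSpace I p),
    covDerivAlong I I (fun q : M ↦ q) V p X = f p • (X - inner ℝ X (V p) • V p)

end Connection

section Hypersurface

variable {n : ℕ}
  {M : Type*} [TopologicalSpace M] [ChartedSpace (EuclideanSpace ℝ (Fin (n + 2))) M]
  [IsManifold (𝓡 (n + 2)) ∞ M]
  [RiemannianBundle (fun x : M ↦ TangentSpace (𝓡 (n + 2)) x)]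
  {N : Type*} [TopologicalSpace N] [ChartedSpace (EuclideanSpace ℝ (Fin (n + 1))) N]

/-- The tangential projection `V^⊤` of `V` on a hypersurface with unit normal `U`, as a vector
field along the immersion `φ` (tangent vectors of `N` are identified with their images
under `dφ`). -/
def tangentialPart (V : ∀ p : M, TangentSpace (𝓡 (n + 2)) p) (φ : N → M)
    (U : ∀ x : N, TangentSpace (𝓡 (n + 2)) (φ x)) (x : N) : TangentSpace (𝓡 (n + 2)) (φ x) :=
  V (φ x) - inner ℝ (V (φ x)) (U x) • U x

/-- The unit vector field `T = V^⊤ / |V^⊤|`. -/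
def unitTangentialPart (V : ∀ p : M, TangentSpace (𝓡 (n + 2)) p) (φ : N → M)
    (U : ∀ x : N, TangentSpace (𝓡 (n + 2)) (φ x)) (x : N) : TangentSpace (𝓡 (n + 2)) (φ x) :=
  ‖tangentialPart V φ U x‖⁻¹ • tangentialPart V φ U x

/-- The shape operator `A(v) = -∇⁰_v U` (again with `T_x N` identified with its image
under `dφ`). -/
def shapeOperator (φ : N → M) (U : ∀ x : N, TangentSpace (𝓡 (n + 2)) (φ x)) (x : N)
    (v : TangentSpace (𝓡 (n + 1)) x) : TangentSpace (𝓡 (n + 2)) (φ x) :=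
  -covDerivAlong (𝓡 (n + 2)) (𝓡 (n + 1)) φ U x v

/-- The metric of `N` induced by the immersion `φ`. -/
def inducedMetric (φ : N → M) (x : N) (v w : TangentSpace (𝓡 (n + 1)) x) : ℝ :=
  inner ℝ (mfderiv (𝓡 (n + 1)) (𝓡 (n + 2)) φ x v) (mfderiv (𝓡 (n + 1)) (𝓡 (n + 2)) φ x w)

/-- The immersion `φ : N → M` with unit normal field `U` is a constant angle hypersurface
with axis `V` and angle `θ`. -/
structure IsConstantAngleHypersurface (V : ∀ p : M, TangentSpace (𝓡 (n + 2)) p) (φ : N → M)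
    (U : ∀ x : N, TangentSpace (𝓡 (n + 2)) (φ x)) (θ : ℝ) : Prop where
  smooth : ContMDiff (𝓡 (n + 1)) (𝓡 (n + 2)) ∞ φ
  immersion : ∀ x, Function.Injective (mfderiv (𝓡 (n + 1)) (𝓡 (n + 2)) φ x)
  smooth_normal : ContMDiff (𝓡 (n + 1)) (𝓡 (n + 2)).tangent ∞
    (fun x ↦ (⟨φ x, U x⟩ : TangentBundle (𝓡 (n + 2)) M))
  unit_normal : ∀ x, ‖U x‖ = 1
  normal : ∀ (x : N) (v : TangentSpace (𝓡 (n + 1)) x),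
    inner ℝ (mfderiv (𝓡 (n + 1)) (𝓡 (n + 2)) φ x v) (U x) = 0
  mem_angle : θ ∈ Set.Icc 0 Real.pi
  angle : ∀ x, inner ℝ (U x) (V (φ x)) = Real.cos θ
  tangential_ne_zero : ∀ x, tangentialPart V φ U x ≠ 0

/-- `A|_𝒟 = δ Id`, where `𝒟` is the orthogonal complement of `T` in the tangent spaces of `N`. -/
def ShapeOperatorIsScalarOnPerp (V : ∀ p : M, TangentSpace (𝓡 (n + 2)) p) (φ : N → M)
    (U : ∀ x : N, TangentSpace (𝓡 (n + 2)) (φ x)) (δ : N → ℝ) : Prop :=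
  ∀ (x : N) (v : TangentSpace (𝓡 (n + 1)) x),
    inner ℝ (mfderiv (𝓡 (n + 1)) (𝓡 (n + 2)) φ x v) (unitTangentialPart V φ U x) = 0 →
      shapeOperator φ U x v = δ x • mfderiv (𝓡 (n + 1)) (𝓡 (n + 2)) φ x v

/-- `ψ` is a smooth diffeomorphism from the product of the interval `(a, b)` and the open set
`W ⊆ ℝⁿ` onto an open subset of `N`. -/
structure IsProductChart (ψ : OpenPartialHomeomorph (ℝ × EuclideanSpace ℝ (Fin n)) N)
    (a b : ℝ) (W : Set (EuclideanSpace ℝ (Fin n))) : Prop where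
  isOpen : IsOpen W
  source_eq : ψ.source = Set.Ioo a b ×ˢ W
  smooth : ContMDiffOn 𝓘(ℝ, ℝ × EuclideanSpace ℝ (Fin n)) (𝓡 (n + 1)) ∞ ψ ψ.source
  smooth_symm : ContMDiffOn (𝓡 (n + 1)) 𝓘(ℝ, ℝ × EuclideanSpace ℝ (Fin n)) ∞ ψ.symm ψ.target

/-- Near `p`, the hypersurface is ruled: a neighbourhood of `p` in `N` is smoothly foliated by
curves that `φ` maps to geodesics of the ambient space. -/
def IsRuledNear (φ : N → M) (p : N) : Prop :=
  ∃ (ψ : OpenPartialHomeomorph (ℝ × EuclideanSpace ℝ (Fin n)) N) (a b : ℝ)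
    (W : Set (EuclideanSpace ℝ (Fin n))),
    IsProductChart ψ a b W ∧ p ∈ ψ.target ∧
      ∀ q ∈ W, IsGeodesicOn (𝓡 (n + 2)) (fun s ↦ φ (ψ (s, q))) (Set.Ioo a b)

/-- `h` is a smooth Riemannian metric on the open set `W ⊆ ℝⁿ`. -/
structure IsRiemannianMetricOn
    (h : EuclideanSpace ℝ (Fin n) → EuclideanSpace ℝ (Fin n) →L[ℝ] EuclideanSpace ℝ (Fin n) →L[ℝ] ℝ)
    (W : Set (EuclideanSpace ℝ (Fin n))) : Prop where
  smooth : ContDiffOn ℝ ∞ h W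
  symm : ∀ q ∈ W, ∀ ξ η, h q ξ η = h q η ξ
  pos : ∀ q ∈ W, ∀ ξ, ξ ≠ 0 → 0 < h q ξ ξ

/-- `ψ` is an isometry from the twisted product `(a, b) ×_lam F`, with metric `ds² + lam² h`,
onto an open subset of `N` with the induced metric. Here `F` is the Riemannian manifold `(W, h)`. -/
structure IsTwistedProductChart (φ : N → M)
    (ψ : OpenPartialHomeomorph (ℝ × EuclideanSpace ℝ (Fin n)) N)
    (a b : ℝ) (W : Set (EuclideanSpace ℝ (Fin n)))
    (h : EuclideanSpace ℝ (Fin n) → EuclideanSpace ℝ (Fin n) →L[ℝ] EuclideanSpace ℝ (Fin n) →L[ℝ] ℝ)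
    (lam : ℝ × EuclideanSpace ℝ (Fin n) → ℝ) : Prop extends IsProductChart ψ a b W where
  metric_fiber : IsRiemannianMetricOn h W
  smooth_lam : ContDiffOn ℝ ∞ lam (Set.Ioo a b ×ˢ W)
  lam_pos : ∀ z ∈ Set.Ioo a b ×ˢ W, 0 < lam z
  isometry : ∀ z ∈ Set.Ioo a b ×ˢ W, ∀ X Y : ℝ × EuclideanSpace ℝ (Fin n),
    inducedMetric φ (ψ z)
        (mfderiv 𝓘(ℝ, ℝ × EuclideanSpace ℝ (Fin n)) (𝓡 (n + 1)) ψ z X)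
        (mfderiv 𝓘(ℝ, ℝ × EuclideanSpace ℝ (Fin n)) (𝓡 (n + 1)) ψ z Y)
      = X.1 * Y.1 + lam z ^ 2 * h z.2 X.2 Y.2

/-- Near `p`, the hypersurface is the twisted product `(a, b) ×_lam F` with `∂/∂s = T` and
`∂/∂s (log lam) = μ`. -/
def IsTwistedProductNear (V : ∀ p : M, TangentSpace (𝓡 (n + 2)) p) (φ : N → M)
    (U : ∀ x : N, TangentSpace (𝓡 (n + 2)) (φ x)) (μ : N → ℝ) (p : N) : Prop :=
  ∃ (ψ : OpenPartialHomeomorph (ℝ × EuclideanSpace ℝ (Fin n)) N) (a b : ℝ)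
    (W : Set (EuclideanSpace ℝ (Fin n)))
    (h : EuclideanSpace ℝ (Fin n) → EuclideanSpace ℝ (Fin n) →L[ℝ] EuclideanSpace ℝ (Fin n) →L[ℝ] ℝ)
    (lam : ℝ × EuclideanSpace ℝ (Fin n) → ℝ),
    IsTwistedProductChart φ ψ a b W h lam ∧ p ∈ ψ.target ∧
      ∀ s ∈ Set.Ioo a b, ∀ q ∈ W,
        mfderiv (𝓡 (n + 1)) (𝓡 (n + 2)) φ (ψ (s, q))
            (mfderiv 𝓘(ℝ, ℝ × EuclideanSpace ℝ (Fin n)) (𝓡 (n + 1)) ψ (s, q)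
              ((1, 0) : ℝ × EuclideanSpace ℝ (Fin n)))
          = unitTangentialPart V φ U (ψ (s, q)) ∧
        HasDerivAt (fun t ↦ Real.log (lam (t, q))) (μ (ψ (s, q))) s

/-- Near `p`, the hypersurface is the warped product `(a, b) ×_lam F` with `∂/∂s = T` and
`(log lam)' = μ`: a twisted product whose twisting function depends on `s` only. -/
def IsWarpedProductNear (V : ∀ p : M, TangentSpace (𝓡 (n + 2)) p) (φ : N → M)
    (U : ∀ x : N, TangentSpace (𝓡 (n + 2)) (φ x)) (μ : N → ℝ) (p : N) : Prop :=
  ∃ (ψ : OpenPartialHomeomorph (ℝ × EuclideanSpace ℝ (Fin n)) N) (a b : ℝ)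
    (W : Set (EuclideanSpace ℝ (Fin n)))
    (h : EuclideanSpace ℝ (Fin n) → EuclideanSpace ℝ (Fin n) →L[ℝ] EuclideanSpace ℝ (Fin n) →L[ℝ] ℝ)
    (lam : ℝ → ℝ),
    IsTwistedProductChart φ ψ a b W h (fun z ↦ lam z.1) ∧ p ∈ ψ.target ∧
      ∀ s ∈ Set.Ioo a b, ∀ q ∈ W,
        mfderiv (𝓡 (n + 1)) (𝓡 (n + 2)) φ (ψ (s, q))
            (mfderiv 𝓘(ℝ, ℝ × EuclideanSpace ℝ (Fin n)) (𝓡 (n + 1)) ψ (s, q)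
              ((1, 0) : ℝ × EuclideanSpace ℝ (Fin n)))
          = unitTangentialPart V φ U (ψ (s, q)) ∧
        HasDerivAt (fun t ↦ Real.log (lam t)) (μ (ψ (s, q))) s

variable (n M)

/-- `M` is isometric to an open subset of the Euclidean space of dimension `n + 2`
(the whole space included). An injective smooth map that preserves the metric between manifolds
of equal dimension is a diffeomorphism onto an open subset. -/
def IsEuclideanDomain : Prop :=
  ∃ Φ : M → EuclideanSpace ℝ (Fin (n + 2)), ContMDiff (𝓡 (n + 2)) (𝓡 (n + 2)) ∞ Φ ∧
    Function.Injective Φ ∧ ∀ (p : M) (v w : TangentSpace (𝓡 (n + 2)) p),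
      inner ℝ v w = inner ℝ (mvfderiv (𝓡 (n + 2)) Φ p v) (mvfderiv (𝓡 (n + 2)) Φ p w)

/-- `M` is isometric to an open subset of the hyperbolic space of dimension `n + 2` (the whole
space included), in the upper half-space model: `x_last > 0` with the Euclidean metric divided
by `x_last²`. -/
def IsHyperbolicDomain : Prop :=
  ∃ Φ : M → EuclideanSpace ℝ (Fin (n + 2)), ContMDiff (𝓡 (n + 2)) (𝓡 (n + 2)) ∞ Φ ∧
    Function.Injective Φ ∧ (∀ p, 0 < Φ p (Fin.last (n + 1))) ∧
    ∀ (p : M) (v w : TangentSpace (𝓡 (n + 2)) p),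
      inner ℝ v w = inner ℝ (mvfderiv (𝓡 (n + 2)) Φ p v) (mvfderiv (𝓡 (n + 2)) Φ p w) /
        (Φ p (Fin.last (n + 1))) ^ 2

end Hypersurface

end ConstantAngle

end

open Bundle
open scoped Manifold ContDiff

noncomputable section

namespace ConstantAngle

section Flow

open Set Filter Topology

universe u

/-- A smooth map with invertible derivative at `x` is a smooth diffeomorphism near `x`. -/
theorem exists_openPartialHomeomorph_contDiffOn {E F : Type*} [NormedAddCommGroup E]
    [NormedSpace ℝ E] [CompleteSpace E] [NormedAddCommGroup F] [NormedSpace ℝ F] [CompleteSpace F]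
    {f : E → F} {Ω : Set E} (hΩ : IsOpen Ω) (hf : ContDiffOn ℝ ∞ f Ω) {x : E} (hx : x ∈ Ω)
    (f' : E ≃L[ℝ] F) (hf' : HasFDerivAt f (f' : E →L[ℝ] F) x) :
    ∃ ψ : OpenPartialHomeomorph E F, (ψ : E → F) = f ∧ x ∈ ψ.source ∧ ψ.source ⊆ Ω ∧
      ContDiffOn ℝ ∞ ψ.symm ψ.target := by
  have hc : ContDiffAt ℝ ∞ f x := hf.contDiffAt (hΩ.mem_nhds hx)
  have h0 : (∞ : WithTop ℕ∞) ≠ 0 := by simp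
  set ψ := hc.toOpenPartialHomeomorph f hf' h0 with hψ
  have hcoe : (ψ : E → F) = f := hc.toOpenPartialHomeomorph_coe hf' h0
  have hxs : x ∈ ψ.source := hc.mem_toOpenPartialHomeomorph_source hf' h0
  let S : Set E := Ω ∩ (fderiv ℝ f) ⁻¹' (range ((↑) : (E ≃L[ℝ] F) → E →L[ℝ] F))
  have hS : IsOpen S :=
    (hf.continuousOn_fderiv_of_isOpen hΩ (by simp)).isOpen_inter_preimage hΩ
      ContinuousLinearEquiv.isOpen
  have hxS : x ∈ S := ⟨hx, f', hf'.fderiv.symm⟩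
  refine ⟨ψ.restrOpen S hS, by simpa using hcoe, by simp [hxs, hxS], ?_, ?_⟩
  · intro y hy
    simp at hy
    exact hy.2.1
  · intro y hy
    have hy' : (ψ.restrOpen S hS).symm y ∈ (ψ.restrOpen S hS).source :=
      (ψ.restrOpen S hS).map_target hy
    have hyS : (ψ.restrOpen S hS).symm y ∈ S := by
      simp at hy' ⊢
      exact hy'.2
    obtain ⟨A, hA⟩ := hyS.2
    have hcy : ContDiffAt ℝ ∞ f ((ψ.restrOpen S hS).symm y) :=
      hf.contDiffAt (hΩ.mem_nhds hyS.1)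
    have hcoe' : ((ψ.restrOpen S hS : OpenPartialHomeomorph E F) : E → F) = f := by simpa using hcoe
    refine (OpenPartialHomeomorph.contDiffAt_symm (f₀' := A) _ hy ?_ ?_).contDiffWithinAt
    · rw [hcoe', hA]
      exact (hcy.differentiableAt (by simp)).hasFDerivAt
    · rw [hcoe']
      exact hcy

variable {K : Type*} [TopologicalSpace K] [CompactSpace K]

/-- The pointwise application of a bilinear map to continuous functions. -/
def pointwiseBilin (K : Type*) [TopologicalSpace K] [CompactSpace K]
    {E F G : Type*} [NormedAddCommGroup E] [NormedSpace ℝ E] [NormedAddCommGroup F]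
    [NormedSpace ℝ F] [NormedAddCommGroup G] [NormedSpace ℝ G] (B : G →L[ℝ] E →L[ℝ] F) :
    C(K, G) →L[ℝ] C(K, E) →L[ℝ] C(K, F) :=
  LinearMap.mkContinuous₂
    (LinearMap.mk₂ ℝ (fun (A : C(K, G)) (h : C(K, E)) ↦
        (⟨fun k ↦ B (A k) (h k), by fun_prop⟩ : C(K, F)))
      (fun _ _ _ ↦ by ext; simp) (fun _ _ _ ↦ by ext; simp) (fun _ _ _ ↦ by ext; simp)
      (fun _ _ _ ↦ by ext; simp)) ‖B‖ <| by
    intro A h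
    rw [ContinuousMap.norm_le _ (by positivity)]
    intro k
    simp only [LinearMap.mk₂_apply, ContinuousMap.coe_mk]
    exact (B.le_opNorm₂ _ _).trans
      (by gcongr; exacts [A.norm_coe_le_norm k, h.norm_coe_le_norm k])

section

variable {E F G : Type*} [NormedAddCommGroup E] [NormedSpace ℝ E] [NormedAddCommGroup F]
  [NormedSpace ℝ F] [NormedAddCommGroup G] [NormedSpace ℝ G] (B : G →L[ℝ] E →L[ℝ] F)

theorem pointwiseBilin_apply (A : C(K, G)) (h : C(K, E)) (k : K) :
    pointwiseBilin K B A h k = B (A k) (h k) := rfl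

theorem hasFDerivAt_postcomp (f : C(E, F)) (f' : C(E, G))
    (hf : ∀ x, HasFDerivAt f (B (f' x)) x) (γ : C(K, E)) :
    HasFDerivAt (fun γ : C(K, E) ↦ f.comp γ) (pointwiseBilin K B (f'.comp γ)) γ := by
  rw [hasFDerivAt_iff_isLittleO_nhds_zero, Asymptotics.isLittleO_iff]
  intro ε hε
  have hcont : ContinuousAt (fun γ : C(K, E) ↦ f'.comp γ) γ :=
    (ContinuousMap.continuous_postcomp f').continuousAt
  have hε' : 0 < ε / (‖B‖ + 1) := by positivity
  obtain ⟨r, hr, hball⟩ := Metric.continuousAt_iff.1 hcont _ hε'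
  filter_upwards [Metric.ball_mem_nhds (0 : C(K, E)) hr] with h hh
  rw [mem_ball_zero_iff] at hh
  rw [ContinuousMap.norm_le _ (by positivity)]
  intro k
  have hk : ‖h k‖ < r := (h.norm_coe_le_norm k).trans_lt hh
  have hbound : ∀ y ∈ Metric.ball (γ k) r, ‖B (f' y) - B (f' (γ k))‖ ≤ ε := by
    intro y hy
    have h1 : dist (γ + ContinuousMap.const K (y - γ k)) γ < r := by
      rw [dist_eq_norm, add_sub_cancel_left, ContinuousMap.norm_lt_iff _ hr]
      intro _
      simpa [dist_eq_norm] using hy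
    have h2 := hball h1
    rw [dist_eq_norm, ContinuousMap.norm_lt_iff _ hε'] at h2
    have h3 := h2 k
    simp only [ContinuousMap.sub_apply, ContinuousMap.comp_apply, ContinuousMap.add_apply,
      ContinuousMap.const_apply, add_sub_cancel] at h3
    rw [← map_sub]
    calc ‖B (f' y - f' (γ k))‖ ≤ ‖B‖ * ‖f' y - f' (γ k)‖ := B.le_opNorm _
      _ ≤ (‖B‖ + 1) * (ε / (‖B‖ + 1)) := by gcongr; linarith
      _ = ε := by field_simp
  have hmv := (convex_ball (γ k) r).norm_image_sub_le_of_norm_hasFDerivWithin_le'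
    (f := f) (φ := B (f' (γ k))) (fun y _ ↦ (hf y).hasFDerivWithinAt) hbound
    (Metric.mem_ball_self hr) (y := γ k + h k) (by simpa [dist_eq_norm] using hk)
  simp only [add_sub_cancel_left] at hmv
  simp only [ContinuousMap.sub_apply, ContinuousMap.comp_apply, ContinuousMap.add_apply,
    pointwiseBilin_apply]
  exact hmv.trans (by gcongr; exact h.norm_coe_le_norm k)

theorem contDiff_postcomp_succ {n : ℕ} (f : C(E, F)) (f' : C(E, G))
    (hf : ∀ x, HasFDerivAt f (B (f' x)) x)
    (hf' : ContDiff ℝ n (fun γ : C(K, E) ↦ f'.comp γ)) :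
    ContDiff ℝ (n + 1) (fun γ : C(K, E) ↦ f.comp γ) :=
  contDiff_succ_iff_hasFDerivAt.2 ⟨fun γ ↦ pointwiseBilin K B (f'.comp γ),
    (pointwiseBilin K B).contDiff.comp hf', fun γ ↦ hasFDerivAt_postcomp B f f' hf γ⟩

end

/-- Composition with a smooth map is a smooth map between spaces of continuous functions. -/
theorem contDiff_postcomp_nat {E : Type u} [NormedAddCommGroup E] [NormedSpace ℝ E] (n : ℕ) :
    ∀ {F : Type u} [NormedAddCommGroup F] [NormedSpace ℝ F] (f : C(E, F)), ContDiff ℝ n f →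
      ContDiff ℝ n (fun γ : C(K, E) ↦ f.comp γ) := by
  induction n with
  | zero =>
    intro F _ _ f _
    exact contDiff_zero.2 (ContinuousMap.continuous_postcomp f)
  | succ n ih =>
    intro F _ _ f hf
    rw [Nat.cast_add, Nat.cast_one] at hf ⊢
    obtain ⟨f', hf', hd⟩ := contDiff_succ_iff_hasFDerivAt.1 hf
    exact contDiff_postcomp_succ (ContinuousLinearMap.id ℝ (E →L[ℝ] F)) f ⟨f', hf'.continuous⟩ hd
      (ih _ hf')

theorem contDiff_postcomp {E F : Type u} [NormedAddCommGroup E] [NormedSpace ℝ E]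
    [NormedAddCommGroup F] [NormedSpace ℝ F] (f : C(E, F)) (hf : ContDiff ℝ ∞ f) :
    ContDiff ℝ ∞ (fun γ : C(K, E) ↦ f.comp γ) :=
  contDiff_infty.2 fun n ↦ contDiff_postcomp_nat n f (contDiff_infty.1 hf n)

open unitInterval in
/-- The Volterra operator `γ ↦ ∫₀ γ` on continuous functions on the unit interval. -/
def volterra (E : Type*) [NormedAddCommGroup E] [NormedSpace ℝ E] [CompleteSpace E] :
    C(I, E) →L[ℝ] C(I, E) :=
  have hint (γ : C(I, E)) (a b : ℝ) :
      IntervalIntegrable (fun κ ↦ γ (projIcc 0 1 zero_le_one κ)) MeasureTheory.volume a b :=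
    (γ.continuous.comp continuous_projIcc).intervalIntegrable a b
  LinearMap.mkContinuous
    { toFun := fun γ ↦ ⟨fun τ ↦ ∫ κ in (0 : ℝ)..τ, γ (projIcc 0 1 zero_le_one κ),
        (intervalIntegral.continuous_primitive (hint γ) 0).comp continuous_subtype_val⟩
      map_add' := fun γ γ' ↦ by
        ext τ
        simp [intervalIntegral.integral_add (hint γ _ _) (hint γ' _ _)]
      map_smul' := fun c γ ↦ by
        ext τ
        simp } 1 <| by
    intro γ
    rw [one_mul, ContinuousMap.norm_le _ (by positivity)]
    intro τ
    simp only [LinearMap.coe_mk, AddHom.coe_mk, ContinuousMap.coe_mk]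
    refine (intervalIntegral.norm_integral_le_of_norm_le_const
      (fun κ _ ↦ γ.norm_coe_le_norm _)).trans ?_
    rw [sub_zero, abs_of_nonneg τ.2.1]
    exact mul_le_of_le_one_right (norm_nonneg _) τ.2.2

open unitInterval in
theorem volterra_apply {E : Type*} [NormedAddCommGroup E] [NormedSpace ℝ E] [CompleteSpace E]
    (γ : C(I, E)) (τ : I) :
    volterra E γ τ = ∫ κ in (0 : ℝ)..τ, γ (projIcc 0 1 zero_le_one κ) := rfl

open unitInterval in
/-- The smooth local flow of a globally defined smooth vector field. -/
theorem exists_contDiffOn_flow_of_contDiff {E : Type u} [NormedAddCommGroup E] [NormedSpace ℝ E]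
    [CompleteSpace E] {v : E → E} (hv : ContDiff ℝ ∞ v) (x₀ : E) :
    ∃ ε > 0, ∃ Θ : ℝ × E → E, ContDiffOn ℝ ∞ Θ (Ioo (-ε) ε ×ˢ Metric.ball x₀ ε) ∧
      ∀ x ∈ Metric.ball x₀ ε, Θ (0, x) = x ∧
        ∀ t ∈ Ioo (-ε) ε, HasDerivAt (fun t ↦ Θ (t, x)) (v (Θ (t, x))) t := by
  let vc : C(E, E) := ⟨v, hv.continuous⟩
  let const : E →L[ℝ] C(I, E) := ContinuousLinearMap.const ℝ I
  let Ξ : ℝ × E × C(I, E) → ℝ × E × C(I, E) := fun z ↦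
    (z.1, z.2.1, z.2.2 - const z.2.1 - z.1 • volterra E (vc.comp z.2.2))
  have hΞ : ContDiff ℝ ∞ Ξ := by
    have h1 : ContDiff ℝ ∞ (fun z : ℝ × E × C(I, E) ↦ volterra E (vc.comp z.2.2)) :=
      (volterra E).contDiff.comp ((contDiff_postcomp vc hv).comp (by fun_prop))
    have h2 : ContDiff ℝ ∞ (fun z : ℝ × E × C(I, E) ↦ const z.2.1) :=
      const.contDiff.comp (by fun_prop)
    exact contDiff_fst.prodMk ((by fun_prop : ContDiff ℝ ∞ (fun z : ℝ × E × C(I, E) ↦ z.2.1)).prodMk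
      (((by fun_prop : ContDiff ℝ ∞ (fun z : ℝ × E × C(I, E) ↦ z.2.2)).sub h2).sub
        (contDiff_fst.smul h1)))
  set b : ℝ × E × C(I, E) := (0, x₀, const x₀) with hb
  let w : C(I, E) := volterra E (vc.comp (const x₀))
  let A : (ℝ × E × C(I, E)) ≃L[ℝ] (ℝ × E × C(I, E)) :=
    ContinuousLinearEquiv.equivOfInverse
      ((ContinuousLinearMap.fst ℝ _ _).prod
        (((ContinuousLinearMap.fst ℝ _ _).comp (ContinuousLinearMap.snd ℝ _ _)).prod
        ((ContinuousLinearMap.snd ℝ _ _).comp (ContinuousLinearMap.snd ℝ _ _)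
          - const.comp ((ContinuousLinearMap.fst ℝ _ _).comp (ContinuousLinearMap.snd ℝ _ _))
          - (ContinuousLinearMap.fst ℝ _ _).smulRight w)))
      ((ContinuousLinearMap.fst ℝ _ _).prod
        (((ContinuousLinearMap.fst ℝ _ _).comp (ContinuousLinearMap.snd ℝ _ _)).prod
        ((ContinuousLinearMap.snd ℝ _ _).comp (ContinuousLinearMap.snd ℝ _ _)
          + const.comp ((ContinuousLinearMap.fst ℝ _ _).comp (ContinuousLinearMap.snd ℝ _ _))
          + (ContinuousLinearMap.fst ℝ _ _).smulRight w)))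
      (fun z ↦ Prod.ext rfl (Prod.ext rfl (by simp; abel)))
      (fun z ↦ Prod.ext rfl (Prod.ext rfl (by simp; abel)))
  have hA : HasFDerivAt Ξ (A : (ℝ × E × C(I, E)) →L[ℝ] (ℝ × E × C(I, E))) b := by
    have h1 : HasFDerivAt (fun z : ℝ × E × C(I, E) ↦ z.1 • volterra E (vc.comp z.2.2))
        ((ContinuousLinearMap.fst ℝ _ _).smulRight w) b := by
      have hd : DifferentiableAt ℝ
          (fun z : ℝ × E × C(I, E) ↦ volterra E (vc.comp z.2.2)) b :=
        (((volterra E).contDiff (n := ∞)).comp ((contDiff_postcomp vc hv).comp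
          (by fun_prop : ContDiff ℝ ∞ (fun z : ℝ × E × C(I, E) ↦ z.2.2)))).differentiable
            (by simp) b
      have := (hasFDerivAt_fst (𝕜 := ℝ) (p := b)).smul hd.hasFDerivAt
      convert! this using 1
      simp [hb, w]
    have h2 : HasFDerivAt (fun z : ℝ × E × C(I, E) ↦ z.2.2 - const z.2.1)
        ((ContinuousLinearMap.snd ℝ _ _).comp (ContinuousLinearMap.snd ℝ _ _)
          - const.comp ((ContinuousLinearMap.fst ℝ _ _).comp (ContinuousLinearMap.snd ℝ _ _))) b :=
      (hasFDerivAt_snd.comp b hasFDerivAt_snd).sub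
        (const.hasFDerivAt.comp b (hasFDerivAt_fst.comp b hasFDerivAt_snd))
    exact hasFDerivAt_fst.prodMk (((hasFDerivAt_fst.comp b hasFDerivAt_snd)).prodMk (h2.sub h1))
  obtain ⟨ψ, hψ, hbs, -, hsymm⟩ := exists_openPartialHomeomorph_contDiffOn isOpen_univ
    hΞ.contDiffOn (mem_univ b) A hA
  have hΞb : ψ b = (0, x₀, 0) := by
    rw [hψ]
    ext <;> simp [Ξ, hb, const]
  obtain ⟨ρ, hρ, hρs⟩ := Metric.isOpen_iff.1 ψ.open_source b hbs
  have hbt : (0, x₀, 0) ∈ ψ.target := hΞb ▸ ψ.map_source hbs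
  let ι : ℝ × E → ℝ × E × C(I, E) := fun z ↦ (z.1, z.2, 0)
  have hι : ContDiff ℝ ∞ ι := by fun_prop
  have hopen : IsOpen (ι ⁻¹' (ψ.target ∩ ψ.symm ⁻¹' Metric.ball b ρ)) :=
    (ψ.symm.isOpen_inter_preimage Metric.isOpen_ball).preimage hι.continuous
  have hmem : ((0, x₀) : ℝ × E) ∈ ι ⁻¹' (ψ.target ∩ ψ.symm ⁻¹' Metric.ball b ρ) := by
    refine ⟨hbt, ?_⟩
    rw [mem_preimage, show ι (0, x₀) = (0, x₀, 0) from rfl, ← hΞb, ψ.left_inv hbs]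
    exact Metric.mem_ball_self hρ
  obtain ⟨ε, hε, hεs⟩ := Metric.isOpen_iff.1 hopen _ hmem
  have hbox : ∀ t ∈ Ioo (-ε) ε, ∀ x ∈ Metric.ball x₀ ε,
      (t, x) ∈ ι ⁻¹' (ψ.target ∩ ψ.symm ⁻¹' Metric.ball b ρ) := by
    intro t ht x hx
    apply hεs
    rw [← ball_prod_same, Real.ball_eq_Ioo]
    simpa using ⟨ht, hx⟩
  let γ : ℝ × E → C(I, E) := fun z ↦ (ψ.symm (ι z)).2.2
  have hγ : ∀ t ∈ Ioo (-ε) ε, ∀ x ∈ Metric.ball x₀ ε, ψ.symm (t, x, 0) = (t, x, γ (t, x)) ∧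
      γ (t, x) = const x + t • volterra E (vc.comp (γ (t, x))) := by
    intro t ht x hx
    have h := ψ.right_inv (hbox t ht x hx).1
    rw [hψ] at h
    simp only [Ξ, ι, Prod.mk.injEq] at h
    obtain ⟨h1, h2, h3⟩ := h
    refine ⟨Prod.ext h1 (Prod.ext h2 rfl), ?_⟩
    rw [h1, h2, sub_sub, sub_eq_zero] at h3
    exact h3
  have hscale : ∀ t ∈ Ioo (-ε) ε, ∀ x ∈ Metric.ball x₀ ε, ∀ r : I,
      γ (t, x) r = γ (r * t, x) 1 := by
    intro t ht x hx r
    have hrt : (r * t : ℝ) ∈ Ioo (-ε) ε := by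
      rw [mem_Ioo, ← abs_lt] at ht ⊢
      rw [abs_mul, abs_of_nonneg r.2.1]
      exact (mul_le_of_le_one_left (abs_nonneg t) r.2.2).trans_lt ht
    let m : C(I, I) := ⟨fun τ ↦ r * τ, by fun_prop⟩
    let η : C(I, E) := (γ (t, x)).comp m
    have hη : η = const x + (r * t : ℝ) • volterra E (vc.comp η) := by
      ext τ
      have h1 := congrArg (fun g : C(I, E) ↦ g (r * τ)) (hγ t ht x hx).2
      simp only [ContinuousMap.add_apply, ContinuousMap.smul_apply, volterra_apply] at h1
      simp only [ContinuousMap.add_apply, ContinuousMap.smul_apply, volterra_apply]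
      refine h1.trans ?_
      congr 1
      rw [mul_comm (r : ℝ) t, mul_smul]
      congr 1
      have h2 : (r : ℝ) • ∫ κ in (0 : ℝ)..τ, vc (γ (t, x) (projIcc 0 1 zero_le_one (r * κ)))
          = ∫ κ in (r * 0 : ℝ)..(r * τ), vc (γ (t, x) (projIcc 0 1 zero_le_one κ)) :=
        intervalIntegral.smul_integral_comp_mul_left
          (fun κ ↦ vc (γ (t, x) (projIcc 0 1 zero_le_one κ))) (r : ℝ)
      rw [mul_zero] at h2
      simp only [ContinuousMap.comp_apply]
      rw [show ((r * τ : I) : ℝ) = r * τ from rfl, ← h2]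
      congr 1
      apply intervalIntegral.integral_congr
      intro κ hκ
      rw [uIcc_of_le τ.2.1] at hκ
      have hκ1 : κ ∈ Icc (0 : ℝ) 1 := ⟨hκ.1, hκ.2.trans τ.2.2⟩
      have hκ2 : (r * κ : ℝ) ∈ Icc (0 : ℝ) 1 := unitInterval.mul_mem r.2 hκ1
      simp only [η, ContinuousMap.comp_apply]
      rw [projIcc_of_mem _ hκ1, projIcc_of_mem _ hκ2]
      rfl
    have hηball : ((r * t : ℝ), x, η) ∈ Metric.ball b ρ := by
      have h1 : (t, x, γ (t, x)) ∈ Metric.ball b ρ := (hγ t ht x hx).1 ▸ (hbox t ht x hx).2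
      rw [Metric.mem_ball, Prod.dist_eq, Prod.dist_eq] at h1 ⊢
      simp only [hb, max_lt_iff] at h1 ⊢
      refine ⟨?_, h1.2.1, ?_⟩
      · rw [dist_zero_right, norm_mul, Real.norm_of_nonneg r.2.1]
        rw [dist_zero_right] at h1
        exact (mul_le_of_le_one_left (norm_nonneg t) r.2.2).trans_lt h1.1
      · rw [ContinuousMap.dist_lt_iff hρ] at h1 ⊢
        intro τ
        exact h1.2.2 (m τ)
    have hΞη : ψ ((r * t : ℝ), x, η) = ((r * t : ℝ), x, 0) := by
      rw [hψ]
      simp only [Ξ, Prod.mk.injEq, true_and]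
      rw [sub_sub, sub_eq_zero]
      exact hη
    have h1 := (hγ _ hrt x hx).1
    rw [← hΞη, ψ.left_inv (hρs hηball)] at h1
    simp only [Prod.mk.injEq, true_and] at h1
    rw [← h1]
    simp [η, m]
  have hsmooth : ContDiffOn ℝ ∞ (fun z ↦ γ z 1) (Ioo (-ε) ε ×ˢ Metric.ball x₀ ε) := by
    have h1 : ContDiffOn ℝ ∞ (fun z ↦ ψ.symm (ι z)) (Ioo (-ε) ε ×ˢ Metric.ball x₀ ε) :=
      hsymm.comp hι.contDiffOn (fun z hz ↦ (hbox z.1 hz.1 z.2 hz.2).1)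
    exact (ContinuousMap.evalCLM ℝ (1 : I)).contDiff.comp_contDiffOn
      (contDiff_snd.comp_contDiffOn (contDiff_snd.comp_contDiffOn h1))
  have hint : ∀ t ∈ Ioo (-ε) ε, ∀ x ∈ Metric.ball x₀ ε, ∀ r : I,
      γ (r * t, x) 1 = x + t • ∫ κ in (0 : ℝ)..r, v (γ (t, x) (projIcc 0 1 zero_le_one κ)) := by
    intro t ht x hx r
    rw [← hscale t ht x hx r]
    exact congrArg (fun g : C(I, E) ↦ g r) (hγ t ht x hx).2
  refine ⟨ε, hε, fun z ↦ γ z 1, hsmooth, fun x hx ↦ ⟨?_, fun t ht ↦ ?_⟩⟩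
  · have := hint 0 ⟨by linarith, hε⟩ x hx 0
    simpa using this
  · obtain ⟨t₁, ht₁, ht₁0, r, hr, hrt⟩ : ∃ t₁ ∈ Ioo (-ε) ε, t₁ ≠ 0 ∧ ∃ r ∈ Icc (0 : ℝ) 1,
        r * t₁ = t := by
      rcases eq_or_ne t 0 with rfl | h0
      · exact ⟨ε / 2, ⟨by linarith, by linarith⟩, by positivity, 0, by simp, by simp⟩
      · exact ⟨t, ht, h0, 1, by simp, by simp⟩
    have hd : DifferentiableAt ℝ (fun t ↦ γ (t, x) 1) t := by
      have h1 : DifferentiableAt ℝ (fun z ↦ γ z 1) (t, x) :=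
        (hsmooth.contDiffAt ((isOpen_Ioo.prod Metric.isOpen_ball).mem_nhds ⟨ht, hx⟩)).differentiableAt
          (by simp)
      exact DifferentiableAt.comp (g := fun z ↦ γ z 1) t h1
        (differentiableAt_id.prodMk (differentiableAt_const x))
    have h1 : HasDerivWithinAt (fun r : ℝ ↦ γ (r * t₁, x) 1)
        (t₁ • deriv (fun t ↦ γ (t, x) 1) t) (Icc 0 1) r := by
      have h2 : HasDerivAt (fun r : ℝ ↦ r * t₁) t₁ r := by
        simpa using (hasDerivAt_id r).mul_const t₁
      have h3 := hd.hasDerivAt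
      rw [← hrt] at h3 ⊢
      exact (h3.scomp r h2).hasDerivWithinAt
    have h2 : HasDerivWithinAt (fun r : ℝ ↦ γ (r * t₁, x) 1)
        (t₁ • v (γ (t, x) 1)) (Icc 0 1) r := by
      have hc : Continuous fun κ : ℝ ↦ v (γ (t₁, x) (projIcc 0 1 zero_le_one κ)) :=
        hv.continuous.comp ((γ (t₁, x)).continuous.comp continuous_projIcc)
      have h3 : HasDerivAt (fun r : ℝ ↦ x + t₁ • ∫ κ in (0 : ℝ)..r,
          v (γ (t₁, x) (projIcc 0 1 zero_le_one κ)))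
          (t₁ • v (γ (t₁, x) (projIcc 0 1 zero_le_one r))) r :=
        ((intervalIntegral.integral_hasDerivAt_right (hc.intervalIntegrable _ _)
          (hc.stronglyMeasurableAtFilter _ _) hc.continuousAt).const_smul t₁).const_add x
      have h4 : γ (t₁, x) (projIcc 0 1 zero_le_one r) = γ (t, x) 1 := by
        rw [projIcc_of_mem _ hr, hscale t₁ ht₁ x hx ⟨r, hr⟩, ← hrt]
      rw [h4] at h3
      exact h3.hasDerivWithinAt.congr (fun r hr ↦ hint t₁ ht₁ x hx ⟨r, hr⟩)
        (hint t₁ ht₁ x hx ⟨r, hr⟩)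
    have h3 := (uniqueDiffOn_Icc_zero_one r hr).eq_deriv _ h1 h2
    have h4 := smul_right_injective E ht₁0 h3
    rw [← h4]
    exact hd.hasDerivAt

/-- A smooth vector field on an open set has a smooth local flow near each point. -/
theorem exists_contDiffOn_flow {E : Type u} [NormedAddCommGroup E] [NormedSpace ℝ E]
    [FiniteDimensional ℝ E] {v : E → E} {Ω : Set E} (hΩ : IsOpen Ω) (hv : ContDiffOn ℝ ∞ v Ω)
    {x₀ : E} (hx₀ : x₀ ∈ Ω) :
    ∃ ε > 0, ∃ Θ : ℝ × E → E, ContDiffOn ℝ ∞ Θ (Ioo (-ε) ε ×ˢ Metric.ball x₀ ε) ∧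
      ∀ x ∈ Metric.ball x₀ ε, Θ (0, x) = x ∧
        ∀ t ∈ Ioo (-ε) ε, Θ (t, x) ∈ Ω ∧ HasDerivAt (fun t ↦ Θ (t, x)) (v (Θ (t, x))) t := by
  have : CompleteSpace E := FiniteDimensional.complete ℝ E
  obtain ⟨r, hr, hrΩ⟩ := Metric.isOpen_iff.1 hΩ x₀ hx₀
  let χ : ContDiffBump x₀ := ⟨r / 4, r / 2, by positivity, by linarith⟩
  have hχ : ContDiff ℝ ∞ (fun x ↦ χ x • v x) := by
    rw [contDiff_iff_contDiffAt]
    intro x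
    by_cases hx : x ∈ Ω
    · exact χ.contDiff.contDiffAt.smul (hv.contDiffAt (hΩ.mem_nhds hx))
    · have hx' : x ∈ (Metric.closedBall x₀ (r / 2))ᶜ := fun h ↦
        hx (hrΩ (Metric.closedBall_subset_ball (by linarith) h))
      have : (fun x ↦ χ x • v x) =ᶠ[𝓝 x] fun _ ↦ 0 := by
        filter_upwards [Metric.isClosed_closedBall.isOpen_compl.mem_nhds hx'] with y hy
        have hy' : r / 2 ≤ dist y x₀ := by
          have : ¬ dist y x₀ ≤ r / 2 := hy
          linarith
        rw [χ.zero_of_le_dist hy', zero_smul]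
      exact contDiffAt_const.congr_of_eventuallyEq this
  obtain ⟨ε, hε, Θ, hΘ, hflow⟩ := exists_contDiffOn_flow_of_contDiff hχ x₀
  have hopen : IsOpen ((Ioo (-ε) ε ×ˢ Metric.ball x₀ ε) ∩ Θ ⁻¹' Metric.ball x₀ (r / 4)) :=
    hΘ.continuousOn.isOpen_inter_preimage (isOpen_Ioo.prod Metric.isOpen_ball) Metric.isOpen_ball
  have hmem : ((0, x₀) : ℝ × E) ∈
      (Ioo (-ε) ε ×ˢ Metric.ball x₀ ε) ∩ Θ ⁻¹' Metric.ball x₀ (r / 4) := by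
    have hx := Metric.mem_ball_self (x := x₀) hε
    refine ⟨⟨⟨by simpa using hε, hε⟩, hx⟩, ?_⟩
    rw [mem_preimage, (hflow x₀ hx).1]
    exact Metric.mem_ball_self (by positivity)
  obtain ⟨ε', hε', hεs⟩ := Metric.isOpen_iff.1 hopen _ hmem
  have hbox : ∀ t ∈ Ioo (-ε') ε', ∀ x ∈ Metric.ball x₀ ε',
      (t, x) ∈ (Ioo (-ε) ε ×ˢ Metric.ball x₀ ε) ∩ Θ ⁻¹' Metric.ball x₀ (r / 4) := by
    intro t ht x hx
    apply hεs
    rw [← ball_prod_same, Real.ball_eq_Ioo]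
    simpa using ⟨ht, hx⟩
  refine ⟨ε', hε', Θ, hΘ.mono fun z hz ↦ (hbox z.1 hz.1 z.2 hz.2).1, fun x hx ↦ ?_⟩
  have h0 := hbox 0 ⟨by simpa using hε', hε'⟩ x hx
  refine ⟨(hflow x h0.1.2).1, fun t ht ↦ ?_⟩
  have ht' := hbox t ht x hx
  have hd := (hflow x h0.1.2).2 t ht'.1.1
  have hmem : Θ (t, x) ∈ Metric.ball x₀ (r / 4) := ht'.2
  rw [χ.one_of_mem_closedBall (Metric.ball_subset_closedBall hmem), one_smul] at hd
  exact ⟨hrΩ (Metric.ball_subset_ball (by linarith) hmem), hd⟩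

end Flow

section FlowBox

open Set Filter Topology

universe u

theorem hasFDerivAt_flow_zero {E : Type*} [NormedAddCommGroup E] [NormedSpace ℝ E]
    {Θ : ℝ × E → E} {x₀ w : E} {ε : ℝ} (hε : 0 < ε)
    (hΘ : DifferentiableAt ℝ Θ (0, x₀)) (h0 : ∀ x ∈ Metric.ball x₀ ε, Θ (0, x) = x)
    (hd : HasDerivAt (fun t ↦ Θ (t, x₀)) w 0) :
    HasFDerivAt Θ ((ContinuousLinearMap.fst ℝ ℝ E).smulRight w + ContinuousLinearMap.snd ℝ ℝ E)
      (0, x₀) := by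
  have h := hΘ.hasFDerivAt
  have h1 : fderiv ℝ Θ (0, x₀) (1, 0) = w := by
    have h2 : HasDerivAt (fun t : ℝ ↦ (t, x₀)) ((1 : ℝ), (0 : E)) 0 :=
      (hasDerivAt_id 0).prodMk (hasDerivAt_const 0 x₀)
    exact (h.comp_hasDerivAt (0 : ℝ) h2).unique hd
  have h2 : ∀ y, fderiv ℝ Θ (0, x₀) (0, y) = y := by
    intro y
    have h3 : HasFDerivAt (fun x : E ↦ Θ (0, x))
        ((fderiv ℝ Θ (0, x₀)).comp (ContinuousLinearMap.inr ℝ ℝ E)) x₀ :=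
      HasFDerivAt.comp (g := Θ) x₀ h (hasFDerivAt_prodMk_right (0 : ℝ) x₀)
    have h4 : HasFDerivAt (fun x : E ↦ Θ (0, x)) (ContinuousLinearMap.id ℝ E) x₀ :=
      (hasFDerivAt_id x₀).congr_of_eventuallyEq
        (by filter_upwards [Metric.ball_mem_nhds x₀ hε] with x hx using h0 x hx)
    simpa using congrArg (fun A : E →L[ℝ] E ↦ A y) (h3.unique h4)
  convert h using 1
  ext z
  · simp [h1]
  · simp [h2]

/-- If `α` is a closed one-form and `τ` a vector field with `α τ = 1`, there are local coordinates
`(s, q)` with `∂/∂s = τ` and `α = ds`. -/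
theorem exists_flowBox {E : Type u} {E₀ : Type*} [NormedAddCommGroup E] [NormedSpace ℝ E]
    [FiniteDimensional ℝ E] [NormedAddCommGroup E₀] [NormedSpace ℝ E₀] [FiniteDimensional ℝ E₀]
    {Ω : Set E} (hΩ : IsOpen Ω) {x₀ : E} (hx₀ : x₀ ∈ Ω) {τ : E → E} (hτ : ContDiffOn ℝ ∞ τ Ω)
    {α : E → E →L[ℝ] ℝ} (hα : ContDiffOn ℝ ∞ α Ω)
    (hclosed : ∀ x ∈ Ω, ∀ a b, fderiv ℝ α x a b = fderiv ℝ α x b a)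
    (hατ : ∀ x ∈ Ω, α x (τ x) = 1) (L : (ℝ × E₀) ≃L[ℝ] E) (hL : L (1, 0) = τ x₀) :
    ∃ ε > 0, ∃ ψ : OpenPartialHomeomorph (ℝ × E₀) E,
      ψ.source = Ioo (-ε) ε ×ˢ Metric.ball 0 ε ∧ ψ.target ⊆ Ω ∧ ψ (0, 0) = x₀ ∧
      ContDiffOn ℝ ∞ ψ ψ.source ∧ ContDiffOn ℝ ∞ ψ.symm ψ.target ∧
      ∀ z ∈ ψ.source, fderiv ℝ ψ z (1, 0) = τ (ψ z) ∧ ∀ ξ, α (ψ z) (fderiv ℝ ψ z (0, ξ)) = 0 := by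
  have : CompleteSpace E := FiniteDimensional.complete ℝ E
  have : CompleteSpace E₀ := FiniteDimensional.complete ℝ E₀
  obtain ⟨r, hr, hrΩ⟩ := Metric.isOpen_iff.1 hΩ x₀ hx₀
  obtain ⟨s', hs'⟩ := (convex_ball x₀ r).exists_forall_hasFDerivAt_of_fderiv_symmetric
    Metric.isOpen_ball ((hα.mono hrΩ).differentiableOn (by simp))
    (fun x hx ↦ hclosed x (hrΩ hx))
  let s : E → ℝ := fun x ↦ s' x - s' x₀
  have hs : ∀ x ∈ Metric.ball x₀ r, HasFDerivAt s (α x) x := fun x hx ↦ (hs' x hx).sub_const _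
  have hs0 : s x₀ = 0 := by simp [s]
  have hssmooth : ContDiffOn ℝ ∞ s (Metric.ball x₀ r) := by
    rw [contDiffOn_infty_iff_fderiv_of_isOpen Metric.isOpen_ball]
    exact ⟨fun x hx ↦ (hs x hx).differentiableAt.differentiableWithinAt,
      (hα.mono hrΩ).congr fun x hx ↦ (hs x hx).fderiv⟩
  obtain ⟨ε₁, hε₁, Θ, hΘ, hflow⟩ := exists_contDiffOn_flow Metric.isOpen_ball (hτ.mono hrΩ)
    (Metric.mem_ball_self hr)
  have hsΘ : ∀ x ∈ Metric.ball x₀ ε₁, x ∈ Metric.ball x₀ r → ∀ t ∈ Ioo (-ε₁) ε₁,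
      s (Θ (t, x)) = s x + t := by
    intro x hx hxr t ht
    have hd : ∀ t ∈ Ioo (-ε₁) ε₁, HasDerivAt (fun t ↦ s (Θ (t, x)) - t) 0 t := by
      intro t ht
      obtain ⟨h1, h2⟩ := (hflow x hx).2 t ht
      have h3 := ((hs _ h1).comp_hasDerivAt t h2).sub (hasDerivAt_id t)
      rw [hατ _ (hrΩ h1), sub_self] at h3
      exact h3
    have h0 : (0 : ℝ) ∈ Ioo (-ε₁) ε₁ := ⟨by linarith, hε₁⟩
    have := isOpen_Ioo.is_const_of_deriv_eq_zero isPreconnected_Ioo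
      (fun t ht ↦ (hd t ht).differentiableAt.differentiableWithinAt)
      (fun t ht ↦ (hd t ht).deriv) ht h0
    simp only [(hflow x hx).1] at this
    linarith
  let j : E₀ → E := fun q ↦ x₀ + L (0, q)
  have hj : ContDiff ℝ ∞ j := contDiff_const.add (L.contDiff.comp (by fun_prop))
  let m : ℝ × E₀ → ℝ × E := fun z ↦ (z.1 - s (j z.2), j z.2)
  let O : Set (ℝ × E₀) := (fun z ↦ j z.2) ⁻¹' Metric.ball x₀ r
  have hO : IsOpen O := Metric.isOpen_ball.preimage (hj.continuous.comp continuous_snd)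
  have hm : ContDiffOn ℝ ∞ m O := by
    have h1 : ContDiff ℝ ∞ (fun z : ℝ × E₀ ↦ j z.2) := hj.comp contDiff_snd
    exact (contDiffOn_fst.sub (hssmooth.comp h1.contDiffOn fun z hz ↦ hz)).prodMk h1.contDiffOn
  let Ω' : Set (ℝ × E₀) := O ∩ m ⁻¹' (Ioo (-ε₁) ε₁ ×ˢ Metric.ball x₀ ε₁)
  have hΩ' : IsOpen Ω' :=
    hm.continuousOn.isOpen_inter_preimage hO (isOpen_Ioo.prod Metric.isOpen_ball)
  have hj0 : j 0 = x₀ := by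
    have : L ((0 : ℝ), (0 : E₀)) = 0 := L.map_zero
    simp [j, this]
  have hm0 : m 0 = (0, x₀) := by simp [m, hj0, hs0]
  have hmem : (0 : ℝ × E₀) ∈ Ω' := by
    refine ⟨?_, ?_⟩
    · change j 0 ∈ Metric.ball x₀ r
      rw [hj0]
      exact Metric.mem_ball_self hr
    · rw [mem_preimage, hm0]
      exact ⟨⟨by linarith, hε₁⟩, Metric.mem_ball_self hε₁⟩
  let f : ℝ × E₀ → E := fun z ↦ Θ (m z)
  have hf : ContDiffOn ℝ ∞ f Ω' := hΘ.comp (hm.mono inter_subset_left) fun z hz ↦ hz.2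
  let β : E₀ →L[ℝ] ℝ := (α x₀).comp ((L : (ℝ × E₀) →L[ℝ] E).comp (ContinuousLinearMap.inr ℝ ℝ E₀))
  let shear : (ℝ × E₀) ≃L[ℝ] (ℝ × E₀) := ContinuousLinearEquiv.equivOfInverse
    ((ContinuousLinearMap.fst ℝ ℝ E₀ - β.comp (ContinuousLinearMap.snd ℝ ℝ E₀)).prod
      (ContinuousLinearMap.snd ℝ ℝ E₀))
    ((ContinuousLinearMap.fst ℝ ℝ E₀ + β.comp (ContinuousLinearMap.snd ℝ ℝ E₀)).prod
      (ContinuousLinearMap.snd ℝ ℝ E₀))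
    (fun z ↦ Prod.ext (by simp) rfl) (fun z ↦ Prod.ext (by simp) rfl)
  have hfd : HasFDerivAt f ((shear.trans L : (ℝ × E₀) ≃L[ℝ] E) : (ℝ × E₀) →L[ℝ] E) 0 := by
    have hjd : HasFDerivAt (fun z : ℝ × E₀ ↦ j z.2)
        (((L : (ℝ × E₀) →L[ℝ] E).comp (ContinuousLinearMap.inr ℝ ℝ E₀)).comp
          (ContinuousLinearMap.snd ℝ ℝ E₀)) 0 :=
      (((L : (ℝ × E₀) →L[ℝ] E).comp (ContinuousLinearMap.inr ℝ ℝ E₀)).hasFDerivAt.const_add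
        x₀).comp (0 : ℝ × E₀) hasFDerivAt_snd
    have hsd : HasFDerivAt (fun z : ℝ × E₀ ↦ s (j z.2))
        ((α x₀).comp (((L : (ℝ × E₀) →L[ℝ] E).comp (ContinuousLinearMap.inr ℝ ℝ E₀)).comp
          (ContinuousLinearMap.snd ℝ ℝ E₀))) 0 :=
      HasFDerivAt.comp (g := s) (0 : ℝ × E₀)
        (by simpa [hj0] using hs x₀ (Metric.mem_ball_self hr)) hjd
    have hmd := (hasFDerivAt_fst.sub hsd).prodMk hjd
    have hΘd := hasFDerivAt_flow_zero hε₁ ((hΘ.contDiffAt ((isOpen_Ioo.prod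
      Metric.isOpen_ball).mem_nhds ⟨⟨by linarith, hε₁⟩, Metric.mem_ball_self hε₁⟩)).differentiableAt
      (by simp)) (fun x hx ↦ (hflow x hx).1)
      ((hflow x₀ (Metric.mem_ball_self hε₁)).2 0 ⟨by linarith, hε₁⟩).2
    rw [(hflow x₀ (Metric.mem_ball_self hε₁)).1] at hΘd
    have hcomp := HasFDerivAt.comp (g := Θ) (f := m) (0 : ℝ × E₀) (hm0.symm ▸ hΘd) hmd
    refine hcomp.congr_fderiv ?_
    have hLt : ∀ t : ℝ, L (t, 0) = t • τ x₀ := by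
      intro t
      rw [← hL, ← map_smul]
      simp
    have hLs : ∀ (t : ℝ) (q : E₀), L (t, q) = t • τ x₀ + L (0, q) := by
      intro t q
      rw [← hLt, ← map_add]
      simp
    refine ContinuousLinearMap.ext fun z ↦ ?_
    exact (hLs (z.1 - β z.2) z.2).symm
  obtain ⟨ψ, hψ, h0s, hsub, hsymm⟩ := exists_openPartialHomeomorph_contDiffOn hΩ' hf hmem _ hfd
  obtain ⟨ε, hε, hεs⟩ := Metric.isOpen_iff.1 ψ.open_source _ h0s
  have hbox : IsOpen (Ioo (-ε) ε ×ˢ Metric.ball (0 : E₀) ε) := isOpen_Ioo.prod Metric.isOpen_ball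
  have hboxs : Ioo (-ε) ε ×ˢ Metric.ball (0 : E₀) ε ⊆ ψ.source := by
    refine subset_trans ?_ hεs
    rw [show (0 : ℝ × E₀) = (0, 0) from rfl, ← ball_prod_same, Real.ball_eq_Ioo]
    simp
  have hsrc : (ψ.restrOpen _ hbox).source = Ioo (-ε) ε ×ˢ Metric.ball 0 ε := by
    simpa using hboxs
  have hcoe : ((ψ.restrOpen _ hbox : OpenPartialHomeomorph (ℝ × E₀) E) : ℝ × E₀ → E) = f := hψ
  have hfΩ : ∀ z ∈ Ω', f z ∈ Metric.ball x₀ r := fun z hz ↦ ((hflow _ hz.2.2).2 _ hz.2.1).1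
  have hsf : ∀ z ∈ Ω', s (f z) = z.1 := by
    intro z hz
    have := hsΘ _ hz.2.2 hz.1 _ hz.2.1
    simp only [f]
    rw [this]
    simp [m]
  refine ⟨ε, hε, ψ.restrOpen _ hbox, hsrc, ?_, ?_, ?_, ?_, ?_⟩
  · intro y hy
    have h1 := (ψ.restrOpen _ hbox).map_target hy
    rw [← (ψ.restrOpen _ hbox).right_inv hy, hcoe]
    exact hrΩ (hfΩ _ (hsub (hboxs (hsrc.subset h1))))
  · rw [hcoe]
    change Θ (m 0) = x₀
    rw [hm0, (hflow x₀ (Metric.mem_ball_self hε₁)).1]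
  · rw [hcoe, hsrc]
    exact hf.mono (hboxs.trans hsub)
  · exact hsymm.mono (fun y hy ↦ hy.1)
  · intro z hz
    have hzΩ : z ∈ Ω' := hsub (hboxs (hsrc.subset hz))
    rw [hcoe]
    have hfdz := ((hf.contDiffAt (hΩ'.mem_nhds hzΩ)).differentiableAt (by simp)).hasFDerivAt
    refine ⟨?_, fun ξ ↦ ?_⟩
    · have h1 : HasDerivAt (fun t : ℝ ↦ (t, z.2)) ((1 : ℝ), (0 : E₀)) z.1 :=
        (hasDerivAt_id _).prodMk (hasDerivAt_const _ _)
      have h2 := HasFDerivAt.comp_hasDerivAt (l := f) z.1 hfdz h1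
      have h3 : HasDerivAt (fun t ↦ f (t, z.2)) (τ (f z)) z.1 := by
        have h4 := ((hflow _ hzΩ.2.2).2 _ hzΩ.2.1).2
        have h5 : HasDerivAt (fun t : ℝ ↦ t - s (j z.2)) 1 z.1 := (hasDerivAt_id _).sub_const _
        have h6 := HasDerivAt.scomp (h := fun t : ℝ ↦ t - s (j z.2)) z.1 h4 h5
        rw [one_smul] at h6
        exact h6
      exact h2.unique h3
    · have h1 : HasFDerivAt (fun z ↦ s (f z)) ((α (f z)).comp (fderiv ℝ f z)) z :=
        (hs _ (hfΩ z hzΩ)).comp z hfdz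
      have h2 : HasFDerivAt (fun z ↦ s (f z)) (ContinuousLinearMap.fst ℝ ℝ E₀) z :=
        hasFDerivAt_fst.congr_of_eventuallyEq
          (by filter_upwards [hΩ'.mem_nhds hzΩ] with y hy using hsf y hy)
      simpa using congrArg (fun A : (ℝ × E₀) →L[ℝ] ℝ ↦ A (0, ξ)) (h1.unique h2)

end FlowBox

section LeviCivita

open Set Filter Topology

set_option linter.unusedSectionVars false

variable {E : Type*} [NormedAddCommGroup E] [NormedSpace ℝ E] [FiniteDimensional ℝ E]
  {M : Type*} [TopologicalSpace M] [ChartedSpace E M] [IsManifold 𝓘(ℝ, E) ∞ M]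
  {E' : Type*} [NormedAddCommGroup E'] [NormedSpace ℝ E']

/-- The tangent space at `p` as the model space, by the chart at `p`. -/
def modelEquiv (p : M) : TangentSpace 𝓘(ℝ, E) p ≃L[ℝ] E := ContinuousLinearEquiv.refl ℝ E

/-- The tangent vector at `q` whose components in the chart at `p` are given. -/
def chartLift (p q : M) : E →L[ℝ] TangentSpace 𝓘(ℝ, E) q :=
  (trivializationAt E (TangentSpace 𝓘(ℝ, E) : M → Type _) p).symmL ℝ q

theorem trivializationAt_self_snd (p : M) (v : TangentSpace 𝓘(ℝ, E) p) :
    (trivializationAt E (TangentSpace 𝓘(ℝ, E) : M → Type _) p ⟨p, v⟩).2 = modelEquiv p v :=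
  tangentCoordChange_self (I := 𝓘(ℝ, E)) (mem_extChartAt_source p)

theorem chartLift_trivializationAt {p q : M} (v : TangentSpace 𝓘(ℝ, E) q)
    (hq : q ∈ (chartAt E p).source) :
    chartLift p q (trivializationAt E (TangentSpace 𝓘(ℝ, E) : M → Type _) p ⟨q, v⟩).2 = v := by
  have hq' : q ∈ (trivializationAt E (TangentSpace 𝓘(ℝ, E) : M → Type _) p).baseSet := by
    simpa using hq
  have h := Trivialization.symmL_continuousLinearMapAt (R := ℝ)
    (trivializationAt E (TangentSpace 𝓘(ℝ, E) : M → Type _) p) hq' v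
  rw [Trivialization.continuousLinearMapAt_apply_of_mem _ _ hq'] at h
  exact h

theorem trivializationAt_chartLift {p q : M} (v : E) (hq : q ∈ (chartAt E p).source) :
    (trivializationAt E (TangentSpace 𝓘(ℝ, E) : M → Type _) p ⟨q, chartLift p q v⟩).2 = v := by
  have hq' : q ∈ (trivializationAt E (TangentSpace 𝓘(ℝ, E) : M → Type _) p).baseSet := by
    simpa using hq
  have h := Trivialization.continuousLinearMapAt_symmL (R := ℝ)
    (trivializationAt E (TangentSpace 𝓘(ℝ, E) : M → Type _) p) hq' v
  rw [Trivialization.continuousLinearMapAt_apply_of_mem _ _ hq'] at h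
  exact h

theorem trivializationAt_symm_eq_chartLift {p q : M} (v : E) (hq : q ∈ (chartAt E p).source) :
    (trivializationAt E (TangentSpace 𝓘(ℝ, E) : M → Type _) p).symm q v = chartLift p q v :=
  (Trivialization.symmL_apply (R := ℝ) _ (by simpa using hq) v).symm

theorem chartLift_self (p : M) (v : E) : chartLift p p v = (modelEquiv p).symm v := by
  have h := chartLift_trivializationAt ((modelEquiv p).symm v) (mem_chart_source E p)
  rwa [trivializationAt_self_snd, ContinuousLinearEquiv.apply_symm_apply] at h

theorem extend_eq_chartLift {p q : M} (v : TangentSpace 𝓘(ℝ, E) p)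
    (hq : q ∈ (chartAt E p).source) :
    FiberBundle.extend E v q = chartLift p q (modelEquiv p v) := by
  rw [← trivializationAt_symm_eq_chartLift _ hq]
  simp only [FiberBundle.extend]
  rw [trivializationAt_self_snd]

theorem mvfderiv_congr {f g : M → E'} {p : M} (h : f =ᶠ[𝓝 p] g) :
    mvfderiv 𝓘(ℝ, E) f p = mvfderiv 𝓘(ℝ, E) g p := by
  ext v
  exact congrArg (fun A : E →L[ℝ] E' ↦ A v) h.mfderiv_eq

variable [RiemannianBundle (fun x : M ↦ TangentSpace 𝓘(ℝ, E) x)]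
  [IsContMDiffRiemannianBundle 𝓘(ℝ, E) ∞ E (fun x : M ↦ TangentSpace 𝓘(ℝ, E) x)]

/-- The derivative at `p` in the direction `a` of the coefficient `⟨b, c⟩` of the metric in the
chart at `p`. -/
def metricDeriv (p : M) (a b c : TangentSpace 𝓘(ℝ, E) p) : ℝ :=
  mvfderiv 𝓘(ℝ, E) (fun q : M ↦ inner ℝ (FiberBundle.extend E b q) (FiberBundle.extend E c q)) p a

theorem mdifferentiableAt_inner_extend (p : M) (b c : TangentSpace 𝓘(ℝ, E) p) :
    MDifferentiableAt 𝓘(ℝ, E) 𝓘(ℝ, ℝ)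
      (fun q : M ↦ inner ℝ (FiberBundle.extend E b q) (FiberBundle.extend E c q)) p :=
  MDifferentiableAt.inner_bundle (FiberBundle.mdifferentiableAt_extend 𝓘(ℝ, E) E b)
    (FiberBundle.mdifferentiableAt_extend 𝓘(ℝ, E) E c)

theorem metricDeriv_comm (p : M) (a b c : TangentSpace 𝓘(ℝ, E) p) :
    metricDeriv p a b c = metricDeriv p a c b := by
  simp only [metricDeriv, real_inner_comm]

theorem metricDeriv_add_right (p : M) (a b c c' : TangentSpace 𝓘(ℝ, E) p) :
    metricDeriv p a b (c + c') = metricDeriv p a b c + metricDeriv p a b c' := by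
  have h : (fun q : M ↦ inner ℝ (FiberBundle.extend E b q) (FiberBundle.extend E (c + c') q))
      =ᶠ[𝓝 p] fun q : M ↦ inner ℝ (FiberBundle.extend E b q) (FiberBundle.extend E c q)
        + inner ℝ (FiberBundle.extend E b q) (FiberBundle.extend E c' q) := by
    filter_upwards [(chartAt E p).open_source.mem_nhds (mem_chart_source E p)] with q hq
    simp only [extend_eq_chartLift _ hq]
    rw [← inner_add_right, ← map_add, ← map_add]
  rw [metricDeriv, mvfderiv_congr h, metricDeriv, metricDeriv]
  have := mvfderiv_fun_add (mdifferentiableAt_inner_extend p b c)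
    (mdifferentiableAt_inner_extend p b c')
  exact congrArg (fun A : TangentSpace 𝓘(ℝ, E) p →L[ℝ] ℝ ↦ A a) this

theorem metricDeriv_smul_right (p : M) (a b c : TangentSpace 𝓘(ℝ, E) p) (r : ℝ) :
    metricDeriv p a b (r • c) = r * metricDeriv p a b c := by
  have h : (fun q : M ↦ inner ℝ (FiberBundle.extend E b q) (FiberBundle.extend E (r • c) q))
      =ᶠ[𝓝 p] fun q : M ↦ r • inner ℝ (FiberBundle.extend E b q) (FiberBundle.extend E c q) := by
    filter_upwards [(chartAt E p).open_source.mem_nhds (mem_chart_source E p)] with q hq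
    simp only [extend_eq_chartLift _ hq]
    rw [smul_eq_mul, ← real_inner_smul_right, ← map_smul, ← map_smul]
  rw [metricDeriv, mvfderiv_congr h, metricDeriv]
  have := mvfderiv_fun_smul (I := 𝓘(ℝ, E)) (mdifferentiableAt_const (c := r))
    (mdifferentiableAt_inner_extend p b c)
  have h2 := congrArg (fun A : TangentSpace 𝓘(ℝ, E) p →L[ℝ] ℝ ↦ A a) this
  simp only [mvfderiv_const] at h2
  simpa using h2

theorem christoffelFirst_eq (p : M) (a b c : TangentSpace 𝓘(ℝ, E) p) :
    christoffelFirst 𝓘(ℝ, E) p a b c =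
      (metricDeriv p a b c + metricDeriv p b a c - metricDeriv p c a b) / 2 := rfl

theorem inner_christoffel (p : M) (a b c : TangentSpace 𝓘(ℝ, E) p) :
    inner ℝ (christoffel 𝓘(ℝ, E) p a b) c = christoffelFirst 𝓘(ℝ, E) p a b c := by
  let Λ : TangentSpace 𝓘(ℝ, E) p →ₗ[ℝ] ℝ :=
    { toFun := fun c ↦ christoffelFirst 𝓘(ℝ, E) p a b c
      map_add' := fun c c' ↦ by
        simp only [christoffelFirst_eq, metricDeriv_add_right]
        simp only [metricDeriv, map_add]
        ring
      map_smul' := fun r c ↦ by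
        simp only [christoffelFirst_eq, metricDeriv_smul_right]
        simp only [metricDeriv, map_smul, smul_eq_mul, RingHom.id_apply]
        ring }
  change _ = Λ c
  conv_rhs => rw [← (stdOrthonormalBasis ℝ (TangentSpace 𝓘(ℝ, E) p)).sum_repr' c]
  simp only [christoffel, sum_inner, map_sum, map_smul, real_inner_smul_left, smul_eq_mul]
  exact Finset.sum_congr rfl fun i _ ↦ mul_comm _ _

theorem christoffel_comm (p : M) (a b : TangentSpace 𝓘(ℝ, E) p) :
    christoffel 𝓘(ℝ, E) p a b = christoffel 𝓘(ℝ, E) p b a := by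
  simp only [christoffel, christoffelFirst_eq]
  refine Finset.sum_congr rfl fun i _ ↦ ?_
  rw [metricDeriv_comm p _ a b, add_comm (metricDeriv p a b _)]

theorem christoffel_add_right (p : M) (a b b' : TangentSpace 𝓘(ℝ, E) p) :
    christoffel 𝓘(ℝ, E) p a (b + b') =
      christoffel 𝓘(ℝ, E) p a b + christoffel 𝓘(ℝ, E) p a b' := by
  refine ext_inner_right ℝ fun c ↦ ?_
  rw [inner_add_left]
  simp only [inner_christoffel, christoffelFirst_eq, metricDeriv_comm p a _ c,
    metricDeriv_add_right]
  simp only [metricDeriv, map_add]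
  ring

theorem christoffel_smul_right (p : M) (a b : TangentSpace 𝓘(ℝ, E) p) (r : ℝ) :
    christoffel 𝓘(ℝ, E) p a (r • b) = r • christoffel 𝓘(ℝ, E) p a b := by
  refine ext_inner_right ℝ fun c ↦ ?_
  rw [real_inner_smul_left]
  simp only [inner_christoffel, christoffelFirst_eq, metricDeriv_comm p a _ c,
    metricDeriv_smul_right]
  simp only [metricDeriv, map_smul, smul_eq_mul]
  ring

theorem inner_christoffel_add_inner_christoffel (p : M) (a b c : TangentSpace 𝓘(ℝ, E) p) :
    inner ℝ (christoffel 𝓘(ℝ, E) p a b) c + inner ℝ b (christoffel 𝓘(ℝ, E) p a c) =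
      metricDeriv p a b c := by
  rw [real_inner_comm, real_inner_comm, real_inner_comm _ b]
  simp only [inner_christoffel, christoffelFirst_eq, metricDeriv_comm p a c b]
  ring

/-- A vector field along `F`, read in the chart at `F z`. -/
def coordAlong (F : E' → M) (Y : ∀ y, TangentSpace 𝓘(ℝ, E) (F y)) (z y : E') : E :=
  (trivializationAt E (TangentSpace 𝓘(ℝ, E) : M → Type _) (F z) ⟨F y, Y y⟩).2

theorem coordAlong_self (F : E' → M) (Y : ∀ y, TangentSpace 𝓘(ℝ, E) (F y)) (z : E') :
    coordAlong F Y z z = modelEquiv (F z) (Y z) :=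
  trivializationAt_self_snd _ _

theorem covDerivAlong_eq (F : E' → M) (Y : ∀ y, TangentSpace 𝓘(ℝ, E) (F y)) (z ξ : E') :
    covDerivAlong 𝓘(ℝ, E) 𝓘(ℝ, E') F Y z ξ =
      (modelEquiv (F z)).symm (fderiv ℝ (coordAlong F Y z) z ξ)
        + christoffel 𝓘(ℝ, E) (F z) (mfderiv 𝓘(ℝ, E') 𝓘(ℝ, E) F z ξ) (Y z) := by
  have h : mvfderiv 𝓘(ℝ, E') (coordAlong F Y z) z ξ = fderiv ℝ (coordAlong F Y z) z ξ :=
    congrArg (fun A : E' →L[ℝ] E ↦ A ξ) mfderiv_eq_fderiv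
  rw [← h, ← chartLift_self, ← trivializationAt_symm_eq_chartLift _ (mem_chart_source E (F z))]
  rfl

/-- A vector field along `F` is differentiable at `z`. -/
abbrev DiffAlong (F : E' → M) (Y : ∀ y, TangentSpace 𝓘(ℝ, E) (F y)) (z : E') : Prop :=
  MDifferentiableAt 𝓘(ℝ, E') 𝓘(ℝ, E).tangent
    (fun y ↦ (⟨F y, Y y⟩ : TangentBundle 𝓘(ℝ, E) M)) z

theorem DiffAlong.mdifferentiableAt {F : E' → M} {Y : ∀ y, TangentSpace 𝓘(ℝ, E) (F y)} {z : E'}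
    (h : DiffAlong F Y z) : MDifferentiableAt 𝓘(ℝ, E') 𝓘(ℝ, E) F z :=
  ((mdifferentiableAt_totalSpace _ _).1 h).1

theorem DiffAlong.differentiableAt {F : E' → M} {Y : ∀ y, TangentSpace 𝓘(ℝ, E) (F y)} {z : E'}
    (h : DiffAlong F Y z) : DifferentiableAt ℝ (coordAlong F Y z) z :=
  mdifferentiableAt_iff_differentiableAt.1 ((mdifferentiableAt_totalSpace _ _).1 h).2

theorem covDerivAlong_congr {F : E' → M} {Y Z : ∀ y, TangentSpace 𝓘(ℝ, E) (F y)} {z : E'}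
    (h : ∀ᶠ y in 𝓝 z, Y y = Z y) (ξ : E') :
    covDerivAlong 𝓘(ℝ, E) 𝓘(ℝ, E') F Y z ξ = covDerivAlong 𝓘(ℝ, E) 𝓘(ℝ, E') F Z z ξ := by
  have h1 : coordAlong F Y z =ᶠ[𝓝 z] coordAlong F Z z := by
    filter_upwards [h] with y hy
    simp only [coordAlong, hy]
  rw [covDerivAlong_eq, covDerivAlong_eq, h1.fderiv_eq, h.self_of_nhds]

theorem coordAlong_add (F : E' → M) (Y Z : ∀ y, TangentSpace 𝓘(ℝ, E) (F y)) (a b : ℝ) (z : E')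
    {y : E'} (hy : F y ∈ (chartAt E (F z)).source) :
    coordAlong F (fun y ↦ a • Y y + b • Z y) z y =
      a • coordAlong F Y z y + b • coordAlong F Z z y := by
  have hq' : F y ∈ (trivializationAt E (TangentSpace 𝓘(ℝ, E) : M → Type _) (F z)).baseSet := by
    simpa using hy
  have h (X : TangentSpace 𝓘(ℝ, E) (F y)) :=
    Trivialization.continuousLinearMapAt_apply_of_mem ℝ
      (trivializationAt E (TangentSpace 𝓘(ℝ, E) : M → Type _) (F z)) hq' X
  simp only [coordAlong]
  rw [← h, ← h, ← h, map_add, map_smul, map_smul]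

theorem eventually_mem_chartAt_source {F : E' → M} {z : E'} (h : ContinuousAt F z) :
    ∀ᶠ y in 𝓝 z, F y ∈ (chartAt E (F z)).source :=
  h.eventually ((chartAt E (F z)).open_source.mem_nhds (mem_chart_source E (F z)))

theorem covDerivAlong_add {F : E' → M} {Y Z : ∀ y, TangentSpace 𝓘(ℝ, E) (F y)} {z : E'}
    (hY : DiffAlong F Y z) (hZ : DiffAlong F Z z) (a b : ℝ) (ξ : E') :
    covDerivAlong 𝓘(ℝ, E) 𝓘(ℝ, E') F (fun y ↦ a • Y y + b • Z y) z ξ =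
      a • covDerivAlong 𝓘(ℝ, E) 𝓘(ℝ, E') F Y z ξ + b • covDerivAlong 𝓘(ℝ, E) 𝓘(ℝ, E') F Z z ξ := by
  have h1 : coordAlong F (fun y ↦ a • Y y + b • Z y) z =ᶠ[𝓝 z]
      fun y ↦ a • coordAlong F Y z y + b • coordAlong F Z z y := by
    filter_upwards [eventually_mem_chartAt_source (E := E) hY.mdifferentiableAt.continuousAt]
      with y hy using coordAlong_add F Y Z a b z hy
  have h2 : fderiv ℝ (coordAlong F (fun y ↦ a • Y y + b • Z y) z) z ξ =
      a • fderiv ℝ (coordAlong F Y z) z ξ + b • fderiv ℝ (coordAlong F Z z) z ξ := by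
    rw [h1.fderiv_eq]
    have := (hY.differentiableAt.hasFDerivAt.const_smul a).add
      (hZ.differentiableAt.hasFDerivAt.const_smul b)
    exact congrArg (fun A : E' →L[ℝ] E ↦ A ξ) this.fderiv
  simp only [covDerivAlong_eq, h2, christoffel_add_right, christoffel_smul_right, map_add,
    map_smul, smul_add]
  abel

theorem differentiableAt_clm_of_apply {G : Type*} [NormedAddCommGroup G] [NormedSpace ℝ G]
    {B : E' → E →L[ℝ] G} {z : E'} (h : ∀ b, DifferentiableAt ℝ (fun y ↦ B y b) z) :
    DifferentiableAt ℝ B z := by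
  let e := Module.finBasis ℝ E
  have hB : B = fun y ↦ ∑ i, ContinuousLinearMap.smulRightL ℝ E G
      (LinearMap.toContinuousLinearMap (e.coord i)) (B y (e i)) := by
    ext y v
    conv_lhs => rw [← e.sum_repr v]
    simp only [map_sum, map_smul]
    simp
  rw [hB]
  fun_prop

/-- The Levi-Civita covariant derivative is compatible with the metric. -/
theorem fderiv_inner_along {F : E' → M} {Y Z : ∀ y, TangentSpace 𝓘(ℝ, E) (F y)} {z : E'}
    (hY : DiffAlong F Y z) (hZ : DiffAlong F Z z) (ξ : E') :
    fderiv ℝ (fun y ↦ inner ℝ (Y y) (Z y)) z ξ =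
      inner ℝ (covDerivAlong 𝓘(ℝ, E) 𝓘(ℝ, E') F Y z ξ) (Z z)
        + inner ℝ (Y z) (covDerivAlong 𝓘(ℝ, E) 𝓘(ℝ, E') F Z z ξ) := by
  have hF := hY.mdifferentiableAt
  have hsrc := eventually_mem_chartAt_source (E := E) hF.continuousAt
  let B : E' → E →L[ℝ] E →L[ℝ] ℝ := fun y ↦
    (innerSL ℝ (E := TangentSpace 𝓘(ℝ, E) (F y))).bilinearComp (chartLift (F z) (F y))
      (chartLift (F z) (F y))
  have hB (y : E') (b c : E) :
      B y b c = inner ℝ (chartLift (F z) (F y) b) (chartLift (F z) (F y) c) := rfl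
  have hBeq (b c : E) : (fun y ↦ B y b c) =ᶠ[𝓝 z]
      (fun q : M ↦ inner ℝ (FiberBundle.extend E ((modelEquiv (F z)).symm b) q)
        (FiberBundle.extend E ((modelEquiv (F z)).symm c) q)) ∘ F := by
    filter_upwards [hsrc] with y hy
    simp only [hB, Function.comp_apply, extend_eq_chartLift _ hy,
      ContinuousLinearEquiv.apply_symm_apply]
  have hg (b c : E) := mdifferentiableAt_inner_extend (E := E) (F z) ((modelEquiv (F z)).symm b)
    ((modelEquiv (F z)).symm c)
  have hBd (b c : E) : DifferentiableAt ℝ (fun y ↦ B y b c) z :=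
    (mdifferentiableAt_iff_differentiableAt.1
      (MDifferentiableAt.comp z (hg b c) hF)).congr_of_eventuallyEq (hBeq b c)
  have hBdiff : DifferentiableAt ℝ B z :=
    differentiableAt_clm_of_apply fun b ↦ differentiableAt_clm_of_apply fun c ↦ hBd b c
  have hB' (b c : E) : fderiv ℝ B z ξ b c =
      metricDeriv (F z) (mfderiv 𝓘(ℝ, E') 𝓘(ℝ, E) F z ξ) ((modelEquiv (F z)).symm b)
        ((modelEquiv (F z)).symm c) := by
    have h1 := (hBdiff.hasFDerivAt.clm_apply (hasFDerivAt_const b z)).clm_apply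
      (hasFDerivAt_const c z)
    have h2 := congrArg (fun A : E' →L[ℝ] ℝ ↦ A ξ) h1.fderiv
    simp only [ContinuousLinearMap.comp_zero, zero_add, ContinuousLinearMap.flip_apply] at h2
    rw [(hBeq b c).fderiv_eq] at h2
    refine h2.symm.trans ?_
    have h3 := mvfderiv_comp_apply z (hg b c) hF ξ
    refine Eq.trans ?_ h3
    exact congrArg (fun A : E' →L[ℝ] ℝ ↦ A ξ) mfderiv_eq_fderiv.symm
  have hinner : (fun y ↦ inner ℝ (Y y) (Z y)) =ᶠ[𝓝 z]
      fun y ↦ B y (coordAlong F Y z y) (coordAlong F Z z y) := by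
    filter_upwards [hsrc] with y hy
    simp only [hB, coordAlong, chartLift_trivializationAt _ hy]
  have hd := (hBdiff.hasFDerivAt.clm_apply hY.differentiableAt.hasFDerivAt).clm_apply
    hZ.differentiableAt.hasFDerivAt
  rw [hinner.fderiv_eq, hd.fderiv]
  simp only [covDerivAlong_eq, inner_add_left, inner_add_right]
  have hmet := inner_christoffel_add_inner_christoffel (F z) (mfderiv 𝓘(ℝ, E') 𝓘(ℝ, E) F z ξ)
    (Y z) (Z z)
  have hYZ := hB' (coordAlong F Y z z) (coordAlong F Z z z)
  simp only [coordAlong_self, ContinuousLinearEquiv.symm_apply_apply] at hYZ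
  have hBz (b c : E) : B z b c = inner ℝ ((modelEquiv (F z)).symm b) ((modelEquiv (F z)).symm c) := by
    rw [hB, chartLift_self, chartLift_self]
  simp only [add_apply, ContinuousLinearMap.comp_apply,
    ContinuousLinearMap.flip_apply, coordAlong_self, hBz, hYZ,
    ContinuousLinearEquiv.symm_apply_apply]
  linarith

/-- The chain rule for the covariant derivative along a map. -/
theorem covDerivAlong_comp {E₂ : Type*} [NormedAddCommGroup E₂] [NormedSpace ℝ E₂] {H' : Type*}
    [TopologicalSpace H'] {I' : ModelWithCorners ℝ E₂ H'} {S : Type*} [TopologicalSpace S]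
    [ChartedSpace H' S] {φ : S → M} {Y : ∀ x, TangentSpace 𝓘(ℝ, E) (φ x)} {g : E' → S} {z : E'}
    (hY : MDifferentiableAt I' 𝓘(ℝ, E).tangent
      (fun x ↦ (⟨φ x, Y x⟩ : TangentBundle 𝓘(ℝ, E) M)) (g z))
    (hg : MDifferentiableAt 𝓘(ℝ, E') I' g z) (ξ : E') :
    covDerivAlong 𝓘(ℝ, E) 𝓘(ℝ, E') (fun y ↦ φ (g y)) (fun y ↦ Y (g y)) z ξ =
      covDerivAlong 𝓘(ℝ, E) I' φ Y (g z) (mfderiv 𝓘(ℝ, E') I' g z ξ) := by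
  have hY' := (mdifferentiableAt_totalSpace _ _).1 hY
  have h1 : mfderiv 𝓘(ℝ, E') 𝓘(ℝ, E) (fun y ↦ φ (g y)) z ξ =
      mfderiv I' 𝓘(ℝ, E) φ (g z) (mfderiv 𝓘(ℝ, E') I' g z ξ) :=
    mfderiv_comp_apply z hY'.1 hg ξ
  have h2 : mvfderiv 𝓘(ℝ, E') (fun y ↦ (trivializationAt E (TangentSpace 𝓘(ℝ, E) : M → Type _)
        (φ (g z)) ⟨φ (g y), Y (g y)⟩).2) z ξ =
      mvfderiv I' (fun x ↦ (trivializationAt E (TangentSpace 𝓘(ℝ, E) : M → Type _)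
        (φ (g z)) ⟨φ x, Y x⟩).2) (g z) (mfderiv 𝓘(ℝ, E') I' g z ξ) :=
    mfderiv_comp_apply z hY'.2 hg ξ
  unfold covDerivAlong
  rw [h1, h2]

theorem coordAlong_mfderiv {F : E' → M} {z : E'} {n : WithTop ℕ∞} (hn : 1 ≤ n)
    (hF : ContMDiffAt 𝓘(ℝ, E') 𝓘(ℝ, E) n F z) (η : E') :
    coordAlong F (fun y ↦ mfderiv 𝓘(ℝ, E') 𝓘(ℝ, E) F y η) z =ᶠ[𝓝 z]
      fun y ↦ fderiv ℝ (fun y ↦ chartAt E (F z) (F y)) y η := by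
  filter_upwards [eventually_mem_chartAt_source (E := E) hF.continuousAt,
    (contMDiffAt_iff_contMDiffAt_nhds (by simp)).1 (hF.of_le hn)] with y hy hFy
  have h1 : MDifferentiableAt 𝓘(ℝ, E) 𝓘(ℝ, E) (chartAt E (F z)) (F y) :=
    mdifferentiableAt_atlas (chart_mem_atlas E (F z)) hy
  have h2 := mfderiv_comp_apply y h1 (hFy.mdifferentiableAt one_ne_zero) η
  have h3 : fderiv ℝ (fun y ↦ chartAt E (F z) (F y)) y η =
      mfderiv 𝓘(ℝ, E') 𝓘(ℝ, E) (chartAt E (F z) ∘ F) y η :=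
    congrArg (fun A : E' →L[ℝ] E ↦ A η) mfderiv_eq_fderiv.symm
  rw [h3, h2, mfderiv_chartAt_eq_tangentCoordChange hy]
  rfl

theorem contDiffAt_chartAt_comp {F : E' → M} {z : E'}
    (hF : ContMDiffAt 𝓘(ℝ, E') 𝓘(ℝ, E) ∞ F z) :
    ContDiffAt ℝ ∞ (fun y ↦ chartAt E (F z) (F y)) z :=
  contMDiffAt_iff_contDiffAt.1
    ((contMDiffAt_of_mem_maximalAtlas (IsManifold.chart_mem_maximalAtlas (F z))
      (mem_chart_source E (F z))).comp z hF)

theorem contMDiffAt_mfderiv_apply {F : E' → M} {z : E'}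
    (hF : ContMDiffAt 𝓘(ℝ, E') 𝓘(ℝ, E) ∞ F z) (η : E') :
    ContMDiffAt 𝓘(ℝ, E') 𝓘(ℝ, E).tangent ∞
      (fun y ↦ (⟨F y, mfderiv 𝓘(ℝ, E') 𝓘(ℝ, E) F y η⟩ : TangentBundle 𝓘(ℝ, E) M)) z := by
  rw [contMDiffAt_totalSpace]
  refine ⟨hF, ContDiffAt.contMDiffAt ?_⟩
  have h : ContDiffAt ℝ ∞ (fun y ↦ fderiv ℝ (fun y ↦ chartAt E (F z) (F y)) y η) z :=
    ((contDiffAt_chartAt_comp hF).fderiv_right (m := ∞) (by simp)).clm_apply contDiffAt_const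
  exact h.congr_of_eventuallyEq (coordAlong_mfderiv (by simp) hF η)

theorem diffAlong_mfderiv_apply {F : E' → M} {z : E'}
    (hF : ContMDiffAt 𝓘(ℝ, E') 𝓘(ℝ, E) ∞ F z) (η : E') :
    DiffAlong F (fun y ↦ mfderiv 𝓘(ℝ, E') 𝓘(ℝ, E) F y η) z :=
  (contMDiffAt_mfderiv_apply hF η).mdifferentiableAt (by simp)

/-- The Levi-Civita covariant derivative has no torsion. -/
theorem covDerivAlong_mfderiv_comm {F : E' → M} {z : E'}
    (hF : ContMDiffAt 𝓘(ℝ, E') 𝓘(ℝ, E) ∞ F z) (ξ η : E') :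
    covDerivAlong 𝓘(ℝ, E) 𝓘(ℝ, E') F (fun y ↦ mfderiv 𝓘(ℝ, E') 𝓘(ℝ, E) F y η) z ξ =
      covDerivAlong 𝓘(ℝ, E) 𝓘(ℝ, E') F (fun y ↦ mfderiv 𝓘(ℝ, E') 𝓘(ℝ, E) F y ξ) z η := by
  have hf := contDiffAt_chartAt_comp hF
  have hd : DifferentiableAt ℝ (fderiv ℝ (fun y ↦ chartAt E (F z) (F y))) z :=
    (hf.fderiv_right (m := ∞) (by simp)).differentiableAt (by simp)
  have h (a b : E') : fderiv ℝ (coordAlong F (fun y ↦ mfderiv 𝓘(ℝ, E') 𝓘(ℝ, E) F y a) z) z b =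
      fderiv ℝ (fderiv ℝ (fun y ↦ chartAt E (F z) (F y))) z b a := by
    rw [(coordAlong_mfderiv (by simp) hF a).fderiv_eq]
    have := hd.hasFDerivAt.clm_apply (hasFDerivAt_const a z)
    rw [this.fderiv]
    simp
  rw [covDerivAlong_eq, covDerivAlong_eq, h, h, christoffel_comm]
  congr 2
  exact (hf.isSymmSndFDerivAt (by simp; exact WithTop.coe_le_coe.2 le_top)) ξ η

end LeviCivita

section ConformallyFlat

open Set Filter Topology

set_option linter.unusedSectionVars false

variable {E : Type*} [NormedAddCommGroup E] [InnerProductSpace ℝ E] [FiniteDimensional ℝ E]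
  {M : Type*} [TopologicalSpace M] [ChartedSpace E M] [IsManifold 𝓘(ℝ, E) ∞ M]
  [RiemannianBundle (fun x : M ↦ TangentSpace 𝓘(ℝ, E) x)]
  {E' : Type*} [NormedAddCommGroup E'] [NormedSpace ℝ E']

/-- The smooth map `Φ : M → E` pulls back the metric `⟨ , ⟩ / κ²`, with `κ y = ⟨c, y⟩ + d`,
to the metric of `M`. -/
structure IsConformallyFlatChart (Φ : M → E) (c : E) (d : ℝ) : Prop where
  smooth : ContMDiff 𝓘(ℝ, E) 𝓘(ℝ, E) ∞ Φ
  ne_zero : ∀ p, inner ℝ c (Φ p) + d ≠ 0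
  inner_eq : ∀ (p : M) (v w : TangentSpace 𝓘(ℝ, E) p),
    inner ℝ v w = inner ℝ (mvfderiv 𝓘(ℝ, E) Φ p v) (mvfderiv 𝓘(ℝ, E) Φ p w) /
      (inner ℝ c (Φ p) + d) ^ 2

/-- The map `Φ` read in the chart at `p`. -/
def readInChart (Φ : M → E) (p : M) (x : E) : E := Φ ((chartAt E p).symm x)

theorem contDiffAt_readInChart {Φ : M → E} (hΦ : ContMDiff 𝓘(ℝ, E) 𝓘(ℝ, E) ∞ Φ) (p : M) {x : E}
    (hx : x ∈ (chartAt E p).target) : ContDiffAt ℝ ∞ (readInChart Φ p) x :=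
  contMDiffAt_iff_contDiffAt.1 (ContMDiffAt.comp x hΦ.contMDiffAt
    (contMDiffAt_symm_of_mem_maximalAtlas (IsManifold.chart_mem_maximalAtlas p) hx))

theorem mvfderiv_eq_fderiv_readInChart {Φ : M → E} (hΦ : ContMDiff 𝓘(ℝ, E) 𝓘(ℝ, E) ∞ Φ)
    {p q : M} (hq : q ∈ (chartAt E p).source) (v : TangentSpace 𝓘(ℝ, E) q) :
    mvfderiv 𝓘(ℝ, E) Φ q v = fderiv ℝ (readInChart Φ p) (chartAt E p q)
      (trivializationAt E (TangentSpace 𝓘(ℝ, E) : M → Type _) p ⟨q, v⟩).2 := by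
  have h1 : MDifferentiableAt 𝓘(ℝ, E) 𝓘(ℝ, E) (chartAt E p) q :=
    mdifferentiableAt_atlas (chart_mem_atlas E p) hq
  have h2 : MDifferentiableAt 𝓘(ℝ, E) 𝓘(ℝ, E) (readInChart Φ p) (chartAt E p q) :=
    ((contDiffAt_readInChart hΦ p ((chartAt E p).map_source hq)).differentiableAt
      (by simp)).mdifferentiableAt
  have h3 : Φ =ᶠ[𝓝 q] readInChart Φ p ∘ chartAt E p := by
    filter_upwards [(chartAt E p).open_source.mem_nhds hq] with y hy
    simp [readInChart, (chartAt E p).left_inv hy]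
  rw [mvfderiv_congr h3]
  refine (mfderiv_comp_apply q h2 h1 v).trans ?_
  rw [mfderiv_chartAt_eq_tangentCoordChange hq]
  exact congrArg (fun A : E →L[ℝ] E ↦ A (tangentCoordChange 𝓘(ℝ, E) q p q v)) mfderiv_eq_fderiv

variable [IsContMDiffRiemannianBundle 𝓘(ℝ, E) ∞ E (fun x : M ↦ TangentSpace 𝓘(ℝ, E) x)]

theorem IsConformallyFlatChart.injective {Φ : M → E} {c : E} {d : ℝ}
    (h : IsConformallyFlatChart Φ c d) (p : M) :
    Function.Injective (mvfderiv 𝓘(ℝ, E) Φ p) := by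
  rw [injective_iff_map_eq_zero]
  intro v hv
  have := h.inner_eq p v v
  rw [hv, inner_zero_left, zero_div] at this
  exact inner_self_eq_zero.1 this

theorem IsConformallyFlatChart.surjective {Φ : M → E} {c : E} {d : ℝ}
    (h : IsConformallyFlatChart Φ c d) (p : M) :
    Function.Surjective (mvfderiv 𝓘(ℝ, E) Φ p) := by
  have h1 : Function.Injective ((mvfderiv 𝓘(ℝ, E) Φ p).comp
      (modelEquiv (E := E) p).symm.toContinuousLinearMap).toLinearMap :=
    fun x y hxy ↦ (modelEquiv p).symm.injective (h.injective p hxy)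
  intro y
  obtain ⟨x, hx⟩ := LinearMap.surjective_of_injective h1 y
  exact ⟨_, hx⟩

theorem IsConformallyFlatChart.metricDeriv_eq {Φ : M → E} {c : E} {d : ℝ}
    (h : IsConformallyFlatChart Φ c d) (p : M) (u v w : TangentSpace 𝓘(ℝ, E) p) :
    metricDeriv p u v w =
      (inner ℝ (fderiv ℝ (fderiv ℝ (readInChart Φ p)) (chartAt E p p) (modelEquiv p u)
          (modelEquiv p v)) (mvfderiv 𝓘(ℝ, E) Φ p w)
        + inner ℝ (mvfderiv 𝓘(ℝ, E) Φ p v)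
          (fderiv ℝ (fderiv ℝ (readInChart Φ p)) (chartAt E p p) (modelEquiv p u)
          (modelEquiv p w))) / (inner ℝ c (Φ p) + d) ^ 2
      - 2 * inner ℝ c (mvfderiv 𝓘(ℝ, E) Φ p u) *
        inner ℝ (mvfderiv 𝓘(ℝ, E) Φ p v) (mvfderiv 𝓘(ℝ, E) Φ p w)
          / (inner ℝ c (Φ p) + d) ^ 3 := by
  have hp := mem_chart_source E p
  have hpt := (chartAt E p).map_source hp
  let f := readInChart Φ p
  let m : E → ℝ := fun x ↦ inner ℝ (fderiv ℝ f x (modelEquiv p v)) (fderiv ℝ f x (modelEquiv p w)) /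
    (inner ℝ c (f x) + d) ^ 2
  have hf : ContDiffAt ℝ ∞ f (chartAt E p p) := contDiffAt_readInChart h.smooth p hpt
  have hfp : f (chartAt E p p) = Φ p := by simp [f, readInChart, (chartAt E p).left_inv hp]
  have hDΦ (a : TangentSpace 𝓘(ℝ, E) p) :
      mvfderiv 𝓘(ℝ, E) Φ p a = fderiv ℝ f (chartAt E p p) (modelEquiv p a) := by
    rw [mvfderiv_eq_fderiv_readInChart h.smooth hp, trivializationAt_self_snd]
  have h1 : (fun q : M ↦ inner ℝ (FiberBundle.extend E v q) (FiberBundle.extend E w q))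
      =ᶠ[𝓝 p] m ∘ chartAt E p := by
    filter_upwards [(chartAt E p).open_source.mem_nhds hp] with q hq
    rw [extend_eq_chartLift _ hq, extend_eq_chartLift _ hq, h.inner_eq,
      mvfderiv_eq_fderiv_readInChart h.smooth hq, mvfderiv_eq_fderiv_readInChart h.smooth hq,
      trivializationAt_chartLift _ hq, trivializationAt_chartLift _ hq]
    simp [m, f, readInChart, (chartAt E p).left_inv hq]
  have hf1 : HasFDerivAt f (fderiv ℝ f (chartAt E p p)) (chartAt E p p) :=
    (hf.differentiableAt (by simp)).hasFDerivAt
  have hf2 : HasFDerivAt (fderiv ℝ f) (fderiv ℝ (fderiv ℝ f) (chartAt E p p)) (chartAt E p p) :=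
    ((hf.fderiv_right (m := ∞) (by simp)).differentiableAt (by simp)).hasFDerivAt
  have hfa (a : E) : HasFDerivAt (fun x ↦ fderiv ℝ f x a)
      ((fderiv ℝ (fderiv ℝ f) (chartAt E p p)).flip a) (chartAt E p p) := by
    simpa using hf2.clm_apply (hasFDerivAt_const a (chartAt E p p))
  have hne : (inner ℝ c (f (chartAt E p p)) + d) ^ 2 ≠ 0 := by
    rw [hfp]
    exact pow_ne_zero 2 (h.ne_zero p)
  let δ : E := modelEquiv p u
  have hline (g : E → E) (g' : E →L[ℝ] E) (hg : HasFDerivAt g g' (chartAt E p p)) :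
      HasDerivAt (fun t : ℝ ↦ g (chartAt E p p + t • δ)) (g' δ) 0 := by
    have hl : HasDerivAt (fun t : ℝ ↦ chartAt E p p + t • δ) δ 0 := by
      simpa using ((hasDerivAt_id (0 : ℝ)).smul_const δ).const_add (chartAt E p p)
    exact HasFDerivAt.comp_hasDerivAt (0 : ℝ) (by simpa using hg) hl
  have hmd : DifferentiableAt ℝ m (chartAt E p p) := by
    have hnum : DifferentiableAt ℝ (fun x ↦ inner ℝ (fderiv ℝ f x (modelEquiv p v))
        (fderiv ℝ f x (modelEquiv p w))) (chartAt E p p) :=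
      (hfa _).differentiableAt.inner ℝ (hfa _).differentiableAt
    have hden : DifferentiableAt ℝ (fun x ↦ inner ℝ c (f x) + d) (chartAt E p p) :=
      ((differentiableAt_const c).inner ℝ hf1.differentiableAt).add_const d
    have hden2 : DifferentiableAt ℝ (fun x ↦ (inner ℝ c (f x) + d) ^ 2) (chartAt E p p) :=
      hden.fun_pow 2
    have hinv : DifferentiableAt ℝ (fun x ↦ ((inner ℝ c (f x) + d) ^ 2)⁻¹) (chartAt E p p) :=
      DifferentiableAt.fun_inv hden2 hne
    simpa only [m, div_eq_mul_inv] using hnum.fun_mul hinv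
  have h2 : metricDeriv p u v w = fderiv ℝ m (chartAt E p p) δ := by
    rw [metricDeriv, mvfderiv_congr h1]
    refine (mfderiv_comp_apply p hmd.mdifferentiableAt
      (mdifferentiableAt_atlas (chart_mem_atlas E p) hp) u).trans ?_
    rw [mfderiv_chartAt_eq_tangentCoordChange hp]
    have hδ : tangentCoordChange 𝓘(ℝ, E) p p p u = δ := trivializationAt_self_snd p u
    exact (congrArg (mfderiv 𝓘(ℝ, E) 𝓘(ℝ, ℝ) m (chartAt E p p)) hδ).trans
      (congrArg (fun A : E →L[ℝ] ℝ ↦ A δ) mfderiv_eq_fderiv)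
  have h3 : HasDerivAt (fun t : ℝ ↦ m (chartAt E p p + t • δ)) (fderiv ℝ m (chartAt E p p) δ) 0 := by
    have hl : HasDerivAt (fun t : ℝ ↦ chartAt E p p + t • δ) δ 0 := by
      simpa using ((hasDerivAt_id (0 : ℝ)).smul_const δ).const_add (chartAt E p p)
    exact HasFDerivAt.comp_hasDerivAt (0 : ℝ) (by simpa using hmd.hasFDerivAt) hl
  have hA := hline _ _ (hfa (modelEquiv p v))
  have hB := hline _ _ (hfa (modelEquiv p w))
  have hC := hline _ _ hf1
  have hD := (((hasDerivAt_const (0 : ℝ) c).inner ℝ hC).add_const d).pow 2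
  have hE := (hA.inner ℝ hB).div hD (by simpa using hne)
  have h4 := h3.unique hE
  rw [h2, h4, hDΦ u, hDΦ v, hDΦ w]
  have hne' := h.ne_zero p
  simp only [zero_smul, add_zero, hfp, ContinuousLinearMap.flip_apply, inner_zero_left, δ, f,
    Pi.pow_apply, Nat.cast_ofNat, Nat.add_one_sub_one, pow_one]
  field_simp
  ring

theorem IsConformallyFlatChart.mvfderiv_christoffel {Φ : M → E} {c : E} {d : ℝ}
    (h : IsConformallyFlatChart Φ c d) (p : M) (u v : TangentSpace 𝓘(ℝ, E) p) :
    mvfderiv 𝓘(ℝ, E) Φ p (christoffel 𝓘(ℝ, E) p u v) =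
      fderiv ℝ (fderiv ℝ (readInChart Φ p)) (chartAt E p p) (modelEquiv p u) (modelEquiv p v)
      - (inner ℝ c (Φ p) + d)⁻¹ • (
        inner ℝ c (mvfderiv 𝓘(ℝ, E) Φ p u) • mvfderiv 𝓘(ℝ, E) Φ p v
        + inner ℝ c (mvfderiv 𝓘(ℝ, E) Φ p v) • mvfderiv 𝓘(ℝ, E) Φ p u
        - inner ℝ (mvfderiv 𝓘(ℝ, E) Φ p u) (mvfderiv 𝓘(ℝ, E) Φ p v) • c) := by
  refine ext_inner_right ℝ fun y ↦ ?_
  obtain ⟨w, rfl⟩ := h.surjective p y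
  have hne := h.ne_zero p
  have h1 := h.inner_eq p (christoffel 𝓘(ℝ, E) p u v) w
  rw [inner_christoffel, christoffelFirst_eq, h.metricDeriv_eq, h.metricDeriv_eq,
    h.metricDeriv_eq] at h1
  have hsymm (a b : E) : fderiv ℝ (fderiv ℝ (readInChart Φ p)) (chartAt E p p) a b =
      fderiv ℝ (fderiv ℝ (readInChart Φ p)) (chartAt E p p) b a :=
    ((contDiffAt_readInChart h.smooth p ((chartAt E p).map_source
      (mem_chart_source E p))).isSymmSndFDerivAt
        (by simp; exact WithTop.coe_le_coe.2 le_top)) a b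
  rw [hsymm (modelEquiv p v) (modelEquiv p u), hsymm (modelEquiv p w) (modelEquiv p u),
    hsymm (modelEquiv p w) (modelEquiv p v)] at h1
  simp only [inner_sub_left, inner_add_left, real_inner_smul_left]
  generalize fderiv ℝ (fderiv ℝ (readInChart Φ p)) (chartAt E p p) (modelEquiv p u)
    (modelEquiv p v) = Suv at *
  generalize fderiv ℝ (fderiv ℝ (readInChart Φ p)) (chartAt E p p) (modelEquiv p u)
    (modelEquiv p w) = Suw at *
  generalize fderiv ℝ (fderiv ℝ (readInChart Φ p)) (chartAt E p p) (modelEquiv p v)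
    (modelEquiv p w) = Svw at *
  generalize mvfderiv 𝓘(ℝ, E) Φ p (christoffel 𝓘(ℝ, E) p u v) = Γ at *
  generalize mvfderiv 𝓘(ℝ, E) Φ p u = u' at *
  generalize mvfderiv 𝓘(ℝ, E) Φ p v = v' at *
  generalize mvfderiv 𝓘(ℝ, E) Φ p w = w' at *
  generalize inner ℝ c (Φ p) + d = κ at *
  rw [real_inner_comm v' Suw] at h1
  field_simp at h1 ⊢
  linarith

/-- The covariant derivative of a conformally flat metric. -/
theorem IsConformallyFlatChart.mvfderiv_covDerivAlong {Φ : M → E} {c : E} {d : ℝ}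
    (h : IsConformallyFlatChart Φ c d) {F : E' → M} {Y : ∀ y, TangentSpace 𝓘(ℝ, E) (F y)}
    {z : E'} (hY : DiffAlong F Y z) (ξ : E') :
    HasFDerivAt (fun y ↦ mvfderiv 𝓘(ℝ, E) Φ (F y) (Y y))
      (fderiv ℝ (fun y ↦ mvfderiv 𝓘(ℝ, E) Φ (F y) (Y y)) z) z ∧
    fderiv ℝ (fun y ↦ mvfderiv 𝓘(ℝ, E) Φ (F y) (Y y)) z ξ =
      mvfderiv 𝓘(ℝ, E) Φ (F z) (covDerivAlong 𝓘(ℝ, E) 𝓘(ℝ, E') F Y z ξ)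
      + (inner ℝ c (Φ (F z)) + d)⁻¹ • (
        inner ℝ c (mvfderiv 𝓘(ℝ, E) Φ (F z) (mfderiv 𝓘(ℝ, E') 𝓘(ℝ, E) F z ξ)) •
          mvfderiv 𝓘(ℝ, E) Φ (F z) (Y z)
        + inner ℝ c (mvfderiv 𝓘(ℝ, E) Φ (F z) (Y z)) •
          mvfderiv 𝓘(ℝ, E) Φ (F z) (mfderiv 𝓘(ℝ, E') 𝓘(ℝ, E) F z ξ)
        - inner ℝ (mvfderiv 𝓘(ℝ, E) Φ (F z) (mfderiv 𝓘(ℝ, E') 𝓘(ℝ, E) F z ξ))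
          (mvfderiv 𝓘(ℝ, E) Φ (F z) (Y z)) • c) := by
  have hp := mem_chart_source E (F z)
  let f := readInChart Φ (F z)
  have hf : ContDiffAt ℝ ∞ f (chartAt E (F z) (F z)) :=
    contDiffAt_readInChart h.smooth (F z) ((chartAt E (F z)).map_source hp)
  have hF := hY.mdifferentiableAt
  have h1 : (fun y ↦ mvfderiv 𝓘(ℝ, E) Φ (F y) (Y y)) =ᶠ[𝓝 z]
      fun y ↦ fderiv ℝ f (chartAt E (F z) (F y)) (coordAlong F Y z y) := by
    filter_upwards [eventually_mem_chartAt_source (E := E) hF.continuousAt] with y hy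
    exact mvfderiv_eq_fderiv_readInChart h.smooth hy _
  have hchart := mdifferentiableAt_atlas (I := 𝓘(ℝ, E)) (chart_mem_atlas E (F z)) hp
  have hFd : DifferentiableAt ℝ (fun y ↦ chartAt E (F z) (F y)) z :=
    mdifferentiableAt_iff_differentiableAt.1 (hchart.comp z hF)
  have hFξ : fderiv ℝ (fun y ↦ chartAt E (F z) (F y)) z ξ =
      modelEquiv (F z) (mfderiv 𝓘(ℝ, E') 𝓘(ℝ, E) F z ξ) := by
    have h2 := mfderiv_comp_apply z hchart hF ξ
    rw [mfderiv_chartAt_eq_tangentCoordChange hp] at h2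
    exact ((congrArg (fun A : E' →L[ℝ] E ↦ A ξ) mfderiv_eq_fderiv.symm).trans h2).trans
      (trivializationAt_self_snd (F z) _)
  have hf2 : HasFDerivAt (fderiv ℝ f) (fderiv ℝ (fderiv ℝ f) (chartAt E (F z) (F z)))
      (chartAt E (F z) (F z)) :=
    ((hf.fderiv_right (m := ∞) (by simp)).differentiableAt (by simp)).hasFDerivAt
  have hd := (HasFDerivAt.comp z hf2 hFd.hasFDerivAt).clm_apply hY.differentiableAt.hasFDerivAt
  have hd' := hd.congr_of_eventuallyEq h1
  refine ⟨hd'.differentiableAt.hasFDerivAt, ?_⟩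
  rw [hd'.fderiv, covDerivAlong_eq, map_add, h.mvfderiv_christoffel]
  have h5 (a : E) : mvfderiv 𝓘(ℝ, E) Φ (F z) ((modelEquiv (F z)).symm a) =
      fderiv ℝ f (chartAt E (F z) (F z)) a := by
    rw [mvfderiv_eq_fderiv_readInChart h.smooth hp, trivializationAt_self_snd,
      ContinuousLinearEquiv.apply_symm_apply]
  simp only [add_apply, ContinuousLinearMap.comp_apply, ContinuousLinearMap.flip_apply,
    Function.comp_apply, h5, hFξ, coordAlong_self]
  simp only [f]
  abel

end ConformallyFlat

section Constancy

open Set Filter Topology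

set_option linter.unusedSectionVars false

variable {E₀ : Type*} [NormedAddCommGroup E₀] [NormedSpace ℝ E₀] [FiniteDimensional ℝ E₀]
  {E : Type*} [NormedAddCommGroup E] [InnerProductSpace ℝ E] [FiniteDimensional ℝ E]

theorem exists_not_mem_span_singleton (hn : 2 ≤ Module.finrank ℝ E₀) (η : E₀) :
    ∃ ξ : E₀, ξ ∉ Submodule.span ℝ {η} := by
  by_contra! h
  have h1 : Submodule.span ℝ {η} = ⊤ := eq_top_iff.2 fun x _ ↦ h x
  have h2 := finrank_span_le_card (R := ℝ) ({η} : Set E₀)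
  rw [h1, finrank_top] at h2
  simp at h2
  omega

/-- If the derivative of `w` is everywhere a multiple `a` of that of an immersion `G` of an open
set of dimension at least two, then `a` is locally constant. -/
theorem hasFDerivAt_zero_of_fderiv_eq_smul (hn : 2 ≤ Module.finrank ℝ E₀) {W : Set E₀}
    (hW : IsOpen W) {w G : E₀ → E} (hw : ContDiffOn ℝ ∞ w W) (hG : ContDiffOn ℝ ∞ G W)
    {a : E₀ → ℝ} (hwG : ∀ q ∈ W, ∀ ξ, fderiv ℝ w q ξ = a q • fderiv ℝ G q ξ)
    (hinj : ∀ q ∈ W, Function.Injective (fderiv ℝ G q)) {q : E₀} (hq : q ∈ W) :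
    HasFDerivAt a (0 : E₀ →L[ℝ] ℝ) q := by
  obtain ⟨e, he⟩ := exists_not_mem_span_singleton hn (0 : E₀)
  have he0 : e ≠ 0 := by
    rintro rfl
    exact he (Submodule.zero_mem _)
  have hwq := hw.contDiffAt (hW.mem_nhds hq)
  have hGq := hG.contDiffAt (hW.mem_nhds hq)
  have hw2 : DifferentiableAt ℝ (fderiv ℝ w) q :=
    (hwq.fderiv_right (m := ∞) (by simp)).differentiableAt (by simp)
  have hG2 : DifferentiableAt ℝ (fderiv ℝ G) q :=
    (hGq.fderiv_right (m := ∞) (by simp)).differentiableAt (by simp)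
  have hne (x : E₀) (hx : x ∈ W) :
      inner ℝ (fderiv ℝ G x e) (fderiv ℝ G x e) ≠ 0 := by
    rw [Ne, inner_self_eq_zero]
    exact fun h ↦ he0 (hinj x hx (h.trans (map_zero _).symm))
  have ha : a =ᶠ[𝓝 q] fun x ↦ inner ℝ (fderiv ℝ w x e) (fderiv ℝ G x e) *
      (inner ℝ (fderiv ℝ G x e) (fderiv ℝ G x e))⁻¹ := by
    filter_upwards [hW.mem_nhds hq] with x hx
    rw [hwG x hx, real_inner_smul_left, mul_assoc, mul_inv_cancel₀ (hne x hx), mul_one]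
  have hwe : DifferentiableAt ℝ (fun x ↦ fderiv ℝ w x e) q :=
    hw2.clm_apply (differentiableAt_const e)
  have hGe : DifferentiableAt ℝ (fun x ↦ fderiv ℝ G x e) q :=
    hG2.clm_apply (differentiableAt_const e)
  have hden : DifferentiableAt ℝ
      (fun x ↦ (inner ℝ (fderiv ℝ G x e) (fderiv ℝ G x e))⁻¹) q :=
    DifferentiableAt.fun_inv (hGe.inner ℝ hGe) (hne q hq)
  have had : DifferentiableAt ℝ a q :=
    ((hwe.inner ℝ hGe).fun_mul hden).congr_of_eventuallyEq ha
  have h1 : fderiv ℝ w =ᶠ[𝓝 q] fun x ↦ a x • fderiv ℝ G x := by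
    filter_upwards [hW.mem_nhds hq] with x hx
    ext ξ
    exact hwG x hx ξ
  have h2 (η ξ : E₀) : fderiv ℝ (fderiv ℝ w) q η ξ =
      a q • fderiv ℝ (fderiv ℝ G) q η ξ + fderiv ℝ a q η • fderiv ℝ G q ξ := by
    rw [h1.fderiv_eq, (had.hasFDerivAt.fun_smul hG2.hasFDerivAt).fderiv]
    simp
  have hs {f : E₀ → E} (hf : ContDiffAt ℝ ∞ f q) (η ξ : E₀) :
      fderiv ℝ (fderiv ℝ f) q η ξ = fderiv ℝ (fderiv ℝ f) q ξ η :=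
    (hf.isSymmSndFDerivAt (by simp; exact WithTop.coe_le_coe.2 le_top)) η ξ
  have h3 (η ξ : E₀) : fderiv ℝ a q η • ξ = fderiv ℝ a q ξ • η := by
    apply hinj q hq
    have h4 := h2 η ξ
    rw [hs hwq, h2 ξ η, hs hGq] at h4
    simpa using (add_left_cancel h4).symm
  have h5 : fderiv ℝ a q = 0 := by
    ext η
    obtain ⟨ξ, hξ⟩ := exists_not_mem_span_singleton hn η
    by_contra hη
    refine hξ (Submodule.mem_span_singleton.2 ⟨(fderiv ℝ a q η)⁻¹ * fderiv ℝ a q ξ, ?_⟩)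
    rw [mul_smul, ← h3, inv_smul_smul₀ hη]
  rw [← h5]
  exact had.hasFDerivAt

variable {M : Type*} [TopologicalSpace M] [ChartedSpace E M] [IsManifold 𝓘(ℝ, E) ∞ M]
  [RiemannianBundle (fun x : M ↦ TangentSpace 𝓘(ℝ, E) x)]
  [IsContMDiffRiemannianBundle 𝓘(ℝ, E) ∞ E (fun x : M ↦ TangentSpace 𝓘(ℝ, E) x)]

theorem contDiffAt_mvfderiv_along {Φ : M → E} (hΦ : ContMDiff 𝓘(ℝ, E) 𝓘(ℝ, E) ∞ Φ)
    {F : E₀ → M} {Y : ∀ y, TangentSpace 𝓘(ℝ, E) (F y)} {z : E₀}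
    (hY : ContMDiffAt 𝓘(ℝ, E₀) 𝓘(ℝ, E).tangent ∞
      (fun y ↦ (⟨F y, Y y⟩ : TangentBundle 𝓘(ℝ, E) M)) z) :
    ContDiffAt ℝ ∞ (fun y ↦ mvfderiv 𝓘(ℝ, E) Φ (F y) (Y y)) z := by
  have hY' := (contMDiffAt_totalSpace).1 hY
  have hF : ContMDiffAt 𝓘(ℝ, E₀) 𝓘(ℝ, E) ∞ F z := hY'.1
  have hc : ContDiffAt ℝ ∞ (coordAlong F Y z) z := contMDiffAt_iff_contDiffAt.1 hY'.2
  have h1 : (fun y ↦ mvfderiv 𝓘(ℝ, E) Φ (F y) (Y y)) =ᶠ[𝓝 z]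
      fun y ↦ fderiv ℝ (readInChart Φ (F z)) (chartAt E (F z) (F y)) (coordAlong F Y z y) := by
    filter_upwards [eventually_mem_chartAt_source (E := E) hF.continuousAt] with y hy
    exact mvfderiv_eq_fderiv_readInChart hΦ hy _
  refine ContDiffAt.congr_of_eventuallyEq (ContDiffAt.clm_apply ?_ hc) h1
  exact ContDiffAt.comp z (((contDiffAt_readInChart hΦ (F z) ((chartAt E (F z)).map_source
    (mem_chart_source E (F z)))).fderiv_right (m := ∞) (by simp))) (contDiffAt_chartAt_comp hF)

/-- In a conformally flat space of this form, the principal curvature of an umbilical normal field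
along an immersion of dimension at least two is locally constant. -/
theorem IsConformallyFlatChart.hasFDerivAt_zero (hn : 2 ≤ Module.finrank ℝ E₀) {Φ : M → E}
    {c : E} {d : ℝ} (h : IsConformallyFlatChart Φ c d) {W : Set E₀} (hW : IsOpen W) {F : E₀ → M}
    {Y : ∀ y, TangentSpace 𝓘(ℝ, E) (F y)}
    (hY : ∀ q ∈ W, ContMDiffAt 𝓘(ℝ, E₀) 𝓘(ℝ, E).tangent ∞
      (fun y ↦ (⟨F y, Y y⟩ : TangentBundle 𝓘(ℝ, E) M)) q)
    (hinj : ∀ q ∈ W, Function.Injective (mfderiv 𝓘(ℝ, E₀) 𝓘(ℝ, E) F q))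
    (hperp : ∀ q ∈ W, ∀ ξ : E₀, inner ℝ (mfderiv 𝓘(ℝ, E₀) 𝓘(ℝ, E) F q ξ) (Y q) = 0)
    {a : E₀ → ℝ} (ha : ∀ q ∈ W, ∀ ξ : E₀, covDerivAlong 𝓘(ℝ, E) 𝓘(ℝ, E₀) F Y q ξ =
      a q • mfderiv 𝓘(ℝ, E₀) 𝓘(ℝ, E) F q ξ) {q : E₀} (hq : q ∈ W) :
    HasFDerivAt a (0 : E₀ →L[ℝ] ℝ) q := by
  let G : E₀ → E := fun y ↦ Φ (F y)
  let κ : E₀ → ℝ := fun y ↦ inner ℝ c (G y) + d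
  let w : E₀ → E := fun y ↦ (κ y)⁻¹ • mvfderiv 𝓘(ℝ, E) Φ (F y) (Y y)
  have hF (x : E₀) (hx : x ∈ W) : ContMDiffAt 𝓘(ℝ, E₀) 𝓘(ℝ, E) ∞ F x :=
    (contMDiffAt_totalSpace.1 (hY x hx)).1
  have hG (x : E₀) (hx : x ∈ W) : ContDiffAt ℝ ∞ G x :=
    contMDiffAt_iff_contDiffAt.1 (h.smooth.contMDiffAt.comp x (hF x hx))
  have hκ0 (x : E₀) : κ x ≠ 0 := h.ne_zero (F x)
  have hκ (x : E₀) (hx : x ∈ W) : ContDiffAt ℝ ∞ κ x :=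
    (contDiffAt_const.inner ℝ (hG x hx)).add contDiffAt_const
  have hw (x : E₀) (hx : x ∈ W) : ContDiffAt ℝ ∞ w x :=
    ((hκ x hx).inv (hκ0 x)).smul (contDiffAt_mvfderiv_along h.smooth (hY x hx))
  have hDG (x : E₀) (hx : x ∈ W) (ξ : E₀) : fderiv ℝ G x ξ =
      mvfderiv 𝓘(ℝ, E) Φ (F x) (mfderiv 𝓘(ℝ, E₀) 𝓘(ℝ, E) F x ξ) := by
    have h1 := mfderiv_comp_apply x (h.smooth.mdifferentiableAt (by simp))
      ((hF x hx).mdifferentiableAt (by simp)) ξ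
    exact (congrArg (fun A : E₀ →L[ℝ] E ↦ A ξ) mfderiv_eq_fderiv.symm).trans h1
  have hDκ (x : E₀) (hx : x ∈ W) (ξ : E₀) : fderiv ℝ κ x ξ = inner ℝ c (fderiv ℝ G x ξ) := by
    have := ((hasFDerivAt_const c x).inner ℝ ((hG x hx).differentiableAt
      (by simp)).hasFDerivAt).add_const d
    rw [this.fderiv]
    simp
  let b : E₀ → ℝ := fun x ↦ (κ x)⁻¹ * (a x + inner ℝ c (w x))
  have hDw (x : E₀) (hx : x ∈ W) (ξ : E₀) : fderiv ℝ w x ξ = b x • fderiv ℝ G x ξ := by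
    have h1 := h.mvfderiv_covDerivAlong ((hY x hx).mdifferentiableAt (by simp)) ξ
    have h2 := ((hκ x hx).differentiableAt (by simp)).hasFDerivAt.fun_smul
      ((hw x hx).differentiableAt (by simp)).hasFDerivAt
    have hκw : (fun y ↦ κ y • w y) = fun y ↦ mvfderiv 𝓘(ℝ, E) Φ (F y) (Y y) := by
      ext1 y
      exact smul_inv_smul₀ (hκ0 y) _
    have h3 : inner ℝ (fderiv ℝ G x ξ) (mvfderiv 𝓘(ℝ, E) Φ (F x) (Y x)) = 0 := by
      have h4 := h.inner_eq (F x) (mfderiv 𝓘(ℝ, E₀) 𝓘(ℝ, E) F x ξ) (Y x)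
      rw [hperp x hx, ← hDG x hx, eq_comm, div_eq_zero_iff] at h4
      exact h4.resolve_right (pow_ne_zero 2 (hκ0 x))
    have h5 := h1.2
    rw [ha x hx, map_smul, ← hDG x hx, h3] at h5
    rw [← congrFun hκw x, ← hκw, h2.fderiv] at h5
    simp only [add_apply, smul_apply, ContinuousLinearMap.smulRight_apply, hDκ x hx,
      real_inner_smul_right] at h5
    apply smul_right_injective E (hκ0 x)
    simp only [b]
    have h6 : (inner ℝ c (Φ (F x)) + d) = κ x := rfl
    rw [smul_smul, mul_inv_cancel_left₀ (hκ0 x)]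
    rw [h6] at h5
    have h7 (k r t : ℝ) (y g : E) (hk : k ≠ 0) :
        k⁻¹ • (r • k • y + (k * t) • g - (0 : ℝ) • c) = r • y + t • g := by
      match_scalars <;> field_simp
      simp
    rw [h7 _ _ _ _ _ (hκ0 x), add_left_comm, add_comm] at h5
    exact (add_left_cancel h5).trans (add_smul _ _ _).symm
  have hb := hasFDerivAt_zero_of_fderiv_eq_smul hn hW
    (fun x hx ↦ (hw x hx).contDiffWithinAt) (fun x hx ↦ (hG x hx).contDiffWithinAt) hDw
    (fun x hx ξ η hξη ↦ hinj x hx (h.injective (F x) (by rw [← hDG x hx, ← hDG x hx, hξη]))) hq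
  have hab : a = fun x ↦ κ x * b x - inner ℝ c (w x) := by
    ext x
    simp only [b]
    field_simp [hκ0 x]
    ring
  have hd := (((hκ q hq).differentiableAt (by simp)).hasFDerivAt.fun_mul hb).fun_sub
    ((hasFDerivAt_const c q).inner ℝ ((hw q hq).differentiableAt (by simp)).hasFDerivAt)
  rw [← hab] at hd
  refine hd.congr_fderiv ?_
  ext ξ
  simp [hDκ q hq, hDw q hq, real_inner_smul_right]

end Constancy

section ConstantAngleGeometry

open Set Filter Topology

set_option linter.unusedSectionVars false

variable {n : ℕ}
  {M : Type*} [TopologicalSpace M] [ChartedSpace (EuclideanSpace ℝ (Fin (n + 2))) M]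
  [IsManifold (𝓡 (n + 2)) ∞ M]
  [RiemannianBundle (fun x : M ↦ TangentSpace (𝓡 (n + 2)) x)]
  [IsContMDiffRiemannianBundle (𝓡 (n + 2)) ∞ (EuclideanSpace ℝ (Fin (n + 2)))
    (fun x : M ↦ TangentSpace (𝓡 (n + 2)) x)]
  {N : Type*} [TopologicalSpace N] [ChartedSpace (EuclideanSpace ℝ (Fin (n + 1))) N]
  [IsManifold (𝓡 (n + 1)) ∞ N]
  {V : ∀ p : M, TangentSpace (𝓡 (n + 2)) p} {f : M → ℝ}
  {φ : N → M} {U : ∀ x : N, TangentSpace (𝓡 (n + 2)) (φ x)} {θ : ℝ} {δ : N → ℝ}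
  {E' : Type*} [NormedAddCommGroup E'] [NormedSpace ℝ E']

theorem IsConstantAngleHypersurface.norm_tangentialPart
    (hN : IsConstantAngleHypersurface V φ U θ) (hV : IsUnitAntiTorqued (𝓡 (n + 2)) V f) (x : N) :
    ‖tangentialPart V φ U x‖ = Real.sin θ := by
  have h1 : ‖tangentialPart V φ U x‖ ^ 2 = Real.sin θ ^ 2 := by
    have hVV : inner ℝ (V (φ x)) (V (φ x)) = 1 := by rw [real_inner_self_eq_norm_sq, hV.unit]; simp
    have hUU : inner ℝ (U x) (U x) = 1 := by rw [real_inner_self_eq_norm_sq, hN.unit_normal]; simp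
    have hUV := hN.angle x
    have hVU : inner ℝ (V (φ x)) (U x) = Real.cos θ := by rw [real_inner_comm, hUV]
    rw [← real_inner_self_eq_norm_sq, tangentialPart]
    simp only [inner_sub_left, inner_sub_right, real_inner_smul_left, real_inner_smul_right,
      hVV, hUU, hUV, hVU]
    nlinarith [Real.sin_sq_add_cos_sq θ]
  exact (pow_left_inj₀ (norm_nonneg _) (Real.sin_nonneg_of_mem_Icc hN.mem_angle)
    two_ne_zero).1 h1

theorem IsConstantAngleHypersurface.sin_pos
    (hN : IsConstantAngleHypersurface V φ U θ) (hV : IsUnitAntiTorqued (𝓡 (n + 2)) V f) (x : N) :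
    0 < Real.sin θ := by
  rw [← hN.norm_tangentialPart hV x]
  exact norm_pos_iff.2 (hN.tangential_ne_zero x)

theorem IsConstantAngleHypersurface.unitTangentialPart_eq
    (hN : IsConstantAngleHypersurface V φ U θ) (hV : IsUnitAntiTorqued (𝓡 (n + 2)) V f) (x : N) :
    unitTangentialPart V φ U x = (Real.sin θ)⁻¹ • V (φ x) + (-Real.cot θ) • U x := by
  have hVU : inner ℝ (V (φ x)) (U x) = Real.cos θ := by rw [real_inner_comm, hN.angle]
  rw [unitTangentialPart, hN.norm_tangentialPart hV, tangentialPart, hVU, smul_sub, smul_smul,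
    Real.cot_eq_cos_div_sin, sub_eq_add_neg, ← neg_smul]
  congr 3
  ring

theorem IsConstantAngleHypersurface.inner_unitTangentialPart_normal
    (hN : IsConstantAngleHypersurface V φ U θ) (x : N) :
    inner ℝ (unitTangentialPart V φ U x) (U x) = 0 := by
  have hUU : inner ℝ (U x) (U x) = 1 := by rw [real_inner_self_eq_norm_sq, hN.unit_normal]; simp
  rw [unitTangentialPart, tangentialPart, real_inner_smul_left, inner_sub_left,
    real_inner_smul_left, hUU, mul_one, sub_self, mul_zero]

theorem IsConstantAngleHypersurface.inner_unitTangentialPart_self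
    (hN : IsConstantAngleHypersurface V φ U θ) (x : N) :
    inner ℝ (unitTangentialPart V φ U x) (unitTangentialPart V φ U x) = 1 := by
  rw [real_inner_self_eq_norm_sq, unitTangentialPart, norm_smul, norm_inv, norm_norm,
    inv_mul_cancel₀ (norm_ne_zero_iff.2 (hN.tangential_ne_zero x)), one_pow]

theorem IsConstantAngleHypersurface.inner_unitTangentialPart
    (hN : IsConstantAngleHypersurface V φ U θ) (hV : IsUnitAntiTorqued (𝓡 (n + 2)) V f) (x : N)
    (v : TangentSpace (𝓡 (n + 1)) x) :
    inner ℝ (mfderiv (𝓡 (n + 1)) (𝓡 (n + 2)) φ x v) (unitTangentialPart V φ U x) =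
      (Real.sin θ)⁻¹ * inner ℝ (mfderiv (𝓡 (n + 1)) (𝓡 (n + 2)) φ x v) (V (φ x)) := by
  rw [hN.unitTangentialPart_eq hV, inner_add_right, real_inner_smul_right, real_inner_smul_right,
    hN.normal, mul_zero, add_zero]

/-- The tangent space of the hypersurface is the orthogonal complement of the normal. -/
theorem IsConstantAngleHypersurface.exists_mfderiv_eq
    (hN : IsConstantAngleHypersurface V φ U θ) (x : N) {w : TangentSpace (𝓡 (n + 2)) (φ x)}
    (hw : inner ℝ w (U x) = 0) :
    ∃ v, mfderiv (𝓡 (n + 1)) (𝓡 (n + 2)) φ x v = w := by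
  let D : TangentSpace (𝓡 (n + 1)) x →ₗ[ℝ] TangentSpace (𝓡 (n + 2)) (φ x) :=
    (mfderiv (𝓡 (n + 1)) (𝓡 (n + 2)) φ x).toLinearMap
  have hU0 : U x ≠ 0 := by
    intro h
    have := hN.unit_normal x
    rw [h, norm_zero] at this
    exact zero_ne_one this
  have h1 : Module.finrank ℝ (LinearMap.range D) = n + 1 := by
    rw [LinearMap.finrank_range_of_inj (hN.immersion x)]
    exact finrank_euclideanSpace_fin (𝕜 := ℝ) (n := n + 1)
  have h2 : Module.finrank ℝ (Submodule.span ℝ {U x})ᗮ = n + 1 := by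
    have h3 : Module.finrank ℝ (TangentSpace (𝓡 (n + 2)) (φ x)) = n + 1 + 1 :=
      finrank_euclideanSpace_fin (𝕜 := ℝ) (n := n + 2)
    exact Submodule.finrank_add_finrank_orthogonal' (by
      rw [finrank_span_singleton hU0, h3, add_comm])
  have h4 : LinearMap.range D ≤ (Submodule.span ℝ {U x})ᗮ := by
    rintro _ ⟨v, rfl⟩
    rw [Submodule.mem_orthogonal_singleton_iff_inner_left]
    exact hN.normal x v
  have h5 := Submodule.eq_of_le_of_finrank_eq h4 (h1.trans h2.symm)
  have h6 : w ∈ LinearMap.range D := by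
    rw [h5, Submodule.mem_orthogonal_singleton_iff_inner_left]
    exact hw
  exact h6

theorem IsUnitAntiTorqued.diffAlong (hV : IsUnitAntiTorqued (𝓡 (n + 2)) V f) {F : E' → M} {z : E'}
    (hF : MDifferentiableAt 𝓘(ℝ, E') (𝓡 (n + 2)) F z) : DiffAlong F (fun y ↦ V (F y)) z :=
  MDifferentiableAt.comp z (hV.smooth.mdifferentiableAt (by simp)) hF

theorem IsUnitAntiTorqued.covDerivAlong_eq (hV : IsUnitAntiTorqued (𝓡 (n + 2)) V f) {F : E' → M}
    {z : E'} (hF : MDifferentiableAt 𝓘(ℝ, E') (𝓡 (n + 2)) F z) (ξ : E') :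
    covDerivAlong (𝓡 (n + 2)) 𝓘(ℝ, E') F (fun y ↦ V (F y)) z ξ =
      f (F z) • (mfderiv 𝓘(ℝ, E') (𝓡 (n + 2)) F z ξ -
        inner ℝ (mfderiv 𝓘(ℝ, E') (𝓡 (n + 2)) F z ξ) (V (F z)) • V (F z)) := by
  rw [← hV.cov]
  exact covDerivAlong_comp (φ := fun q : M ↦ q) (hV.smooth.mdifferentiableAt (by simp)) hF ξ

theorem IsConstantAngleHypersurface.mfderiv_comp (hN : IsConstantAngleHypersurface V φ U θ)
    {g : E' → N} {z : E'} (hg : MDifferentiableAt 𝓘(ℝ, E') (𝓡 (n + 1)) g z) (ξ : E') :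
    mfderiv 𝓘(ℝ, E') (𝓡 (n + 2)) (fun y ↦ φ (g y)) z ξ =
      mfderiv (𝓡 (n + 1)) (𝓡 (n + 2)) φ (g z) (mfderiv 𝓘(ℝ, E') (𝓡 (n + 1)) g z ξ) :=
  mfderiv_comp_apply z (hN.smooth.mdifferentiableAt (by simp)) hg ξ

theorem IsConstantAngleHypersurface.covDerivAlong_normal
    (hN : IsConstantAngleHypersurface V φ U θ) (hδ : ShapeOperatorIsScalarOnPerp V φ U δ)
    {g : E' → N} {z : E'} (hg : MDifferentiableAt 𝓘(ℝ, E') (𝓡 (n + 1)) g z) {ξ : E'}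
    (hξ : inner ℝ (mfderiv 𝓘(ℝ, E') (𝓡 (n + 2)) (fun y ↦ φ (g y)) z ξ)
      (unitTangentialPart V φ U (g z)) = 0) :
    covDerivAlong (𝓡 (n + 2)) 𝓘(ℝ, E') (fun y ↦ φ (g y)) (fun y ↦ U (g y)) z ξ =
      (-δ (g z)) • mfderiv 𝓘(ℝ, E') (𝓡 (n + 2)) (fun y ↦ φ (g y)) z ξ := by
  have h1 := covDerivAlong_comp (hN.smooth_normal.mdifferentiableAt (x := g z) (by simp)) hg ξ
  rw [hN.mfderiv_comp hg] at hξ ⊢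
  have h2 := hδ (g z) _ hξ
  rw [shapeOperator, neg_eq_iff_eq_neg] at h2
  rw [neg_smul, ← h2]
  exact h1

theorem IsConstantAngleHypersurface.covDerivAlong_axis
    (hN : IsConstantAngleHypersurface V φ U θ) (hV : IsUnitAntiTorqued (𝓡 (n + 2)) V f)
    {g : E' → N} {z : E'} (hg : MDifferentiableAt 𝓘(ℝ, E') (𝓡 (n + 1)) g z) {ξ : E'}
    (hξ : inner ℝ (mfderiv 𝓘(ℝ, E') (𝓡 (n + 2)) (fun y ↦ φ (g y)) z ξ)
      (unitTangentialPart V φ U (g z)) = 0) :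
    inner ℝ (mfderiv 𝓘(ℝ, E') (𝓡 (n + 2)) (fun y ↦ φ (g y)) z ξ) (V (φ (g z))) = 0 ∧
    covDerivAlong (𝓡 (n + 2)) 𝓘(ℝ, E') (fun y ↦ φ (g y)) (fun y ↦ V (φ (g y))) z ξ =
      f (φ (g z)) • mfderiv 𝓘(ℝ, E') (𝓡 (n + 2)) (fun y ↦ φ (g y)) z ξ := by
  have h1 : inner ℝ (mfderiv 𝓘(ℝ, E') (𝓡 (n + 2)) (fun y ↦ φ (g y)) z ξ) (V (φ (g z))) = 0 := by
    rw [hN.mfderiv_comp hg] at hξ ⊢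
    rw [hN.inner_unitTangentialPart hV] at hξ
    exact (mul_eq_zero.1 hξ).resolve_left (inv_ne_zero (hN.sin_pos hV (g z)).ne')
  refine ⟨h1, ?_⟩
  have h2 := hV.covDerivAlong_eq (F := fun y ↦ φ (g y))
    (MDifferentiableAt.comp z (hN.smooth.mdifferentiableAt (by simp)) hg) ξ
  rw [h1, zero_smul, sub_zero] at h2
  exact h2

theorem IsConstantAngleHypersurface.covDerivAlong_unitTangentialPart
    (hN : IsConstantAngleHypersurface V φ U θ) (hV : IsUnitAntiTorqued (𝓡 (n + 2)) V f)
    (hδ : ShapeOperatorIsScalarOnPerp V φ U δ)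
    {g : E' → N} {z : E'} (hg : MDifferentiableAt 𝓘(ℝ, E') (𝓡 (n + 1)) g z) {ξ : E'}
    (hξ : inner ℝ (mfderiv 𝓘(ℝ, E') (𝓡 (n + 2)) (fun y ↦ φ (g y)) z ξ)
      (unitTangentialPart V φ U (g z)) = 0) :
    covDerivAlong (𝓡 (n + 2)) 𝓘(ℝ, E') (fun y ↦ φ (g y))
        (fun y ↦ unitTangentialPart V φ U (g y)) z ξ =
      (Real.cot θ * δ (g z) + f (φ (g z)) / Real.sin θ) •
        mfderiv 𝓘(ℝ, E') (𝓡 (n + 2)) (fun y ↦ φ (g y)) z ξ := by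
  have hVd : DiffAlong (fun y ↦ φ (g y)) (fun y ↦ V (φ (g y))) z :=
    hV.diffAlong (MDifferentiableAt.comp z (hN.smooth.mdifferentiableAt (by simp)) hg)
  have hUd : DiffAlong (fun y ↦ φ (g y)) (fun y ↦ U (g y)) z :=
    MDifferentiableAt.comp z (hN.smooth_normal.mdifferentiableAt (by simp)) hg
  rw [covDerivAlong_congr (Eventually.of_forall fun y ↦ hN.unitTangentialPart_eq hV (g y)),
    covDerivAlong_add hVd hUd, hN.covDerivAlong_normal hδ hg hξ,
    (hN.covDerivAlong_axis hV hg hξ).2, smul_smul, smul_smul, ← add_smul]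
  congr 1
  ring

/-- The one-form `⟨V, dF⟩` is closed. -/
theorem IsUnitAntiTorqued.fderiv_inner_comm (hV : IsUnitAntiTorqued (𝓡 (n + 2)) V f) {F : E' → M}
    {z : E'} (hF : ContMDiffAt 𝓘(ℝ, E') (𝓡 (n + 2)) ∞ F z) (ξ η : E') :
    fderiv ℝ (fun y ↦ inner ℝ (V (F y)) (mfderiv 𝓘(ℝ, E') (𝓡 (n + 2)) F y η)) z ξ =
      fderiv ℝ (fun y ↦ inner ℝ (V (F y)) (mfderiv 𝓘(ℝ, E') (𝓡 (n + 2)) F y ξ)) z η := by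
  have hFd := hF.mdifferentiableAt (by simp)
  rw [fderiv_inner_along (hV.diffAlong hFd) (diffAlong_mfderiv_apply hF η),
    fderiv_inner_along (hV.diffAlong hFd) (diffAlong_mfderiv_apply hF ξ),
    covDerivAlong_mfderiv_comm hF, hV.covDerivAlong_eq hFd, hV.covDerivAlong_eq hFd]
  simp only [real_inner_smul_left, inner_sub_left]
  rw [real_inner_comm (mfderiv 𝓘(ℝ, E') (𝓡 (n + 2)) F z ξ) (mfderiv 𝓘(ℝ, E') (𝓡 (n + 2)) F z η),
    real_inner_comm (mfderiv 𝓘(ℝ, E') (𝓡 (n + 2)) F z ξ) (V (F z)),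
    real_inner_comm (mfderiv 𝓘(ℝ, E') (𝓡 (n + 2)) F z η) (V (F z))]
  ring

end ConstantAngleGeometry

section AdaptedChart

open Set Filter Topology

set_option linter.unusedSectionVars false

variable {E : Type*} [NormedAddCommGroup E] [NormedSpace ℝ E] [FiniteDimensional ℝ E]
  {M : Type*} [TopologicalSpace M] [ChartedSpace E M] [IsManifold 𝓘(ℝ, E) ∞ M]
  [RiemannianBundle (fun x : M ↦ TangentSpace 𝓘(ℝ, E) x)]
  [IsContMDiffRiemannianBundle 𝓘(ℝ, E) ∞ E (fun x : M ↦ TangentSpace 𝓘(ℝ, E) x)]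
  {E' : Type*} [NormedAddCommGroup E'] [NormedSpace ℝ E'] [FiniteDimensional ℝ E']

/-- The pull-back of the metric by `F`. -/
def pullbackMetric (F : E' → M) (z : E') : E' →L[ℝ] E' →L[ℝ] ℝ :=
  (innerSL ℝ (E := TangentSpace 𝓘(ℝ, E) (F z))).bilinearComp
    (mfderiv 𝓘(ℝ, E') 𝓘(ℝ, E) F z : E' →L[ℝ] TangentSpace 𝓘(ℝ, E) (F z))
    (mfderiv 𝓘(ℝ, E') 𝓘(ℝ, E) F z : E' →L[ℝ] TangentSpace 𝓘(ℝ, E) (F z))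

theorem pullbackMetric_apply (F : E' → M) (z ξ η : E') :
    pullbackMetric (E := E) F z ξ η = inner ℝ (mfderiv 𝓘(ℝ, E') 𝓘(ℝ, E) F z ξ)
      (mfderiv 𝓘(ℝ, E') 𝓘(ℝ, E) F z η) := rfl

theorem contDiffAt_inner_along {F : E' → M} {Y Z : ∀ y, TangentSpace 𝓘(ℝ, E) (F y)} {z : E'}
    (hY : ContMDiffAt 𝓘(ℝ, E') 𝓘(ℝ, E).tangent ∞
      (fun y ↦ (⟨F y, Y y⟩ : TangentBundle 𝓘(ℝ, E) M)) z)
    (hZ : ContMDiffAt 𝓘(ℝ, E') 𝓘(ℝ, E).tangent ∞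
      (fun y ↦ (⟨F y, Z y⟩ : TangentBundle 𝓘(ℝ, E) M)) z) :
    ContDiffAt ℝ ∞ (fun y ↦ inner ℝ (Y y) (Z y)) z :=
  contMDiffAt_iff_contDiffAt.1 (ContMDiffAt.inner_bundle hY hZ)

theorem contDiffOn_pullbackMetric {F : E' → M} {s : Set E'}
    (hF : ∀ z ∈ s, ContMDiffAt 𝓘(ℝ, E') 𝓘(ℝ, E) ∞ F z) :
    ContDiffOn ℝ ∞ (pullbackMetric (E := E) F) s := by
  refine contDiffOn_clm_apply.2 fun ξ ↦ contDiffOn_clm_apply.2 fun η z hz ↦ ?_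
  exact (contDiffAt_inner_along (contMDiffAt_mfderiv_apply (hF z hz) ξ)
    (contMDiffAt_mfderiv_apply (hF z hz) η)).contDiffWithinAt

theorem exists_pullbackMetric_eq {F : E' → M} {z : E'}
    (hinj : Function.Injective (mfderiv 𝓘(ℝ, E') 𝓘(ℝ, E) F z)) :
    ∃ e : E' ≃L[ℝ] (E' →L[ℝ] ℝ), (e : E' →L[ℝ] (E' →L[ℝ] ℝ)) = pullbackMetric (E := E) F z := by
  have h1 : Function.Injective (pullbackMetric (E := E) F z).toLinearMap := by
    rw [injective_iff_map_eq_zero]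
    intro ξ hξ
    have h2 : pullbackMetric (E := E) F z ξ ξ = 0 := congrArg (fun A : E' →L[ℝ] ℝ ↦ A ξ) hξ
    rw [pullbackMetric_apply, inner_self_eq_zero] at h2
    exact hinj (h2.trans (map_zero _).symm)
  have h3 : Module.finrank ℝ E' = Module.finrank ℝ (E' →L[ℝ] ℝ) := by
    rw [← (LinearMap.toContinuousLinearMap (𝕜 := ℝ) (E := E') (F' := ℝ)).finrank_eq]
    exact Subspace.dual_finrank_eq.symm
  refine ⟨(LinearEquiv.ofInjectiveOfFinrankEq _ h1 h3).toContinuousLinearEquiv, ?_⟩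
  ext
  rfl

/-- The vector field that represents a smooth one-form with respect to the pull-back metric. -/
theorem exists_pullbackMetric_repr {F : E' → M} {s : Set E'} (hs : IsOpen s)
    (hF : ∀ z ∈ s, ContMDiffAt 𝓘(ℝ, E') 𝓘(ℝ, E) ∞ F z)
    (hinj : ∀ z ∈ s, Function.Injective (mfderiv 𝓘(ℝ, E') 𝓘(ℝ, E) F z))
    {α : E' → E' →L[ℝ] ℝ} (hα : ContDiffOn ℝ ∞ α s) :
    ∃ τ : E' → E', ContDiffOn ℝ ∞ τ s ∧
      ∀ z ∈ s, ∀ ξ, pullbackMetric (E := E) F z (τ z) ξ = α z ξ := by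
  refine ⟨fun z ↦ (pullbackMetric (E := E) F z).inverse (α z), fun z hz ↦ ?_, fun z hz ξ ↦ ?_⟩
  · obtain ⟨e, he⟩ := exists_pullbackMetric_eq (hinj z hz)
    have h1 : ContDiffAt ℝ ∞ ContinuousLinearMap.inverse (pullbackMetric (E := E) F z) := by
      rw [← he]
      exact contDiffAt_map_inverse e
    have h2 := (contDiffOn_pullbackMetric hF).contDiffAt (hs.mem_nhds hz)
    exact ((ContDiffAt.comp z h1 h2).clm_apply
      (hα.contDiffAt (hs.mem_nhds hz))).contDiffWithinAt
  · obtain ⟨e, he⟩ := exists_pullbackMetric_eq (hinj z hz)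
    simp only [← he, ContinuousLinearMap.inverse_equiv]
    simp

theorem exists_continuousLinearEquiv_prod {n : ℕ} {v : EuclideanSpace ℝ (Fin (n + 1))}
    (hv : v ≠ 0) :
    ∃ L : (ℝ × EuclideanSpace ℝ (Fin n)) ≃L[ℝ] EuclideanSpace ℝ (Fin (n + 1)), L (1, 0) = v := by
  have h1 : Module.finrank ℝ (ℝ × EuclideanSpace ℝ (Fin n)) =
      Module.finrank ℝ (EuclideanSpace ℝ (Fin (n + 1))) := by
    simp [add_comm]
  let L₀ := ContinuousLinearEquiv.ofFinrankEq h1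
  have h2 : L₀ (1, 0) ≠ 0 := by
    simp
  obtain ⟨A, hA⟩ := SeparatingDual.exists_continuousLinearEquiv_apply_eq (R := ℝ) h2 hv
  exact ⟨L₀.trans A, by simpa using hA⟩

end AdaptedChart

section AdaptedChartHypersurface

open Set Filter Topology

set_option linter.unusedSectionVars false

variable {n : ℕ}
  {M : Type*} [TopologicalSpace M] [ChartedSpace (EuclideanSpace ℝ (Fin (n + 2))) M]
  [IsManifold (𝓡 (n + 2)) ∞ M]
  [RiemannianBundle (fun x : M ↦ TangentSpace (𝓡 (n + 2)) x)]
  [IsContMDiffRiemannianBundle (𝓡 (n + 2)) ∞ (EuclideanSpace ℝ (Fin (n + 2)))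
    (fun x : M ↦ TangentSpace (𝓡 (n + 2)) x)]
  {N : Type*} [TopologicalSpace N] [ChartedSpace (EuclideanSpace ℝ (Fin (n + 1))) N]
  [IsManifold (𝓡 (n + 1)) ∞ N]
  {V : ∀ p : M, TangentSpace (𝓡 (n + 2)) p} {f : M → ℝ}
  {φ : N → M} {U : ∀ x : N, TangentSpace (𝓡 (n + 2)) (φ x)} {θ : ℝ} {δ : N → ℝ}

theorem IsProductChart.injective_mfderiv
    {ψ : OpenPartialHomeomorph (ℝ × EuclideanSpace ℝ (Fin n)) N} {a b : ℝ}
    {W : Set (EuclideanSpace ℝ (Fin n))} (hψ : IsProductChart ψ a b W)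
    {z : ℝ × EuclideanSpace ℝ (Fin n)} (hz : z ∈ ψ.source) :
    Function.Injective (mfderiv 𝓘(ℝ, ℝ × EuclideanSpace ℝ (Fin n)) (𝓡 (n + 1)) ψ z) :=
  OpenPartialHomeomorph.MDifferentiable.mfderiv_injective
    ⟨hψ.smooth.mdifferentiableOn (by simp), hψ.smooth_symm.mdifferentiableOn (by simp)⟩ hz

/-- `ψ` is a product chart on a cube, with `∂/∂s = T` and with slices orthogonal to `T`. -/
structure IsAdaptedChart (V : ∀ p : M, TangentSpace (𝓡 (n + 2)) p) (φ : N → M)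
    (U : ∀ x : N, TangentSpace (𝓡 (n + 2)) (φ x))
    (ψ : OpenPartialHomeomorph (ℝ × EuclideanSpace ℝ (Fin n)) N) (ε : ℝ) : Prop extends
    IsProductChart ψ (-ε) ε (Metric.ball 0 ε) where
  pos : 0 < ε
  mfderiv_fst : ∀ z ∈ ψ.source, mfderiv (𝓡 (n + 1)) (𝓡 (n + 2)) φ (ψ z)
    (mfderiv 𝓘(ℝ, ℝ × EuclideanSpace ℝ (Fin n)) (𝓡 (n + 1)) ψ z
      ((1, 0) : ℝ × EuclideanSpace ℝ (Fin n))) = unitTangentialPart V φ U (ψ z)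
  inner_mfderiv_snd : ∀ z ∈ ψ.source, ∀ ξ : EuclideanSpace ℝ (Fin n),
    inner ℝ (mfderiv (𝓡 (n + 1)) (𝓡 (n + 2)) φ (ψ z)
      (mfderiv 𝓘(ℝ, ℝ × EuclideanSpace ℝ (Fin n)) (𝓡 (n + 1)) ψ z
        ((0, ξ) : ℝ × EuclideanSpace ℝ (Fin n)))) (unitTangentialPart V φ U (ψ z)) = 0

theorem IsConstantAngleHypersurface.exists_isAdaptedChart
    (hN : IsConstantAngleHypersurface V φ U θ) (hV : IsUnitAntiTorqued (𝓡 (n + 2)) V f) (p : N) :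
    ∃ (ψ : OpenPartialHomeomorph (ℝ × EuclideanSpace ℝ (Fin n)) N) (ε : ℝ),
      IsAdaptedChart V φ U ψ ε ∧ p ∈ ψ.target := by
  let e := chartAt (EuclideanSpace ℝ (Fin (n + 1))) p
  let F : EuclideanSpace ℝ (Fin (n + 1)) → M := fun x ↦ φ (e.symm x)
  have he (x) (hx : x ∈ e.target) : ContMDiffAt (𝓡 (n + 1)) (𝓡 (n + 1)) ∞ e.symm x :=
    contMDiffAt_symm_of_mem_maximalAtlas (IsManifold.chart_mem_maximalAtlas p) hx
  have hed (x) (hx : x ∈ e.target) : MDifferentiableAt (𝓡 (n + 1)) (𝓡 (n + 1)) e.symm x :=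
    (he x hx).mdifferentiableAt (by simp)
  have hF (x) (hx : x ∈ e.target) : ContMDiffAt (𝓡 (n + 1)) (𝓡 (n + 2)) ∞ F x :=
    hN.smooth.contMDiffAt.comp x (he x hx)
  have hFi (x) (hx : x ∈ e.target) :
      Function.Injective (mfderiv (𝓡 (n + 1)) (𝓡 (n + 2)) F x) := fun ξ η h ↦ by
    have h1 := hN.mfderiv_comp (hed x hx) ξ
    have h2 := hN.mfderiv_comp (hed x hx) η
    exact (mdifferentiable_chart p).symm.mfderiv_injective hx
      (hN.immersion (e.symm x) (h1.symm.trans (h.trans h2)))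
  have hFV (x) (hx : x ∈ e.target) (ξ : EuclideanSpace ℝ (Fin (n + 1))) :
      inner ℝ (mfderiv (𝓡 (n + 1)) (𝓡 (n + 2)) F x ξ) (unitTangentialPart V φ U (e.symm x)) =
        (Real.sin θ)⁻¹ * inner ℝ (V (F x)) (mfderiv (𝓡 (n + 1)) (𝓡 (n + 2)) F x ξ) := by
    have h1 := hN.mfderiv_comp (hed x hx) ξ
    have h2 := hN.inner_unitTangentialPart hV (e.symm x) (mfderiv (𝓡 (n + 1)) (𝓡 (n + 1)) e.symm x ξ)
    rw [← h1] at h2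
    rw [real_inner_comm _ (V (F x))]
    exact h2
  let α : EuclideanSpace ℝ (Fin (n + 1)) → EuclideanSpace ℝ (Fin (n + 1)) →L[ℝ] ℝ := fun x ↦
    (Real.sin θ)⁻¹ • (innerSL ℝ (V (F x))).comp
      (mfderiv (𝓡 (n + 1)) (𝓡 (n + 2)) F x : EuclideanSpace ℝ (Fin (n + 1)) →L[ℝ] _)
  have hαa (x ξ) : α x ξ = (Real.sin θ)⁻¹ * inner ℝ (V (F x))
      (mfderiv (𝓡 (n + 1)) (𝓡 (n + 2)) F x ξ) := rfl
  have hVF (x) (hx : x ∈ e.target) (ξ) : ContDiffAt ℝ ∞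
      (fun y ↦ inner ℝ (V (F y)) (mfderiv (𝓡 (n + 1)) (𝓡 (n + 2)) F y ξ)) x :=
    contDiffAt_inner_along (hV.smooth.contMDiffAt.comp x (hF x hx))
      (contMDiffAt_mfderiv_apply (hF x hx) ξ)
  have hα : ContDiffOn ℝ ∞ α e.target :=
    contDiffOn_clm_apply.2 fun ξ x hx ↦
      (contDiffAt_const.mul (hVF x hx ξ)).contDiffWithinAt
  obtain ⟨τ, hτ, hτα⟩ := exists_pullbackMetric_repr e.open_target hF hFi hα
  have hτT (x) (hx : x ∈ e.target) :
      mfderiv (𝓡 (n + 1)) (𝓡 (n + 2)) F x (τ x) = unitTangentialPart V φ U (e.symm x) := by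
    obtain ⟨v, hv⟩ := hN.exists_mfderiv_eq (e.symm x)
      (hN.inner_unitTangentialPart_normal (e.symm x))
    obtain ⟨t, rfl⟩ := (mdifferentiable_chart p).symm.mfderiv_surjective hx v
    have h1 : mfderiv (𝓡 (n + 1)) (𝓡 (n + 2)) F x t = unitTangentialPart V φ U (e.symm x) :=
      (hN.mfderiv_comp (hed x hx) t).trans hv
    have h2 (ξ) : inner ℝ (mfderiv (𝓡 (n + 1)) (𝓡 (n + 2)) F x (τ x))
        (mfderiv (𝓡 (n + 1)) (𝓡 (n + 2)) F x ξ) = inner ℝ (mfderiv (𝓡 (n + 1)) (𝓡 (n + 2)) F x t)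
        (mfderiv (𝓡 (n + 1)) (𝓡 (n + 2)) F x ξ) := by
      refine (hτα x hx ξ).trans ((hFV x hx ξ).symm.trans ?_)
      rw [← h1]
      exact real_inner_comm _ _
    rw [← h1, ← sub_eq_zero, ← inner_self_eq_zero (𝕜 := ℝ), inner_sub_left,
      inner_sub_right, inner_sub_right, h2 (τ x), h2 t, sub_self]
  have hατ (x) (hx : x ∈ e.target) : α x (τ x) = 1 := by
    rw [hαa, ← hFV x hx, hτT x hx]
    exact hN.inner_unitTangentialPart_self _
  have hclosed (x) (hx : x ∈ e.target) (a b) : fderiv ℝ α x a b = fderiv ℝ α x b a := by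
    have h1 (a b) : fderiv ℝ α x a b = (Real.sin θ)⁻¹ * fderiv ℝ (fun y ↦ inner ℝ (V (F y))
        (mfderiv (𝓡 (n + 1)) (𝓡 (n + 2)) F y b)) x a := by
      have h2 := (((hα.contDiffAt (e.open_target.mem_nhds hx)).differentiableAt
        (by simp)).hasFDerivAt.clm_apply (hasFDerivAt_const b x)).unique
          ((((hVF x hx b).differentiableAt (by simp)).hasFDerivAt).const_mul (Real.sin θ)⁻¹)
      simpa using congrArg (fun A : EuclideanSpace ℝ (Fin (n + 1)) →L[ℝ] ℝ ↦ A a) h2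
    rw [h1, h1, hV.fderiv_inner_comm (hF x hx)]
  have hp : e p ∈ e.target := e.map_source (mem_chart_source _ p)
  obtain ⟨L, hL⟩ := exists_continuousLinearEquiv_prod (v := τ (e p)) (fun h0 ↦ by
    have := hατ (e p) hp
    rw [h0, map_zero] at this
    exact zero_ne_one this)
  obtain ⟨ε, hε, ψ, hsrc, htgt, hψ0, hψ, hψs, hψd⟩ :=
    exists_flowBox e.open_target hp hτ hα hclosed hατ L hL
  have hsrc' : (ψ.trans e.symm).source = ψ.source := by
    rw [OpenPartialHomeomorph.trans_source]
    exact inter_eq_left.2 fun z hz ↦ htgt (ψ.map_source hz)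
  have hd (z) (hz : z ∈ ψ.source) (X : ℝ × EuclideanSpace ℝ (Fin n)) :
      mfderiv (𝓡 (n + 1)) (𝓡 (n + 2)) φ ((ψ.trans e.symm) z)
        (mfderiv 𝓘(ℝ, ℝ × EuclideanSpace ℝ (Fin n)) (𝓡 (n + 1)) (ψ.trans e.symm) z X) =
      mfderiv (𝓡 (n + 1)) (𝓡 (n + 2)) F (ψ z) (fderiv ℝ ψ z X) := by
    have hz' := htgt (ψ.map_source hz)
    have h1 : MDifferentiableAt 𝓘(ℝ, ℝ × EuclideanSpace ℝ (Fin n)) (𝓡 (n + 1)) ψ z :=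
      ((hψ.contDiffAt (ψ.open_source.mem_nhds hz)).differentiableAt (by simp)).mdifferentiableAt
    have h2 := mfderiv_comp_apply z (hed (ψ z) hz') h1 X
    have h3 : mfderiv 𝓘(ℝ, ℝ × EuclideanSpace ℝ (Fin n)) (𝓡 (n + 1)) ψ z X = fderiv ℝ ψ z X :=
      congrArg (fun A : (ℝ × EuclideanSpace ℝ (Fin n)) →L[ℝ] EuclideanSpace ℝ (Fin (n + 1)) ↦ A X)
        mfderiv_eq_fderiv
    rw [h3] at h2
    refine Eq.trans ?_ (hN.mfderiv_comp (hed (ψ z) hz') (fderiv ℝ ψ z X)).symm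
    exact congrArg (mfderiv (𝓡 (n + 1)) (𝓡 (n + 2)) φ (e.symm (ψ z))) h2
  refine ⟨ψ.trans e.symm, ε, ⟨⟨Metric.isOpen_ball, hsrc'.trans hsrc, ?_, ?_⟩, hε, ?_, ?_⟩, ?_⟩
  · rw [hsrc']
    intro z hz
    exact (ContMDiffAt.comp z (he (ψ z) (htgt (ψ.map_source hz)))
      (hψ.contDiffAt (ψ.open_source.mem_nhds hz)).contMDiffAt).contMDiffWithinAt
  · intro x hx
    rw [OpenPartialHomeomorph.trans_target] at hx
    have h1 : x ∈ e.source := hx.1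
    have h2 : e x ∈ ψ.target := hx.2
    exact (ContMDiffAt.comp x (hψs.contDiffAt (ψ.open_target.mem_nhds h2)).contMDiffAt
      (contMDiffAt_of_mem_maximalAtlas (IsManifold.chart_mem_maximalAtlas p)
        h1)).contMDiffWithinAt
  · intro z hz
    rw [hsrc'] at hz
    rw [hd z hz, (hψd z hz).1]
    exact hτT _ (htgt (ψ.map_source hz))
  · intro z hz ξ
    rw [hsrc'] at hz
    rw [hd z hz]
    exact (hFV _ (htgt (ψ.map_source hz)) _).trans ((hψd z hz).2 ξ)
  · have h0 : ((0 : ℝ), (0 : EuclideanSpace ℝ (Fin n))) ∈ (ψ.trans e.symm).source := by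
      rw [hsrc', hsrc]
      exact ⟨⟨by simpa using hε, hε⟩, Metric.mem_ball_self hε⟩
    have h1 := (ψ.trans e.symm).map_source h0
    have h2 : (ψ.trans e.symm) (0, 0) = p :=
      (congrArg e.symm hψ0).trans (e.left_inv (mem_chart_source _ p))
    rwa [h2] at h1

end AdaptedChartHypersurface

section Products

open Set Filter Topology

set_option linter.unusedSectionVars false

variable {n : ℕ}
  {M : Type*} [TopologicalSpace M] [ChartedSpace (EuclideanSpace ℝ (Fin (n + 2))) M]
  [IsManifold (𝓡 (n + 2)) ∞ M]
  [RiemannianBundle (fun x : M ↦ TangentSpace (𝓡 (n + 2)) x)]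
  [IsContMDiffRiemannianBundle (𝓡 (n + 2)) ∞ (EuclideanSpace ℝ (Fin (n + 2)))
    (fun x : M ↦ TangentSpace (𝓡 (n + 2)) x)]
  {N : Type*} [TopologicalSpace N] [ChartedSpace (EuclideanSpace ℝ (Fin (n + 1))) N]
  [IsManifold (𝓡 (n + 1)) ∞ N]
  {V : ∀ p : M, TangentSpace (𝓡 (n + 2)) p} {f : M → ℝ}
  {φ : N → M} {U : ∀ x : N, TangentSpace (𝓡 (n + 2)) (φ x)} {θ : ℝ} {δ : N → ℝ}
  {ψ : OpenPartialHomeomorph (ℝ × EuclideanSpace ℝ (Fin n)) N} {ε : ℝ}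
  {z : ℝ × EuclideanSpace ℝ (Fin n)}

theorem IsAdaptedChart.mk_mem_source (hA : IsAdaptedChart V φ U ψ ε) {s : ℝ}
    (hs : s ∈ Ioo (-ε) ε) {q : EuclideanSpace ℝ (Fin n)} (hq : q ∈ Metric.ball 0 ε) :
    (s, q) ∈ ψ.source := by
  rw [hA.source_eq]
  exact ⟨hs, hq⟩

theorem IsAdaptedChart.contMDiffAt (hA : IsAdaptedChart V φ U ψ ε) (hz : z ∈ ψ.source) :
    ContMDiffAt 𝓘(ℝ, ℝ × EuclideanSpace ℝ (Fin n)) (𝓡 (n + 1)) ∞ ψ z :=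
  hA.smooth.contMDiffAt (ψ.open_source.mem_nhds hz)

theorem IsAdaptedChart.mdifferentiableAt (hA : IsAdaptedChart V φ U ψ ε) (hz : z ∈ ψ.source) :
    MDifferentiableAt 𝓘(ℝ, ℝ × EuclideanSpace ℝ (Fin n)) (𝓡 (n + 1)) ψ z :=
  (hA.contMDiffAt hz).mdifferentiableAt (by simp)

theorem IsAdaptedChart.contMDiffAt_comp (hA : IsAdaptedChart V φ U ψ ε)
    (hN : IsConstantAngleHypersurface V φ U θ) (hz : z ∈ ψ.source) :
    ContMDiffAt 𝓘(ℝ, ℝ × EuclideanSpace ℝ (Fin n)) (𝓡 (n + 2)) ∞ (fun y ↦ φ (ψ y)) z :=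
  hN.smooth.contMDiffAt.comp z (hA.contMDiffAt hz)

theorem IsAdaptedChart.mfderiv_comp_fst (hA : IsAdaptedChart V φ U ψ ε)
    (hN : IsConstantAngleHypersurface V φ U θ) (hz : z ∈ ψ.source) :
    mfderiv 𝓘(ℝ, ℝ × EuclideanSpace ℝ (Fin n)) (𝓡 (n + 2)) (fun y ↦ φ (ψ y)) z
      ((1, 0) : ℝ × EuclideanSpace ℝ (Fin n)) = unitTangentialPart V φ U (ψ z) :=
  (hN.mfderiv_comp (hA.mdifferentiableAt hz) _).trans (hA.mfderiv_fst z hz)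

theorem IsAdaptedChart.inner_mfderiv_comp_snd (hA : IsAdaptedChart V φ U ψ ε)
    (hN : IsConstantAngleHypersurface V φ U θ) (hz : z ∈ ψ.source)
    (ξ : EuclideanSpace ℝ (Fin n)) :
    inner ℝ (mfderiv 𝓘(ℝ, ℝ × EuclideanSpace ℝ (Fin n)) (𝓡 (n + 2)) (fun y ↦ φ (ψ y)) z
      ((0, ξ) : ℝ × EuclideanSpace ℝ (Fin n))) (unitTangentialPart V φ U (ψ z)) = 0 := by
  have h1 := hN.mfderiv_comp (hA.mdifferentiableAt hz) ((0, ξ) : ℝ × EuclideanSpace ℝ (Fin n))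
  rw [h1]
  exact hA.inner_mfderiv_snd z hz ξ

theorem IsAdaptedChart.injective_mfderiv_comp (hA : IsAdaptedChart V φ U ψ ε)
    (hN : IsConstantAngleHypersurface V φ U θ) (hz : z ∈ ψ.source) :
    Function.Injective (mfderiv 𝓘(ℝ, ℝ × EuclideanSpace ℝ (Fin n)) (𝓡 (n + 2))
      (fun y ↦ φ (ψ y)) z) := fun X Y h ↦
  hA.injective_mfderiv hz (hN.immersion (ψ z)
    ((hN.mfderiv_comp (hA.mdifferentiableAt hz) X).symm.trans
      (h.trans (hN.mfderiv_comp (hA.mdifferentiableAt hz) Y))))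

/-- The metric induced on the slices of a product. -/
def sliceMetric (F : ℝ × EuclideanSpace ℝ (Fin n) → M) (z : ℝ × EuclideanSpace ℝ (Fin n)) :
    EuclideanSpace ℝ (Fin n) →L[ℝ] EuclideanSpace ℝ (Fin n) →L[ℝ] ℝ :=
  (pullbackMetric (E := EuclideanSpace ℝ (Fin (n + 2))) F z).bilinearComp
    (ContinuousLinearMap.inr ℝ ℝ _) (ContinuousLinearMap.inr ℝ ℝ _)

theorem sliceMetric_apply (F : ℝ × EuclideanSpace ℝ (Fin n) → M)
    (z : ℝ × EuclideanSpace ℝ (Fin n)) (ξ η : EuclideanSpace ℝ (Fin n)) :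
    sliceMetric F z ξ η = inner ℝ
      (mfderiv 𝓘(ℝ, ℝ × EuclideanSpace ℝ (Fin n)) (𝓡 (n + 2)) F z
        ((0, ξ) : ℝ × EuclideanSpace ℝ (Fin n)))
      (mfderiv 𝓘(ℝ, ℝ × EuclideanSpace ℝ (Fin n)) (𝓡 (n + 2)) F z
        ((0, η) : ℝ × EuclideanSpace ℝ (Fin n))) := rfl

theorem sliceMetric_comm (F : ℝ × EuclideanSpace ℝ (Fin n) → M)
    (z : ℝ × EuclideanSpace ℝ (Fin n)) (ξ η : EuclideanSpace ℝ (Fin n)) :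
    sliceMetric F z ξ η = sliceMetric F z η ξ := by
  rw [sliceMetric_apply, sliceMetric_apply]
  exact real_inner_comm _ _

theorem IsAdaptedChart.sliceMetric_pos (hA : IsAdaptedChart V φ U ψ ε)
    (hN : IsConstantAngleHypersurface V φ U θ) (hz : z ∈ ψ.source)
    {ξ : EuclideanSpace ℝ (Fin n)} (hξ : ξ ≠ 0) :
    0 < sliceMetric (fun y ↦ φ (ψ y)) z ξ ξ := by
  rw [sliceMetric_apply]
  refine real_inner_self_pos.2 fun h ↦ hξ ?_
  have h1 := hA.injective_mfderiv_comp hN hz (h.trans (map_zero _).symm)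
  exact congrArg Prod.snd h1

theorem IsAdaptedChart.contDiffOn_sliceMetric (hA : IsAdaptedChart V φ U ψ ε)
    (hN : IsConstantAngleHypersurface V φ U θ) :
    ContDiffOn ℝ ∞ (sliceMetric fun y ↦ φ (ψ y)) ψ.source := by
  have h1 := contDiffOn_pullbackMetric fun z hz ↦ hA.contMDiffAt_comp hN hz
  refine contDiffOn_clm_apply.2 fun ξ ↦ contDiffOn_clm_apply.2 fun η ↦ ?_
  exact contDiffOn_clm_apply.1 (contDiffOn_clm_apply.1 h1 (0, ξ)) (0, η)

theorem IsAdaptedChart.hasDerivAt_sliceMetric (hA : IsAdaptedChart V φ U ψ ε)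
    (hN : IsConstantAngleHypersurface V φ U θ) (hV : IsUnitAntiTorqued (𝓡 (n + 2)) V f)
    (hδ : ShapeOperatorIsScalarOnPerp V φ U δ) {s : ℝ} {q : EuclideanSpace ℝ (Fin n)}
    (hz : (s, q) ∈ ψ.source) (ξ η : EuclideanSpace ℝ (Fin n)) :
    HasDerivAt (fun t ↦ sliceMetric (fun y ↦ φ (ψ y)) (t, q) ξ η)
      (2 * (Real.cot θ * δ (ψ (s, q)) + f (φ (ψ (s, q))) / Real.sin θ) *
        sliceMetric (fun y ↦ φ (ψ y)) (s, q) ξ η) s := by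
  have hF := hA.contMDiffAt_comp hN hz
  have hcov (ζ : EuclideanSpace ℝ (Fin n)) :
      covDerivAlong (𝓡 (n + 2)) 𝓘(ℝ, ℝ × EuclideanSpace ℝ (Fin n)) (fun y ↦ φ (ψ y))
        (fun y ↦ mfderiv 𝓘(ℝ, ℝ × EuclideanSpace ℝ (Fin n)) (𝓡 (n + 2)) (fun y ↦ φ (ψ y)) y
          ((0, ζ) : ℝ × EuclideanSpace ℝ (Fin n))) (s, q)
        ((1, 0) : ℝ × EuclideanSpace ℝ (Fin n)) =
      (Real.cot θ * δ (ψ (s, q)) + f (φ (ψ (s, q))) / Real.sin θ) •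
        mfderiv 𝓘(ℝ, ℝ × EuclideanSpace ℝ (Fin n)) (𝓡 (n + 2)) (fun y ↦ φ (ψ y)) (s, q)
          ((0, ζ) : ℝ × EuclideanSpace ℝ (Fin n)) := by
    rw [covDerivAlong_mfderiv_comm hF]
    have h1 : ∀ᶠ y in 𝓝 (s, q), mfderiv 𝓘(ℝ, ℝ × EuclideanSpace ℝ (Fin n)) (𝓡 (n + 2))
        (fun y ↦ φ (ψ y)) y ((1, 0) : ℝ × EuclideanSpace ℝ (Fin n)) =
          unitTangentialPart V φ U (ψ y) := by
      filter_upwards [ψ.open_source.mem_nhds hz] with y hy using hA.mfderiv_comp_fst hN hy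
    rw [covDerivAlong_congr h1]
    exact hN.covDerivAlong_unitTangentialPart hV hδ (hA.mdifferentiableAt hz)
      (hA.inner_mfderiv_comp_snd hN hz ζ)
  have h2 := fderiv_inner_along
    (diffAlong_mfderiv_apply hF ((0, ξ) : ℝ × EuclideanSpace ℝ (Fin n)))
    (diffAlong_mfderiv_apply hF ((0, η) : ℝ × EuclideanSpace ℝ (Fin n)))
    ((1, 0) : ℝ × EuclideanSpace ℝ (Fin n))
  rw [hcov, hcov, real_inner_smul_left, real_inner_smul_right, ← sliceMetric_apply] at h2
  have h3 := (contDiffAt_inner_along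
    (contMDiffAt_mfderiv_apply hF ((0, ξ) : ℝ × EuclideanSpace ℝ (Fin n)))
    (contMDiffAt_mfderiv_apply hF ((0, η) : ℝ × EuclideanSpace ℝ (Fin n)))).differentiableAt
    (by simp)
  have h4 : HasDerivAt (fun t : ℝ ↦ (t, q)) ((1, 0) : ℝ × EuclideanSpace ℝ (Fin n)) s :=
    (hasDerivAt_id s).prodMk (hasDerivAt_const s q)
  have h5 := HasFDerivAt.comp_hasDerivAt s h3.hasFDerivAt h4
  rw [h2] at h5
  refine h5.congr_deriv ?_
  ring

theorem IsAdaptedChart.sliceMetric_mul (hA : IsAdaptedChart V φ U ψ ε)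
    (hN : IsConstantAngleHypersurface V φ U θ) (hV : IsUnitAntiTorqued (𝓡 (n + 2)) V f)
    (hδ : ShapeOperatorIsScalarOnPerp V φ U δ) {s : ℝ} (hs : s ∈ Ioo (-ε) ε)
    {q : EuclideanSpace ℝ (Fin n)} (hq : q ∈ Metric.ball 0 ε) {e : EuclideanSpace ℝ (Fin n)}
    (he : e ≠ 0) (ξ η : EuclideanSpace ℝ (Fin n)) :
    sliceMetric (fun y ↦ φ (ψ y)) (s, q) ξ η = sliceMetric (fun y ↦ φ (ψ y)) (s, q) e e /
      sliceMetric (fun y ↦ φ (ψ y)) (0, q) e e * sliceMetric (fun y ↦ φ (ψ y)) (0, q) ξ η := by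
  have h0 : (0 : ℝ) ∈ Ioo (-ε) ε := ⟨by simpa using hA.pos, hA.pos⟩
  have hpos (t : ℝ) (ht : t ∈ Ioo (-ε) ε) : sliceMetric (fun y ↦ φ (ψ y)) (t, q) e e ≠ 0 :=
    (hA.sliceMetric_pos hN (hA.mk_mem_source ht hq) he).ne'
  have hd (t : ℝ) (ht : t ∈ Ioo (-ε) ε) :
      HasDerivAt (fun t ↦ sliceMetric (fun y ↦ φ (ψ y)) (t, q) ξ η /
        sliceMetric (fun y ↦ φ (ψ y)) (t, q) e e) 0 t := by
    have h1 := hA.hasDerivAt_sliceMetric hN hV hδ (hA.mk_mem_source ht hq) ξ η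
    have h2 := hA.hasDerivAt_sliceMetric hN hV hδ (hA.mk_mem_source ht hq) e e
    refine (h1.fun_div h2 (hpos t ht)).congr_deriv ?_
    rw [div_eq_zero_iff]
    left
    ring
  have hc := isOpen_Ioo.is_const_of_deriv_eq_zero isPreconnected_Ioo
    (fun t ht ↦ (hd t ht).differentiableAt.differentiableWithinAt)
    (fun t ht ↦ (hd t ht).deriv) hs h0
  have hs0 := hpos s hs
  have h00 := hpos 0 h0
  rw [div_eq_div_iff hs0 h00] at hc
  rw [div_mul_eq_mul_div, eq_div_iff h00, hc, mul_comm]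

/-- An adapted chart is a twisted product chart, with twisting function one at `s = 0`. -/
theorem IsAdaptedChart.exists_isTwistedProductChart (hn : 0 < n) (hA : IsAdaptedChart V φ U ψ ε)
    (hN : IsConstantAngleHypersurface V φ U θ) (hV : IsUnitAntiTorqued (𝓡 (n + 2)) V f)
    (hδ : ShapeOperatorIsScalarOnPerp V φ U δ) :
    ∃ h lam, IsTwistedProductChart φ ψ (-ε) ε (Metric.ball 0 ε) h lam ∧
      (∀ q ∈ Metric.ball 0 ε, lam (0, q) = 1) ∧
      ∀ s ∈ Ioo (-ε) ε, ∀ q ∈ Metric.ball 0 ε,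
        HasDerivAt (fun t ↦ Real.log (lam (t, q)))
          (Real.cot θ * δ (ψ (s, q)) + f (φ (ψ (s, q))) / Real.sin θ) s := by
  have h0 : (0 : ℝ) ∈ Ioo (-ε) ε := ⟨by simpa using hA.pos, hA.pos⟩
  have : NeZero n := ⟨hn.ne'⟩
  let e : EuclideanSpace ℝ (Fin n) := EuclideanSpace.single 0 1
  have he : e ≠ 0 := by
    intro h
    have h1 : ‖e‖ = 1 := by simp [e]
    rw [h, norm_zero] at h1
    exact zero_ne_one h1
  let B := sliceMetric fun y ↦ φ (ψ y)
  let r : ℝ × EuclideanSpace ℝ (Fin n) → ℝ := fun z ↦ B z e e / B (0, z.2) e e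
  have hBpos (t : ℝ) (ht : t ∈ Ioo (-ε) ε) (q) (hq : q ∈ Metric.ball 0 ε) : 0 < B (t, q) e e :=
    hA.sliceMetric_pos hN (hA.mk_mem_source ht hq) he
  have hrpos (z : ℝ × EuclideanSpace ℝ (Fin n)) (hz : z ∈ Ioo (-ε) ε ×ˢ Metric.ball 0 ε) :
      0 < r z := div_pos (hBpos z.1 hz.1 z.2 hz.2) (hBpos 0 h0 z.2 hz.2)
  have hB : ContDiffOn ℝ ∞ B (Ioo (-ε) ε ×ˢ Metric.ball 0 ε) := by
    rw [← hA.source_eq]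
    exact hA.contDiffOn_sliceMetric hN
  have hBe : ContDiffOn ℝ ∞ (fun z ↦ B z e e) (Ioo (-ε) ε ×ˢ Metric.ball 0 ε) :=
    contDiffOn_clm_apply.1 (contDiffOn_clm_apply.1 hB e) e
  have hr : ContDiffOn ℝ ∞ r (Ioo (-ε) ε ×ˢ Metric.ball 0 ε) := by
    refine hBe.div (hBe.comp (contDiff_const.prodMk contDiff_snd).contDiffOn
      fun z hz ↦ ⟨h0, hz.2⟩) fun z hz ↦ (hBpos 0 h0 z.2 hz.2).ne'
  refine ⟨fun q ↦ B (0, q), fun z ↦ Real.sqrt (r z),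
    ⟨hA.toIsProductChart, ⟨?_, ?_, ?_⟩, ?_, ?_, ?_⟩, ?_, ?_⟩
  · exact hB.comp (contDiff_const.prodMk contDiff_id).contDiffOn fun q hq ↦ ⟨h0, hq⟩
  · exact fun q _ ξ η ↦ sliceMetric_comm _ _ ξ η
  · exact fun q hq ξ hξ ↦ hA.sliceMetric_pos hN (hA.mk_mem_source h0 hq) hξ
  · exact hr.sqrt fun z hz ↦ (hrpos z hz).ne'
  · exact fun z hz ↦ Real.sqrt_pos.2 (hrpos z hz)
  · intro z hz X Y
    have hz' : z ∈ ψ.source := by rwa [hA.source_eq]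
    have h1 (X : ℝ × EuclideanSpace ℝ (Fin n)) :
        mfderiv (𝓡 (n + 1)) (𝓡 (n + 2)) φ (ψ z)
          (mfderiv 𝓘(ℝ, ℝ × EuclideanSpace ℝ (Fin n)) (𝓡 (n + 1)) ψ z X) =
        X.1 • unitTangentialPart V φ U (ψ z) +
          mfderiv 𝓘(ℝ, ℝ × EuclideanSpace ℝ (Fin n)) (𝓡 (n + 2)) (fun y ↦ φ (ψ y)) z
            ((0, X.2) : ℝ × EuclideanSpace ℝ (Fin n)) := by
      rw [← hA.mfderiv_comp_fst hN hz']
      refine (hN.mfderiv_comp (hA.mdifferentiableAt hz') X).symm.trans ?_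
      have h2 : X = X.1 • ((1, 0) : ℝ × EuclideanSpace ℝ (Fin n)) + (0, X.2) := by
        ext <;> simp
      conv_lhs => rw [h2]
      exact (map_add _ _ _).trans (congrArg₂ _ (map_smul _ _ _) rfl)
    have h3 := hA.inner_mfderiv_comp_snd hN hz'
    have h4 := hA.sliceMetric_mul hN hV hδ hz.1 hz.2 he X.2 Y.2
    rw [inducedMetric, h1, h1, inner_add_left, inner_add_right, inner_add_right,
      real_inner_smul_left, real_inner_smul_right, hN.inner_unitTangentialPart_self,
      real_inner_smul_left, real_inner_comm, h3, real_inner_smul_right, h3,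
      ← sliceMetric_apply, Real.sq_sqrt (hrpos z hz).le]
    simp only [mul_one, mul_zero, zero_add, add_zero]
    exact congrArg _ h4
  · intro q hq
    simp only [r]
    rw [div_self (hBpos 0 h0 q hq).ne', Real.sqrt_one]
  · intro s hs q hq
    have h1 := hA.hasDerivAt_sliceMetric hN hV hδ (hA.mk_mem_source hs hq) e e
    have h2 := ((h1.div_const (B (0, q) e e)).sqrt (hrpos (s, q) ⟨hs, hq⟩).ne').log
      (Real.sqrt_pos.2 (hrpos (s, q) ⟨hs, hq⟩)).ne'
    refine h2.congr_deriv ?_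
    have h3 := (hBpos 0 h0 q hq).ne'
    have h4 := (hBpos s hs q hq).ne'
    rw [div_div, mul_assoc 2 (√_), Real.mul_self_sqrt (hrpos (s, q) ⟨hs, hq⟩).le]
    have h5 : r (s, q) = B (s, q) e e / B (0, q) e e := rfl
    rw [h5]
    simp only [B] at h3 h4 ⊢
    field_simp

theorem IsAdaptedChart.mfderiv_comp_comp (hA : IsAdaptedChart V φ U ψ ε)
    (hN : IsConstantAngleHypersurface V φ U θ) {E' : Type*} [NormedAddCommGroup E']
    [NormedSpace ℝ E'] {ι : E' → ℝ × EuclideanSpace ℝ (Fin n)}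
    {ι' : E' →L[ℝ] ℝ × EuclideanSpace ℝ (Fin n)} {y : E'} (hι : HasFDerivAt ι ι' y)
    (hy : ι y ∈ ψ.source) (ξ : E') :
    mfderiv 𝓘(ℝ, E') (𝓡 (n + 2)) (fun y ↦ φ (ψ (ι y))) y ξ =
      mfderiv 𝓘(ℝ, ℝ × EuclideanSpace ℝ (Fin n)) (𝓡 (n + 2)) (fun y ↦ φ (ψ y)) (ι y) (ι' ξ) := by
  have h1 := mfderiv_comp_apply y ((hA.contMDiffAt_comp hN hy).mdifferentiableAt (by simp))
    hι.differentiableAt.mdifferentiableAt ξ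
  refine h1.trans (congrArg _ ?_)
  exact congrArg (fun A : E' →L[ℝ] ℝ × EuclideanSpace ℝ (Fin n) ↦ A ξ)
    (mfderiv_eq_fderiv.trans hι.fderiv)

theorem IsAdaptedChart.isGeodesicOn (hA : IsAdaptedChart V φ U ψ ε)
    (hN : IsConstantAngleHypersurface V φ U θ) (hV : IsUnitAntiTorqued (𝓡 (n + 2)) V f)
    (hθ : Real.cos θ = 0) {q : EuclideanSpace ℝ (Fin n)} (hq : q ∈ Metric.ball 0 ε) :
    IsGeodesicOn (𝓡 (n + 2)) (fun s ↦ φ (ψ (s, q))) (Ioo (-ε) ε) := by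
  have hι (s : ℝ) : HasFDerivAt (fun t : ℝ ↦ (t, q))
      (ContinuousLinearMap.inl ℝ ℝ (EuclideanSpace ℝ (Fin n))) s :=
    hasFDerivAt_prodMk_left s q
  have hγ (s : ℝ) (hs : s ∈ Ioo (-ε) ε) :
      ContMDiffAt 𝓘(ℝ, ℝ) (𝓡 (n + 2)) ∞ (fun s ↦ φ (ψ (s, q))) s :=
    ContMDiffAt.comp s (hA.contMDiffAt_comp hN (hA.mk_mem_source hs hq))
      (f := fun t : ℝ ↦ (t, q)) (contDiffAt_id.prodMk contDiffAt_const).contMDiffAt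
  have hTV (x : N) : unitTangentialPart V φ U x = V (φ x) := by
    have h1 : Real.sin θ = 1 := by
      have h2 := Real.sin_sq_add_cos_sq θ
      rw [hθ] at h2
      nlinarith [hN.sin_pos hV x]
    rw [hN.unitTangentialPart_eq hV, h1, Real.cot_eq_cos_div_sin, hθ]
    simp
  have hγ' (s : ℝ) (hs : s ∈ Ioo (-ε) ε) :
      mfderiv 𝓘(ℝ, ℝ) (𝓡 (n + 2)) (fun s ↦ φ (ψ (s, q))) s (1 : ℝ) = V (φ (ψ (s, q))) := by
    refine (hA.mfderiv_comp_comp hN (hι s) (hA.mk_mem_source hs hq) 1).trans ?_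
    rw [← hTV, ← hA.mfderiv_comp_fst hN (hA.mk_mem_source hs hq)]
    rfl
  refine ⟨fun s hs ↦ (hγ s hs).contMDiffWithinAt, fun s hs ↦ ?_⟩
  have h1 : ∀ᶠ t in 𝓝 s, mfderiv 𝓘(ℝ, ℝ) (𝓡 (n + 2)) (fun s ↦ φ (ψ (s, q))) t (1 : ℝ) =
      V (φ (ψ (t, q))) := by
    filter_upwards [isOpen_Ioo.mem_nhds hs] with t ht using hγ' t ht
  have hVV : inner ℝ (V (φ (ψ (s, q)))) (V (φ (ψ (s, q)))) = 1 := by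
    rw [real_inner_self_eq_norm_sq, hV.unit, one_pow]
  have h2 := hV.covDerivAlong_eq ((hγ s hs).mdifferentiableAt (by simp)) (1 : ℝ)
  rw [hγ' s hs, hVV, one_smul, sub_self, smul_zero] at h2
  exact (covDerivAlong_congr h1 _).trans h2

/-- In a conformally flat ambient space, `δ` and `f` depend on `s` only along an adapted chart. -/
theorem IsAdaptedChart.eq_of_isConformallyFlatChart (hn : 2 ≤ n) (hA : IsAdaptedChart V φ U ψ ε)
    (hN : IsConstantAngleHypersurface V φ U θ) (hV : IsUnitAntiTorqued (𝓡 (n + 2)) V f)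
    (hδ : ShapeOperatorIsScalarOnPerp V φ U δ) {Φ : M → EuclideanSpace ℝ (Fin (n + 2))}
    {c : EuclideanSpace ℝ (Fin (n + 2))} {d : ℝ} (h : IsConformallyFlatChart Φ c d) {s : ℝ}
    (hs : s ∈ Ioo (-ε) ε) {q q' : EuclideanSpace ℝ (Fin n)} (hq : q ∈ Metric.ball 0 ε)
    (hq' : q' ∈ Metric.ball 0 ε) :
    δ (ψ (s, q)) = δ (ψ (s, q')) ∧ f (φ (ψ (s, q))) = f (φ (ψ (s, q'))) := by
  have hfin : 2 ≤ Module.finrank ℝ (EuclideanSpace ℝ (Fin n)) := by simpa using hn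
  have hι (x : EuclideanSpace ℝ (Fin n)) : HasFDerivAt (fun q : EuclideanSpace ℝ (Fin n) ↦ (s, q))
      (ContinuousLinearMap.inr ℝ ℝ (EuclideanSpace ℝ (Fin n))) x :=
    hasFDerivAt_prodMk_right s x
  have hg (x) (hx : x ∈ Metric.ball 0 ε) : ContMDiffAt (𝓡 n) (𝓡 (n + 1)) ∞ (fun q ↦ ψ (s, q)) x :=
    (hA.contMDiffAt (hA.mk_mem_source hs hx)).comp x
      (contDiffAt_const.prodMk contDiffAt_id).contMDiffAt
  have hgd (x) (hx : x ∈ Metric.ball 0 ε) : MDifferentiableAt (𝓡 n) (𝓡 (n + 1))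
      (fun q ↦ ψ (s, q)) x := (hg x hx).mdifferentiableAt (by simp)
  have hD (x) (hx : x ∈ Metric.ball 0 ε) (ξ : EuclideanSpace ℝ (Fin n)) :
      mfderiv (𝓡 n) (𝓡 (n + 2)) (fun q ↦ φ (ψ (s, q))) x ξ =
        mfderiv 𝓘(ℝ, ℝ × EuclideanSpace ℝ (Fin n)) (𝓡 (n + 2)) (fun y ↦ φ (ψ y)) (s, x)
          ((0, ξ) : ℝ × EuclideanSpace ℝ (Fin n)) :=
    hA.mfderiv_comp_comp hN (hι x) (hA.mk_mem_source hs hx) ξ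
  have hT (x) (hx : x ∈ Metric.ball 0 ε) (ξ : EuclideanSpace ℝ (Fin n)) :
      inner ℝ (mfderiv (𝓡 n) (𝓡 (n + 2)) (fun q ↦ φ (ψ (s, q))) x ξ)
        (unitTangentialPart V φ U (ψ (s, x))) = 0 := by
    have h1 := hA.inner_mfderiv_comp_snd hN (hA.mk_mem_source hs hx) ξ
    rw [← hD x hx] at h1
    exact h1
  have hinj (x) (hx : x ∈ Metric.ball 0 ε) :
      Function.Injective (mfderiv (𝓡 n) (𝓡 (n + 2)) (fun q ↦ φ (ψ (s, q))) x) := fun ξ η hξη ↦ by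
    have h1 := hA.injective_mfderiv_comp hN (hA.mk_mem_source hs hx)
      ((hD x hx ξ).symm.trans (hξη.trans (hD x hx η)))
    exact congrArg Prod.snd h1
  have hconst (a : EuclideanSpace ℝ (Fin n) → ℝ)
      (ha : ∀ x ∈ Metric.ball 0 ε, HasFDerivAt a (0 : EuclideanSpace ℝ (Fin n) →L[ℝ] ℝ) x) :
      a q = a q' :=
    Metric.isOpen_ball.is_const_of_fderiv_eq_zero (convex_ball 0 ε).isPreconnected
      (fun x hx ↦ (ha x hx).differentiableAt.differentiableWithinAt)
      (fun x hx ↦ (ha x hx).fderiv) hq hq'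
  constructor
  · refine neg_injective (hconst (fun x ↦ -δ (ψ (s, x))) fun x hx ↦ ?_)
    refine h.hasFDerivAt_zero hfin Metric.isOpen_ball (F := fun q ↦ φ (ψ (s, q)))
      (Y := fun q ↦ U (ψ (s, q))) (fun y hy ↦ ContMDiffAt.comp y hN.smooth_normal.contMDiffAt
        (hg y hy)) hinj (fun y hy ξ ↦ ?_)
      (fun y hy ξ ↦ hN.covDerivAlong_normal hδ (hgd y hy) (hT y hy ξ)) hx
    rw [hN.mfderiv_comp (hgd y hy)]
    exact hN.normal _ _
  · refine hconst (fun x ↦ f (φ (ψ (s, x)))) fun x hx ↦ ?_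
    exact h.hasFDerivAt_zero hfin Metric.isOpen_ball (F := fun q ↦ φ (ψ (s, q)))
      (Y := fun q ↦ V (φ (ψ (s, q)))) (fun y hy ↦ ContMDiffAt.comp y hV.smooth.contMDiffAt
        (ContMDiffAt.comp y hN.smooth.contMDiffAt (hg y hy))) hinj
      (fun y hy ξ ↦ (hN.covDerivAlong_axis hV (hgd y hy) (hT y hy ξ)).1)
      (fun y hy ξ ↦ (hN.covDerivAlong_axis hV (hgd y hy) (hT y hy ξ)).2) hx

theorem IsConstantAngleHypersurface.isTwistedProductNear (hn : 0 < n)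
    (hN : IsConstantAngleHypersurface V φ U θ) (hV : IsUnitAntiTorqued (𝓡 (n + 2)) V f)
    (hδ : ShapeOperatorIsScalarOnPerp V φ U δ) (p : N) :
    IsTwistedProductNear (n := n) V φ U
      (fun x ↦ Real.cot θ * δ x + f (φ x) / Real.sin θ) p := by
  obtain ⟨ψ, ε, hA, hp⟩ := hN.exists_isAdaptedChart hV p
  obtain ⟨h, lam, htw, -, hlog⟩ := hA.exists_isTwistedProductChart hn hN hV hδ
  exact ⟨ψ, -ε, ε, Metric.ball 0 ε, h, lam, htw, hp, fun s hs q hq ↦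
    ⟨hA.mfderiv_fst _ (hA.mk_mem_source hs hq), hlog s hs q hq⟩⟩

theorem IsConstantAngleHypersurface.isRuledNear
    (hN : IsConstantAngleHypersurface V φ U θ) (hV : IsUnitAntiTorqued (𝓡 (n + 2)) V f)
    (hθ : Real.cos θ = 0) (p : N) : IsRuledNear (n := n) φ p := by
  obtain ⟨ψ, ε, hA, hp⟩ := hN.exists_isAdaptedChart hV p
  exact ⟨ψ, -ε, ε, Metric.ball 0 ε, hA.toIsProductChart, hp,
    fun q hq ↦ hA.isGeodesicOn hN hV hθ hq⟩

theorem IsConstantAngleHypersurface.isWarpedProductNear (hn : 2 ≤ n)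
    (hN : IsConstantAngleHypersurface V φ U θ) (hV : IsUnitAntiTorqued (𝓡 (n + 2)) V f)
    (hδ : ShapeOperatorIsScalarOnPerp V φ U δ) {Φ : M → EuclideanSpace ℝ (Fin (n + 2))}
    {c : EuclideanSpace ℝ (Fin (n + 2))} {d : ℝ} (hΦ : IsConformallyFlatChart Φ c d) (p : N) :
    IsWarpedProductNear (n := n) V φ U
      (fun x ↦ Real.cot θ * δ x + f (φ x) / Real.sin θ) p := by
  obtain ⟨ψ, ε, hA, hp⟩ := hN.exists_isAdaptedChart hV p
  obtain ⟨h, lam, htw, hlam, hlog⟩ := hA.exists_isTwistedProductChart (by omega) hN hV hδ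
  have h0 : (0 : ℝ) ∈ Ioo (-ε) ε := ⟨by simpa using hA.pos, hA.pos⟩
  have h0b : (0 : EuclideanSpace ℝ (Fin n)) ∈ Metric.ball 0 ε := Metric.mem_ball_self hA.pos
  have hlog' (s) (hs : s ∈ Ioo (-ε) ε) (q) (hq : q ∈ Metric.ball 0 ε) :
      HasDerivAt (fun t ↦ Real.log (lam (t, 0)))
        (Real.cot θ * δ (ψ (s, q)) + f (φ (ψ (s, q))) / Real.sin θ) s := by
    obtain ⟨h1, h2⟩ := hA.eq_of_isConformallyFlatChart hn hN hV hδ hΦ hs hq h0b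
    rw [h1, h2]
    exact hlog s hs 0 h0b
  have heq (s) (hs : s ∈ Ioo (-ε) ε) (q) (hq : q ∈ Metric.ball 0 ε) :
      lam (s, q) = lam (s, 0) := by
    have hd (t) (ht : t ∈ Ioo (-ε) ε) :=
      (hlog t ht q hq).fun_sub (hlog' t ht q hq)
    have hc := isOpen_Ioo.is_const_of_deriv_eq_zero isPreconnected_Ioo
      (fun t ht ↦ (hd t ht).differentiableAt.differentiableWithinAt)
      (fun t ht ↦ (hd t ht).deriv.trans (sub_self _)) hs h0
    simp only [hlam q hq, hlam 0 h0b, sub_self] at hc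
    exact Real.log_injOn_pos (htw.lam_pos (s, q) ⟨hs, hq⟩) (htw.lam_pos (s, 0) ⟨hs, h0b⟩)
      (sub_eq_zero.1 hc)
  refine ⟨ψ, -ε, ε, Metric.ball 0 ε, h, fun s ↦ lam (s, 0),
    ⟨htw.toIsProductChart, htw.metric_fiber, ?_, ?_, ?_⟩, hp, fun s hs q hq ↦
    ⟨hA.mfderiv_fst _ (hA.mk_mem_source hs hq), hlog' s hs q hq⟩⟩
  · exact htw.smooth_lam.comp (contDiff_fst.prodMk contDiff_const).contDiffOn
      fun z hz ↦ ⟨hz.1, h0b⟩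
  · exact fun z hz ↦ htw.lam_pos _ ⟨hz.1, h0b⟩
  · intro z hz X Y
    rw [htw.isometry z hz]
    simp only [← heq z.1 hz.1 z.2 hz.2]

theorem IsEuclideanDomain.exists_isConformallyFlatChart (h : IsEuclideanDomain n M) :
    ∃ (Φ : M → EuclideanSpace ℝ (Fin (n + 2))) (c : EuclideanSpace ℝ (Fin (n + 2))) (d : ℝ),
      IsConformallyFlatChart Φ c d := by
  obtain ⟨Φ, hΦ, -, hi⟩ := h
  exact ⟨Φ, 0, 1, hΦ, by simp, fun p v w ↦ by simp [hi p v w]⟩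

theorem IsHyperbolicDomain.exists_isConformallyFlatChart (h : IsHyperbolicDomain n M) :
    ∃ (Φ : M → EuclideanSpace ℝ (Fin (n + 2))) (c : EuclideanSpace ℝ (Fin (n + 2))) (d : ℝ),
      IsConformallyFlatChart Φ c d := by
  obtain ⟨Φ, hΦ, -, hpos, hi⟩ := h
  have h1 (y : EuclideanSpace ℝ (Fin (n + 2))) :
      inner ℝ (EuclideanSpace.single (Fin.last (n + 1)) (1 : ℝ)) y + 0 = y (Fin.last (n + 1)) := by
    simp [EuclideanSpace.inner_single_left]
  refine ⟨Φ, EuclideanSpace.single (Fin.last (n + 1)) 1, 0, hΦ, fun p ↦ ?_, fun p v w ↦ ?_⟩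
  · rw [h1]
    exact (hpos p).ne'
  · rw [h1]
    exact hi p v w

end Products

end ConstantAngle

end

theorem theorem3p9 {n : ℕ} (hn : 3 < n + 2)
    {M : Type*} [TopologicalSpace M] [T2Space M]
    [ChartedSpace (EuclideanSpace ℝ (Fin (n + 2))) M] [IsManifold (𝓡 (n + 2)) ∞ M]
    [RiemannianBundle (fun x : M ↦ TangentSpace (𝓡 (n + 2)) x)]
    [IsContMDiffRiemannianBundle (𝓡 (n + 2)) ∞ (EuclideanSpace ℝ (Fin (n + 2)))
      (fun x : M ↦ TangentSpace (𝓡 (n + 2)) x)]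
    {N : Type*} [TopologicalSpace N] [T2Space N]
    [ChartedSpace (EuclideanSpace ℝ (Fin (n + 1))) N] [IsManifold (𝓡 (n + 1)) ∞ N]
    (V : ∀ p : M, TangentSpace (𝓡 (n + 2)) p) (f : M → ℝ)
    (hV : ConstantAngle.IsUnitAntiTorqued (𝓡 (n + 2)) V f)
    (φ : N → M) (U : ∀ x : N, TangentSpace (𝓡 (n + 2)) (φ x)) (θ : ℝ)
    (hN : ConstantAngle.IsConstantAngleHypersurface V φ U θ)
    (δ : N → ℝ) (hδ : ConstantAngle.ShapeOperatorIsScalarOnPerp V φ U δ) :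
    ((Real.cos θ = 0 ∧ ∀ p : N, ConstantAngle.IsRuledNear (n := n) φ p) ∨
      (Real.cos θ ≠ 0 ∧ ∀ p : N, ConstantAngle.IsTwistedProductNear (n := n) V φ U
        (fun x ↦ Real.cot θ * δ x + f (φ x) / Real.sin θ) p)) ∧
    (ConstantAngle.IsEuclideanDomain n M ∨ ConstantAngle.IsHyperbolicDomain n M →
      ∀ p : N, ConstantAngle.IsWarpedProductNear (n := n) V φ U
        (fun x ↦ Real.cot θ * δ x + f (φ x) / Real.sin θ) p) := by
  refine ⟨?_, fun h p ↦ ?_⟩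
  · by_cases hθ : Real.cos θ = 0
    · exact Or.inl ⟨hθ, hN.isRuledNear hV hθ⟩
    · exact Or.inr ⟨hθ, hN.isTwistedProductNear (by omega) hV hδ⟩
  · obtain ⟨Φ, c, d, hΦ⟩ := h.elim (fun h ↦ h.exists_isConformallyFlatChart)
      fun h ↦ h.exists_isConformallyFlatChart
    exact hN.isWarpedProductNear (by omega) hV hδ hΦ p
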